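/- \textbf{Setting.} Let $n,N\ge 0$ and $0\le N_1\le N$ be integers. Let $\lambda_1,\dots,\lambda_N$ be points of the open upper half plane $\mathbb C^+$ and let $m_1,\dots,m_N\ge 0$ be integers. Assume that $\operatorname{Re}\lambda_k=0$ exactly for $k\le N_1$ (so that $\lambda_k=-\bar\lambda_k$ for these $k$), and that $\lambda_k\ne\lambda_l$, $\lambda_k\ne-\bar\lambda_l$ for $k\neq l$. Let $\mathbf f$ be a $\mathbb C^n$-valued polynomial with $\mathbf f(\lambda_k)\neq\mathbf 0$ for all $k$ and $$\mathbf f^{(m_k-r)}(\lambda_k)=(-1)^{r+1}\,\overline{\mathbf f^{(m_k-r)}(\lambda_k)},\qquad 1\le k\le N_1,\ 0\le r\le m_k .$$ Put $\theta(x,t;\lambda)=\lambda x+4\lambda^3t$, write $(n+1)\times(n+1)$ matrices as $\mathbf M=(\mathbf M_{\rm L},\mathbf M_{\rm R})=\begin{pmatrix}\mathbf M_{\rm UL}&\mathbf M_{\rm UR}\\ \mathbf M_{\rm DL}&\mathbf M_{\rm DR}\end{pmatrix}$ with $\mathbf M_{\rm L}$ the first column and $\mathbf M_{\rm DR}$ of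 size $n\times n$, and let $\bar{\mathbf v}$, $\mathbf v^{\dagger}=\bar{\mathbf v}^{\mathrm T}$ denote complex conjugate and conjugate transpose. \textbf{Reflectionless Riemann--Hilbert problem at $(x,t)$.} Find a matrix function $\mathbf M(\lambda)=\mathbf M(x,t;\lambda)$ that is analytic in $\mathbb C\setminus(\mathbb R\cup\{\pm\lambda_k,\pm\bar\lambda_k\}_{k=1}^N)$, such that: $\mathbf M\to\mathbf I$ as $\lambda\to\infty$, $\lambda\notin\mathbb R$; $\mathbf M$ has continuous boundary values $\mathbf M_\pm$ on $\mathbb R$ from $\mathbb C^\pm$ and $\mathbf M_+=\mathbf M_-$ (reflection coefficient $\gamma\equiv 0$); $\mathbf M$ has poles of order $m_k+1$ at $\pm\lambda_k,\pm\bar\lambda_k$, while $\mathbf M_{\rm R}$ is analytic at $\lambda_k,-\bar\lambda_k$ and $\mathbf M_{\rm L}$ is analytic at $\bar\lambda_k,-\lambda_k$; and, for all $k$ and $0\le r\le m_k$, with all derivatives taken in $\lambda$, \begin{align*} \operatorname*{Res}_{\lambda=\lambda_k}(\lambda-\lambda_k)^{r}\mathbf M&=\Big(\tfrac{[e^{2i\theta}\mathbf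 M_{\rm R}\mathbf f(\lambda)]^{(m_k-r)}|_{\lambda=\lambda_k}}{(m_k-r)!},\mathbf 0\Big),\\ \operatorname*{Res}_{\lambda=-\bar\lambda_k}(\lambda+\bar\lambda_k)^{r}\mathbf M&=\Big(\tfrac{[e^{2i\theta}\mathbf M_{\rm R}\overline{\mathbf f(-\bar\lambda)}]^{(m_k-r)}|_{\lambda=-\bar\lambda_k}}{(-1)^{m_k+1}(m_k-r)!},\mathbf 0\Big),\\ \operatorname*{Res}_{\lambda=\bar\lambda_k}(\lambda-\bar\lambda_k)^{r}\mathbf M&=\Big(\mathbf 0,-\tfrac{[e^{-2i\theta}\mathbf M_{\rm L}\mathbf f(\bar\lambda)^{\dagger}]^{(m_k-r)}|_{\lambda=\bar\lambda_k}}{(m_k-r)!}\Big),\\ \operatorname*{Res}_{\lambda=-\lambda_k}(\lambda+\lambda_k)^{r}\mathbf M&=\Big(\mathbf 0,\tfrac{[e^{-2i\theta}\mathbf M_{\rm L}\mathbf f(-\lambda)^{\mathrm T}]^{(m_k-r)}|_{\lambda=-\lambda_k}}{(-1)^{m_k}(m_k-r)!}\Big). \end{align*} \textbf{The functions $\mathbf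 F_1,\mathbf F_2,\mathbf G_1,\mathbf G_2$.} Put $\mathbf h(\lambda)=e^{2i\theta(x,t;\lambda)}\mathbf f(\lambda)$, $\mathbf h^*(\lambda)=\overline{\mathbf h(\bar\lambda)}$, $\mathbf F_1(\lambda)=-2i\,\mathbf M_{\rm DR}(\lambda)\mathbf h(\lambda)$, $\mathbf F_2(\lambda)=2i\,\mathbf M_{\rm DR}(-\lambda)\mathbf h^*(\lambda)$. Write $D_{kl}[A]_{a,b}=\frac{1}{m_k!\,m_l!}\partial_\mu^{m_k}\partial_\nu^{m_l}A(\mu,\nu)\big|_{\mu=a,\,\nu=b}$ and \begin{align*} \mathbf G_1(\lambda)=\mathbf F_1(\lambda)+2i\mathbf h(\lambda) &+\sum_{k=1}^N\sum_{l=1}^N D_{kl}\Big[\tfrac{\mathbf F_1(\nu)\,\mathbf h^*(\mu)^{\mathrm T}\mathbf h(\lambda)}{(\lambda-\mu)(\mu-\nu)}\Big]_{\bar\lambda_k,\lambda_l} +\sum_{k=1}^N\sum_{l=N_1+1}^N D_{kl}\Big[\tfrac{\mathbf F_2(\nu)\,\mathbf h^*(\mu)^{\mathrm T}\mathbf h(\lambda)}{(\lambda-\mu)(\mu+\nu)}\Big]_{\bar\lambda_k,\bar\lambda_l}\\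 &+\sum_{k=N_1+1}^N\sum_{l=1}^N D_{kl}\Big[\tfrac{\mathbf F_1(\nu)\,\mathbf h(\mu)^{\mathrm T}\mathbf h(\lambda)}{(\lambda+\mu)(\mu+\nu)}\Big]_{\lambda_k,\lambda_l} +\sum_{k=N_1+1}^N\sum_{l=N_1+1}^N D_{kl}\Big[\tfrac{\mathbf F_2(\nu)\,\mathbf h(\mu)^{\mathrm T}\mathbf h(\lambda)}{(\lambda+\mu)(\mu-\nu)}\Big]_{\lambda_k,\bar\lambda_l},\\ \mathbf G_2(\lambda)=\mathbf F_2(\lambda)-2i\mathbf h^*(\lambda) &+\sum_{k=1}^N\sum_{l=1}^N D_{kl}\Big[\tfrac{\mathbf F_1(\nu)\,\mathbf h^*(\mu)^{\mathrm T}\mathbf h^*(\lambda)}{(\lambda+\mu)(\mu-\nu)}\Big]_{\bar\lambda_k,\lambda_l} +\sum_{k=1}^N\sum_{l=N_1+1}^N D_{kl}\Big[\tfrac{\mathbf F_2(\nu)\,\mathbf h^*(\mu)^{\mathrm T}\mathbf h^*(\lambda)}{(\lambda+\mu)(\mu+\nu)}\Big]_{\bar\lambda_k,\bar\lambda_l}\\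 &+\sum_{k=N_1+1}^N\sum_{l=1}^N D_{kl}\Big[\tfrac{\mathbf F_1(\nu)\,\mathbf h(\mu)^{\mathrm T}\mathbf h^*(\lambda)}{(\lambda-\mu)(\mu+\nu)}\Big]_{\lambda_k,\lambda_l} +\sum_{k=N_1+1}^N\sum_{l=N_1+1}^N D_{kl}\Big[\tfrac{\mathbf F_2(\nu)\,\mathbf h(\mu)^{\mathrm T}\mathbf h^*(\lambda)}{(\lambda-\mu)(\mu-\nu)}\Big]_{\lambda_k,\bar\lambda_l}. \end{align*} The equations $$\frac{\mathbf G_1^{(j)}(\lambda_k)}{j!}=\mathbf 0\ \ (1\le k\le N,\ 0\le j\le m_k),\qquad \frac{\mathbf G_2^{(j)}(\bar\lambda_k)}{j!}=\mathbf 0\ \ (N_1<k\le N,\ 0\le j\le m_k)\tag{S}$$ involve $\mathbf F_1,\mathbf F_2$ only through the vectors $\mathbf F_1^{(j)}(\lambda_k)$ $(1\le k\le N$, $0\le j\le m_k)$ and $\mathbf F_2^{(j)}(\bar\lambda_k)$ $(N_1<k\le N$, $0\le j\le m_k)$. Read (S) as a finite linear algebraic system with these vectors as unknowns (that is, replace $\mathbf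 F_1$ near $\lambda_k$ and $\mathbf F_2$ near $\bar\lambda_k$ by the Taylor polynomials of degree $m_k$ formed with the unknowns). \textbf{Theorem.} There is a smooth function $\mathbf q:\mathbb R\times\mathbb R\to\mathbb R^n$ which solves the vector modified Korteweg--de Vries equation $$\mathbf q_t+\mathbf q_{xxx}+3\left(\mathbf q_x\mathbf q^{\mathrm T}\mathbf q+\mathbf q\mathbf q^{\mathrm T}\mathbf q_x\right)=\mathbf 0$$ and such that for all $(x,t)\in\mathbb R\times\mathbb R$: the reflectionless Riemann--Hilbert problem has exactly one solution $\mathbf M$; $\mathbf q(x,t)=-2i\lim_{\lambda\to\infty}\lambda\,\mathbf M_{\rm DL}(x,t;\lambda)$ (limit over $\lambda\notin\mathbb R$); the system (S) has exactly one solution, namely the family of derivatives $\mathbf F_1^{(j)}(x,t;\lambda_k)$, $\mathbf F_2^{(j)}(x,t;\bar\lambda_k)$ of the functions $\mathbf F_1,\mathbf F_2$ formed with $\mathbf M$; and, in terms of this solution, $$\mathbf q(x,t)=\sum_{k=1}^{N}\frac{\mathbf F_1^{(m_k)}(x,t;\lambda_k)}{m_k!}+\sum_{k=N_1+1}^{N}\frac{\mathbf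 F_2^{(m_k)}(x,t;\bar\lambda_k)}{m_k!}.$$ -/

import Mathlib

open Complex Filter Topology ComplexConjugate
open scoped Matrix ContDiff Nat

namespace VmKdV

noncomputable section

/-- `q` is a smooth classical solution on `ℝ × ℝ` of the real vector modified Korteweg-de Vries
equation `q_t + q_xxx + 3 (q_x qᵀ q + q qᵀ q_x) = 0` with `n` components. -/
def IsVmKdVSolution {n : ℕ} (q : ℝ → ℝ → Fin n → ℝ) : Prop :=
  ContDiff ℝ ∞ (fun p : ℝ × ℝ => q p.1 p.2) ∧
  ∀ x t : ℝ,
    deriv (fun s => q x s) t + iteratedDeriv 3 (fun y => q y t) x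
      + (3 : ℝ) • ((q x t ⬝ᵥ q x t) • deriv (fun y => q y t) x
          + (q x t ⬝ᵥ deriv (fun y => q y t) x) • q x t) = 0

/-- The phase `θ(x,t;z) = z x + 4 z³ t`. -/
def phase (x t : ℝ) (z : ℂ) : ℂ := z * x + 4 * z ^ 3 * t

/-- `ρ` is the residue at `c` of `g`: the common value of `(2πi)⁻¹ ∮ g` over all sufficiently
small positively oriented circles centred at `c`. -/
def HasResidue (g : ℂ → ℂ) (c ρ : ℂ) : Prop :=
  ∀ᶠ r : ℝ in 𝓝[>] 0, (2 * Real.pi * I)⁻¹ * (∮ z in C(c, r), g z) = ρ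

/-- `(n+1) × (n+1)` matrices in block form: `inl ()` is the first index (row `U`, column `L`) and
`inr j` are the last `n` indices (rows `D`, columns `R`). -/
abbrev BlockMat (n : ℕ) : Type := Matrix (Unit ⊕ Fin n) (Unit ⊕ Fin n) ℂ

/-- Entrywise residue of a matrix-valued function. -/
def HasMatResidue {n : ℕ} (G : ℂ → BlockMat n) (c : ℂ) (R : BlockMat n) : Prop :=
  ∀ i j, HasResidue (fun z => G z i j) c (R i j)

/-- The matrix-valued function `G` has a pole of order exactly `p` at `c`. -/
def HasMatPole {n : ℕ} (G : ℂ → BlockMat n) (c : ℂ) (p : ℕ) : Prop :=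
  (∀ i j, MeromorphicAt (fun z => G z i j) c) ∧
  (∀ i j, ((-(p : ℤ) : ℤ) : WithTop ℤ) ≤ meromorphicOrderAt (fun z => G z i j) c) ∧
  ∃ i j, meromorphicOrderAt (fun z => G z i j) c = ((-(p : ℤ) : ℤ) : WithTop ℤ)

/-- The matrix `(v, 0)` with first column `v` and vanishing last `n` columns. -/
def leftCol {n : ℕ} (v : Unit ⊕ Fin n → ℂ) : BlockMat n :=
  Matrix.of fun i => Sum.elim (fun _ => v i) (fun _ => 0)

/-- The matrix `(0, V)` with vanishing first column and last `n` columns `V`. -/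
def rightCols {n : ℕ} (V : Unit ⊕ Fin n → Fin n → ℂ) : BlockMat n :=
  Matrix.of fun i => Sum.elim (fun _ => 0) (fun j => V i j)

/-- The jump matrix on the real line, for a reflection coefficient `γ` (a row vector on `ℝ`). -/
def jumpMatrix {n : ℕ} (γ : ℝ → Fin n → ℂ) (x t s : ℝ) : BlockMat n :=
  Matrix.fromBlocks
    (Matrix.of fun _ _ => 1 + ∑ i, γ s i * conj (γ s i))
    (Matrix.of fun _ j => -exp (-2 * I * phase x t s) * γ s j)
    (Matrix.of fun i _ => -exp (2 * I * phase x t s) * conj (γ s i))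
    1

/-- The discrete scattering data: `N` pairs `{λ_k, -conj λ_k}` of points of the open upper half
plane, the `k`-th one of order `m_k + 1`, purely imaginary exactly for the first `N₁` indices, and a
vector polynomial `f` which carries the residue constants `f^{(j)}(λ_k)`, `j ≤ m_k`. -/
structure DiscreteData (n N N₁ : ℕ) where
  /-- the points `λ_k` -/
  pole : Fin N → ℂ
  /-- the numbers `m_k` -/
  m : Fin N → ℕ
  /-- the components of `f` -/
  f : Fin n → Polynomial ℂ
  N₁_le : N₁ ≤ N
  im_pos : ∀ k, 0 < (pole k).im
  re_eq_zero_iff : ∀ k : Fin N, (pole k).re = 0 ↔ (k : ℕ) < N₁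
  distinct : ∀ k l, k ≠ l → pole k ≠ pole l ∧ pole k ≠ -conj (pole l)
  f_ne_zero : ∀ k, (fun i => (f i).eval (pole k)) ≠ 0
  f_symm : ∀ k : Fin N, (k : ℕ) < N₁ → ∀ r ≤ m k, ∀ i,
    (Polynomial.derivative^[m k - r] (f i)).eval (pole k)
      = (-1) ^ (r + 1) * conj ((Polynomial.derivative^[m k - r] (f i)).eval (pole k))

namespace DiscreteData

variable {n N N₁ : ℕ} (d : DiscreteData n N N₁)

/-- The poles `λ_k`, `-conj λ_k` in the upper half plane. -/
def upperPoles : Set ℂ := {z | ∃ k, z = d.pole k ∨ z = -conj (d.pole k)}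

/-- The poles `conj λ_k`, `-λ_k` in the lower half plane. -/
def lowerPoles : Set ℂ := {z | ∃ k, z = conj (d.pole k) ∨ z = -d.pole k}

/-- The domain `ℂ ∖ (ℝ ∪ {±λ_k, ±conj λ_k})`. -/
def domain : Set ℂ := {z | z.im ≠ 0 ∧ z ∉ d.upperPoles ∧ z ∉ d.lowerPoles}

/-- The vector `f(z)`. -/
def fv (z : ℂ) (i : Fin n) : ℂ := (d.f i).eval z

/-- The Riemann-Hilbert problem at `(x,t)` with reflection coefficient `γ` and discrete data `d`:
analyticity, normalization, jump across the real line with continuous boundary values, and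
residue conditions. The columns `M_R` are analytic at the poles in the upper half plane, and the
column `M_L` at those in the lower half plane, so that the derivatives on the right-hand sides of
the residue conditions are meaningful. -/
structure IsRHSolution (γ : ℝ → Fin n → ℂ) (x t : ℝ) (M : ℂ → BlockMat n) : Prop where
  analytic : ∀ z ∈ d.domain, ∀ i j, AnalyticAt ℂ (fun w => M w i j) z
  analytic_right : ∀ z ∈ d.upperPoles, ∀ i (j : Fin n), AnalyticAt ℂ (fun w => M w i (.inr j)) z
  analytic_left : ∀ z ∈ d.lowerPoles, ∀ i, AnalyticAt ℂ (fun w => M w i (.inl ())) z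
  normalization : Tendsto M (Bornology.cobounded ℂ ⊓ 𝓟 {z | z.im ≠ 0}) (𝓝 1)
  jump : ∃ Mplus Mminus : ℝ → BlockMat n,
    (∀ s : ℝ, Tendsto M (𝓝[{z | 0 < z.im}] (s : ℂ)) (𝓝 (Mplus s))) ∧
    (∀ s : ℝ, Tendsto M (𝓝[{z | z.im < 0}] (s : ℂ)) (𝓝 (Mminus s))) ∧
    ∀ s : ℝ, Mplus s = Mminus s * jumpMatrix γ x t s
  poles : ∀ k, HasMatPole M (d.pole k) (d.m k + 1) ∧ HasMatPole M (-conj (d.pole k)) (d.m k + 1) ∧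
    HasMatPole M (conj (d.pole k)) (d.m k + 1) ∧ HasMatPole M (-d.pole k) (d.m k + 1)
  residue₁ : ∀ k, ∀ r ≤ d.m k,
    HasMatResidue (fun z => (z - d.pole k) ^ r • M z) (d.pole k)
      (leftCol fun i =>
        iteratedDeriv (d.m k - r)
            (fun z => exp (2 * I * phase x t z) * ∑ j, M z i (.inr j) * d.fv z j) (d.pole k)
          / (d.m k - r)!)
  residue₂ : ∀ k, ∀ r ≤ d.m k,
    HasMatResidue (fun z => (z + conj (d.pole k)) ^ r • M z) (-conj (d.pole k))
      (leftCol fun i =>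
        iteratedDeriv (d.m k - r)
            (fun z => exp (2 * I * phase x t z) * ∑ j, M z i (.inr j) * conj (d.fv (-conj z) j))
            (-conj (d.pole k))
          / ((-1) ^ (d.m k + 1) * (d.m k - r)!))
  residue₃ : ∀ k, ∀ r ≤ d.m k,
    HasMatResidue (fun z => (z - conj (d.pole k)) ^ r • M z) (conj (d.pole k))
      (rightCols fun i j =>
        -iteratedDeriv (d.m k - r)
            (fun z => exp (-2 * I * phase x t z) * M z i (.inl ()) * conj (d.fv (conj z) j))
            (conj (d.pole k))
          / (d.m k - r)!)
  residue₄ : ∀ k, ∀ r ≤ d.m k,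
    HasMatResidue (fun z => (z + d.pole k) ^ r • M z) (-d.pole k)
      (rightCols fun i j =>
        iteratedDeriv (d.m k - r)
            (fun z => exp (-2 * I * phase x t z) * M z i (.inl ()) * d.fv (-z) j) (-d.pole k)
          / ((-1) ^ d.m k * (d.m k - r)!))

/-- `h(z) = e^{2iθ(z)} f(z)`. -/
def h (x t : ℝ) (z : ℂ) : Fin n → ℂ := fun i => exp (2 * I * phase x t z) * d.fv z i

/-- `z ↦ conj (h (conj z))`, the Schwarz conjugate of `h`. -/
def hbar (x t : ℝ) (z : ℂ) : Fin n → ℂ := fun i => conj (d.h x t (conj z) i)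

/-- `F₁(z) = -2i M_DR(z) h(z)`. -/
def F₁ (x t : ℝ) (M : ℂ → BlockMat n) (z : ℂ) : Fin n → ℂ :=
  (-2 * I) • ((M z).toBlocks₂₂ *ᵥ d.h x t z)

/-- `F₂(z) = 2i M_DR(-z) conj (h (conj z))`. -/
def F₂ (x t : ℝ) (M : ℂ → BlockMat n) (z : ℂ) : Fin n → ℂ :=
  (2 * I) • ((M (-z)).toBlocks₂₂ *ᵥ d.hbar x t z)

/-- The indices `k = N₁+1, …, N` of the poles off the imaginary axis. -/
abbrev OffAxis (N N₁ : ℕ) : Type := {k : Fin N // N₁ ≤ (k : ℕ)}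

/-- The unknowns of the algebraic system: vectors in place of `F₁^{(j)}(λ_k)` for all `k`,
`j = 0, …, m_k`, and of `F₂^{(j)}(conj λ_k)` for `k > N₁`, `j = 0, …, m_k`. -/
abbrev Unknowns : Type :=
  ((k : Fin N) → Fin (d.m k + 1) → Fin n → ℂ) ×
    ((k : OffAxis N N₁) → Fin (d.m k + 1) → Fin n → ℂ)

/-- The derivatives of `F₁` at `λ_k` and of `F₂` at `conj λ_k`. -/
def jets (F₁ F₂ : ℂ → Fin n → ℂ) : d.Unknowns :=
  (fun k j => iteratedDeriv j F₁ (d.pole k), fun k j => iteratedDeriv j F₂ (conj (d.pole k)))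

/-- `F₁` near `λ_k`, as the Taylor polynomial made of the unknown derivatives. -/
def T₁ (U : d.Unknowns) (k : Fin N) (z : ℂ) : Fin n → ℂ :=
  ∑ j : Fin (d.m k + 1), ((z - d.pole k) ^ (j : ℕ) / ((j : ℕ)! : ℂ)) • U.1 k j

/-- `F₂` near `conj λ_k`, as the Taylor polynomial made of the unknown derivatives. -/
def T₂ (U : d.Unknowns) (k : OffAxis N N₁) (z : ℂ) : Fin n → ℂ :=
  ∑ j : Fin (d.m k + 1), ((z - conj (d.pole k)) ^ (j : ℕ) / ((j : ℕ)! : ℂ)) • U.2 k j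

/-- `(∂_μ^p ∂_ν^r / (p! r!)) A(μ,ν)` at `μ = a`, `ν = b`. -/
def mixedTaylor (p r : ℕ) (A : ℂ → ℂ → Fin n → ℂ) (a b : ℂ) : Fin n → ℂ :=
  ((p ! : ℂ) * (r ! : ℂ))⁻¹ •
    iteratedDeriv p (fun μ => iteratedDeriv r (fun ν => A μ ν) b) a

/-- The function `G₁` near `λ_j`. The functions `F₁`, `F₂` enter it only through their derivatives
of order at most `m_l` at the points `λ_l`, `conj λ_l`, up to terms that do not affect
the derivatives of `G₁` of order at most `m_j` at `λ_j`. -/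
def G₁ (x t : ℝ) (U : d.Unknowns) (j : Fin N) (z : ℂ) : Fin n → ℂ :=
  d.T₁ U j z + (2 * I) • d.h x t z
  + ∑ k : Fin N, ∑ l : Fin N, mixedTaylor (d.m k) (d.m l)
      (fun μ ν => ((d.hbar x t μ ⬝ᵥ d.h x t z) / ((z - μ) * (μ - ν))) • d.T₁ U l ν)
      (conj (d.pole k)) (d.pole l)
  + ∑ k : Fin N, ∑ l : OffAxis N N₁, mixedTaylor (d.m k) (d.m l)
      (fun μ ν => ((d.hbar x t μ ⬝ᵥ d.h x t z) / ((z - μ) * (μ + ν))) • d.T₂ U l ν)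
      (conj (d.pole k)) (conj (d.pole l))
  + ∑ k : OffAxis N N₁, ∑ l : Fin N, mixedTaylor (d.m k) (d.m l)
      (fun μ ν => ((d.h x t μ ⬝ᵥ d.h x t z) / ((z + μ) * (μ + ν))) • d.T₁ U l ν)
      (d.pole k) (d.pole l)
  + ∑ k : OffAxis N N₁, ∑ l : OffAxis N N₁, mixedTaylor (d.m k) (d.m l)
      (fun μ ν => ((d.h x t μ ⬝ᵥ d.h x t z) / ((z + μ) * (μ - ν))) • d.T₂ U l ν)
      (d.pole k) (conj (d.pole l))

/-- The function `G₂` near `conj λ_j`. -/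
def G₂ (x t : ℝ) (U : d.Unknowns) (j : OffAxis N N₁) (z : ℂ) : Fin n → ℂ :=
  d.T₂ U j z - (2 * I) • d.hbar x t z
  + ∑ k : Fin N, ∑ l : Fin N, mixedTaylor (d.m k) (d.m l)
      (fun μ ν => ((d.hbar x t μ ⬝ᵥ d.hbar x t z) / ((z + μ) * (μ - ν))) • d.T₁ U l ν)
      (conj (d.pole k)) (d.pole l)
  + ∑ k : Fin N, ∑ l : OffAxis N N₁, mixedTaylor (d.m k) (d.m l)
      (fun μ ν => ((d.hbar x t μ ⬝ᵥ d.hbar x t z) / ((z + μ) * (μ + ν))) • d.T₂ U l ν)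
      (conj (d.pole k)) (conj (d.pole l))
  + ∑ k : OffAxis N N₁, ∑ l : Fin N, mixedTaylor (d.m k) (d.m l)
      (fun μ ν => ((d.h x t μ ⬝ᵥ d.hbar x t z) / ((z - μ) * (μ + ν))) • d.T₁ U l ν)
      (d.pole k) (d.pole l)
  + ∑ k : OffAxis N N₁, ∑ l : OffAxis N N₁, mixedTaylor (d.m k) (d.m l)
      (fun μ ν => ((d.h x t μ ⬝ᵥ d.hbar x t z) / ((z - μ) * (μ - ν))) • d.T₂ U l ν)
      (d.pole k) (conj (d.pole l))

/-- The finite linear algebraic system: the Taylor coefficients of `G₁` at `λ_k` and, for `k > N₁`,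
of `G₂` at `conj λ_k` vanish up to order `m_k`. -/
def SolvesSystem (x t : ℝ) (U : d.Unknowns) : Prop :=
  (∀ k : Fin N, ∀ j ≤ d.m k,
    ((j ! : ℂ)⁻¹) • iteratedDeriv j (d.G₁ x t U k) (d.pole k) = 0) ∧
  (∀ k : OffAxis N N₁, ∀ j ≤ d.m k,
    ((j ! : ℂ)⁻¹) • iteratedDeriv j (d.G₂ x t U k) (conj (d.pole k)) = 0)

/-- `∑_k F₁^{(m_k)}(λ_k) / m_k! + ∑_{k > N₁} F₂^{(m_k)}(conj λ_k) / m_k!`. -/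
def solitonFormula (U : d.Unknowns) : Fin n → ℂ :=
  ∑ k : Fin N, (((d.m k)! : ℂ)⁻¹) • U.1 k (Fin.last _)
  + ∑ k : OffAxis N N₁, (((d.m k)! : ℂ)⁻¹) • U.2 k (Fin.last _)

/-- The vector `q` is recovered from `M` at `(x,t)`: `q = -2i lim_{z → ∞} z M_DL(z)`. -/
def Reconstructs (M : ℂ → BlockMat n) (q : Fin n → ℝ) : Prop :=
  Tendsto (fun z : ℂ => fun i : Fin n => -2 * I * (z * M z (.inr i) (.inl ())))
    (Bornology.cobounded ℂ ⊓ 𝓟 {z | z.im ≠ 0}) (𝓝 fun i => (q i : ℂ))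

end DiscreteData

end

end VmKdV

/-! Without a jump the solution is rational. After the coincidences `-conj λ_k = λ_k` on the
imaginary axis are removed, the data are distinct points of the upper half plane with orders and
polynomial residue constants (`PoleData`). Let `W` be the monic polynomial with these zeros and `W*`
the one with conjugated coefficients. A row has the form `P_L / W` in the first column and `P_R /
W*` in the others, and the residue conditions say that certain expressions in `P` vanish to finite
order (`Cond`).

For two rows subject to `Cond` the exponentials cancel in the pairing `∑ P_j P'_j*`, which is
therefore divisible by `W W*` (`Cond.dvd_pairing`). If a row decays at infinity, its pairing with
itself has too small a degree and vanishes, and on the real line that pairing is a sum of squares.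
This gives uniqueness (`Cond.eq_zero`). There are as many equations as unknown coefficients, so
solutions exist and depend smoothly on `(x,t)` (`exists_smooth_cond`). The same pairing yields `M(z)
M(conj z)ᴴ = 1`, hence an anti-Hermitian first Laurent coefficient `M₁` and the exact pole orders.

The evolution equation comes from dressing. The `x`- and `t`-derivatives of a row, corrected by the
phase, satisfy `Cond` again (`Cond.dirDeriv`). Once the polynomial part is cancelled by combinations
of rows of `M`, uniqueness leaves zero; these are the Lax equations `lax_x` and `lax_t`. Comparing
Laurent coefficients gives the matrix equation `Q_t + Q_xxx = 3 (Q_x Q² + Q² Q_x)` for `Q = [iσ,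
M₁]` (`evolution_of_recursion`), whose lower left block is the vector equation. The symmetry `z ↦
-conj z` makes `q` real (`potential_real`).

An arbitrary solution of the Riemann-Hilbert problem extends holomorphically across the real line by
Morera's theorem, and the pairing argument with Liouville's theorem identifies it with the
constructed one. For the algebraic system, mixed Taylor coefficients of Cauchy kernels are iterated
principal parts. Hence `G₁` and `G₂` measure how far a trial row built from the unknowns is from
satisfying the residue conditions in the upper half plane (`G₁_apply`, `G₂_apply`,
`solvesSystem_iff`), and unique solvability is inherited from the Riemann-Hilbert problem. The
formula for `q` reads off the `1/z` coefficient of the partial fraction expansion. -/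

namespace VmKdV

noncomputable section

open scoped Polynomial

set_option linter.unusedSectionVars false

/-! ### Zeros of finite order -/

/-- `f` is analytic at `p` and vanishes there to order at least `N`. -/
def VanishesTo (f : ℂ → ℂ) (p : ℂ) (N : ℕ) : Prop :=
  ∃ k, AnalyticAt ℂ k p ∧ ∀ᶠ z in 𝓝 p, f z = (z - p) ^ N * k z

namespace VanishesTo

variable {f g : ℂ → ℂ} {p : ℂ} {N : ℕ}

theorem analyticAt (h : VanishesTo f p N) : AnalyticAt ℂ f p := by
  obtain ⟨k, hk, he⟩ := h
  refine AnalyticAt.congr (f := fun z => (z - p) ^ N * k z) (by fun_prop) ?_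
  filter_upwards [he] with z hz using hz.symm

theorem congr (h : VanishesTo f p N) (e : ∀ᶠ z in 𝓝 p, g z = f z) : VanishesTo g p N := by
  obtain ⟨k, hk, he⟩ := h
  exact ⟨k, hk, by filter_upwards [he, e] with z h1 h2 using h2.trans h1⟩

theorem congr' (h : VanishesTo f p N) (e : ∀ z, g z = f z) : VanishesTo g p N :=
  h.congr (Eventually.of_forall e)

theorem add (h : VanishesTo f p N) (h' : VanishesTo g p N) :
    VanishesTo (fun z => f z + g z) p N := by
  obtain ⟨k, hk, he⟩ := h
  obtain ⟨l, hl, he'⟩ := h'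
  exact ⟨fun z => k z + l z, by fun_prop,
    by filter_upwards [he, he'] with z h1 h2 using by rw [h1, h2]; ring⟩

theorem mul_left (h : VanishesTo f p N) (hg : AnalyticAt ℂ g p) :
    VanishesTo (fun z => g z * f z) p N := by
  obtain ⟨k, hk, he⟩ := h
  exact ⟨fun z => g z * k z, by fun_prop,
    by filter_upwards [he] with z h1 using by rw [h1]; ring⟩

theorem neg (h : VanishesTo f p N) : VanishesTo (fun z => - f z) p N :=
  (h.mul_left (analyticAt_const (v := (-1 : ℂ)))).congr' fun z => by ring

theorem sub (h : VanishesTo f p N) (h' : VanishesTo g p N) :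
    VanishesTo (fun z => f z - g z) p N :=
  (h.add h'.neg).congr' fun z => by ring

theorem zero : VanishesTo (fun _ => 0) p N :=
  ⟨fun _ => 0, analyticAt_const, Eventually.of_forall fun z => by simp⟩

theorem sum {ι : Type*} {F : ι → ℂ → ℂ} (s : Finset ι) (h : ∀ i ∈ s, VanishesTo (F i) p N) :
    VanishesTo (fun z => ∑ i ∈ s, F i z) p N := by
  classical
  induction s using Finset.induction_on with
  | empty => simpa using zero
  | insert a s ha ih =>
    simp only [Finset.sum_insert ha]
    exact (h a (by simp)).add (ih fun i hi => h i (by simp [hi]))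

theorem iff_iteratedDeriv (hf : AnalyticAt ℂ f p) :
    VanishesTo f p N ↔ ∀ i < N, iteratedDeriv i f p = 0 := by
  rw [← natCast_le_analyticOrderAt_iff_iteratedDeriv_eq_zero hf, natCast_le_analyticOrderAt hf]
  simp [VanishesTo]

theorem sub_iff_iteratedDeriv (hf : AnalyticAt ℂ f p) (hg : AnalyticAt ℂ g p) :
    VanishesTo (fun z => f z - g z) p N ↔ ∀ i < N, iteratedDeriv i f p = iteratedDeriv i g p := by
  rw [iff_iteratedDeriv (hf.fun_sub hg)]
  refine forall₂_congr fun i _ => ?_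
  rw [iteratedDeriv_fun_sub hf.contDiffAt hg.contDiffAt, sub_eq_zero]

end VanishesTo

theorem analyticAt_conj_conj {f : ℂ → ℂ} {p : ℂ} (h : AnalyticAt ℂ f (conj p)) :
    AnalyticAt ℂ (fun z => conj (f (conj z))) p := by
  rw [Complex.analyticAt_iff_eventually_differentiableAt] at h ⊢
  have hc : Tendsto (fun z : ℂ => conj z) (𝓝 p) (𝓝 (conj p)) :=
    Complex.continuous_conj.continuousAt
  filter_upwards [hc.eventually h] with z hz
  have := hz.conj_conj
  simpa [Function.comp_def] using this

theorem VanishesTo.conj_conj {f : ℂ → ℂ} {p : ℂ} {N : ℕ} (h : VanishesTo f (conj p) N) :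
    VanishesTo (fun z => conj (f (conj z))) p N := by
  obtain ⟨k, hk, he⟩ := h
  refine ⟨fun z => conj (k (conj z)), analyticAt_conj_conj hk, ?_⟩
  have hc : Tendsto (fun z : ℂ => conj z) (𝓝 p) (𝓝 (conj p)) :=
    Complex.continuous_conj.continuousAt
  filter_upwards [hc.eventually he] with z hz
  simp [hz]

/-- The bridge from local vanishing to divisibility, where degrees can be counted. -/
theorem VanishesTo.dvd {P : ℂ[X]} {p : ℂ} {N : ℕ}
    (h : VanishesTo (fun z => P.eval z) p N) : (Polynomial.X - Polynomial.C p) ^ N ∣ P := by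
  rcases eq_or_ne P 0 with rfl | hP
  · simp
  rcases N with _ | N
  · simp
  rw [← Polynomial.le_rootMultiplicity_iff hP, Nat.succ_le_iff,
    Polynomial.lt_rootMultiplicity_iff_isRoot_iterate_derivative hP]
  rw [VanishesTo.iff_iteratedDeriv h.analyticAt] at h
  intro i hi
  have := h i (by omega)
  rw [iteratedDeriv_eq_iterate] at this
  have key : ∀ i (Q : ℂ[X]), deriv^[i] (fun z => Q.eval z)
      = fun z => (Polynomial.derivative^[i] Q).eval z := by
    intro i
    induction i with
    | zero => intro Q; rfl
    | succ i ih =>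
      intro Q
      rw [Function.iterate_succ_apply, Function.iterate_succ_apply, ← ih]
      congr 1
      ext z
      exact Q.deriv
  rw [key] at this
  exact this

/-! ### Polar parts and principal parts -/

/-- Near `p`, off `p`, `a` is `ψ / (z - p)^{m+1}` up to an analytic function. -/
def PolarRel (a ψ : ℂ → ℂ) (p : ℂ) (m : ℕ) : Prop :=
  ∃ k, AnalyticAt ℂ k p ∧ ∀ᶠ z in 𝓝[≠] p, a z = ψ z / (z - p) ^ (m + 1) + k z

namespace PolarRel

variable {a b ψ χ : ℂ → ℂ} {p : ℂ} {m : ℕ}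

theorem congr (h : PolarRel a ψ p m) (e : ∀ᶠ z in 𝓝[≠] p, b z = a z)
    (e' : ∀ᶠ z in 𝓝[≠] p, χ z = ψ z) : PolarRel b χ p m := by
  obtain ⟨k, hk, he⟩ := h
  exact ⟨k, hk, by filter_upwards [he, e, e'] with z h1 h2 h3 using by rw [h2, h1, h3]⟩

/-- The polar part depends only on the jet of order `m` of `ψ`. On the imaginary axis this allows
`f` to be exchanged with its reflection. -/
theorem congr_vanishes (h : PolarRel a ψ p m) (e : VanishesTo (fun z => χ z - ψ z) p (m + 1)) :
    PolarRel a χ p m := by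
  obtain ⟨k, hk, he⟩ := h
  obtain ⟨l, hl, he'⟩ := e
  refine ⟨fun z => k z - l z, by fun_prop, ?_⟩
  filter_upwards [he, he'.filter_mono nhdsWithin_le_nhds, self_mem_nhdsWithin] with z h1 h2 h3
  have h3 : z - p ≠ 0 := sub_ne_zero.2 h3
  have : χ z = ψ z + (z - p) ^ (m + 1) * l z := by rw [← h2]; ring
  rw [h1, this]; field_simp; ring

theorem sub_analytic (h : PolarRel a ψ p m) (h' : PolarRel b ψ p m) :
    ∃ k, AnalyticAt ℂ k p ∧ ∀ᶠ z in 𝓝[≠] p, a z - b z = k z := by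
  obtain ⟨k, hk, he⟩ := h
  obtain ⟨l, hl, he'⟩ := h'
  exact ⟨fun z => k z - l z, by fun_prop,
    by filter_upwards [he, he'] with z h1 h2 using by rw [h1, h2]; ring⟩

/-- The reflection turns `z + conj p` into `-(z - p)` after conjugation; the power `m + 1` of this
sign is the factor in front of `ψ`. -/
theorem conj_neg (h : PolarRel a ψ (-conj p) m) :
    PolarRel (fun z => conj (a (-conj z))) (fun z => (-1) ^ (m + 1) * conj (ψ (-conj z))) p m := by
  obtain ⟨k, hk, he⟩ := h
  have hk' : AnalyticAt ℂ (fun z => k (-z)) (conj p) := by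
    refine AnalyticAt.comp (g := k) (f := fun z => -z) (by simpa using hk) (by fun_prop)
  refine ⟨fun z => conj (k (-conj z)), analyticAt_conj_conj hk', ?_⟩
  have hc : Tendsto (fun z : ℂ => -conj z) (𝓝[≠] p) (𝓝[≠] (-conj p)) := by
    refine tendsto_nhdsWithin_iff.2 ⟨?_, ?_⟩
    · exact (Complex.continuous_conj.neg.continuousAt).mono_left nhdsWithin_le_nhds
    · filter_upwards [self_mem_nhdsWithin] with z hz
      simpa using fun h : conj z = conj p => hz ((starRingEnd ℂ).injective h)
  filter_upwards [hc.eventually he, self_mem_nhdsWithin] with z hz hz'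
  have h3 : z - p ≠ 0 := sub_ne_zero.2 hz'
  rw [hz]
  simp only [map_add, map_div₀, map_pow, map_sub, map_neg, Complex.conj_conj]
  have : -z - -p = (-1) * (z - p) := by ring
  rw [this, mul_pow, add_left_inj]
  have h1 : ((-1 : ℂ) ^ (m + 1)) * (-1) ^ (m + 1) = 1 := by rw [← mul_pow]; simp
  have h2 : ((-1 : ℂ) ^ (m + 1)) ≠ 0 := by simp
  field_simp
  rw [sq, h1, mul_one]

end PolarRel

/-- The principal part at `p` of `ψ / (z - p)^{m+1}`. -/
def principalPart (ψ : ℂ → ℂ) (p : ℂ) (m : ℕ) (z : ℂ) : ℂ :=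
  ∑ r ∈ Finset.range (m + 1), iteratedDeriv (m - r) ψ p / (m - r)! / (z - p) ^ (r + 1)

theorem principalPart_congr {ψ χ : ℂ → ℂ} {p : ℂ} {m : ℕ}
    (h : ∀ i < m + 1, iteratedDeriv i ψ p = iteratedDeriv i χ p) (z : ℂ) :
    principalPart ψ p m z = principalPart χ p m z := by
  unfold principalPart
  refine Finset.sum_congr rfl fun r _ => ?_
  rw [h (m - r) (by omega)]

theorem principalPart_analyticAt (ψ : ℂ → ℂ) {p : ℂ} (m : ℕ) {z : ℂ} (hz : z ≠ p) :
    AnalyticAt ℂ (principalPart ψ p m) z := by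
  unfold principalPart
  refine Finset.analyticAt_fun_sum _ fun r _ => ?_
  refine AnalyticAt.div (by fun_prop) (by fun_prop) (pow_ne_zero _ (sub_ne_zero.2 hz))

theorem tendsto_sub_cobounded (p : ℂ) :
    Tendsto (fun z : ℂ => z - p) (Bornology.cobounded ℂ) (Bornology.cobounded ℂ) := by
  rw [← tendsto_norm_atTop_iff_cobounded]
  refine tendsto_atTop_mono (f := fun z => ‖z‖ - ‖p‖) (fun z => norm_sub_norm_le z p) ?_
  exact tendsto_atTop_add_const_right _ _ tendsto_norm_cobounded_atTop

theorem tendsto_inv_pow (p : ℂ) (r : ℕ) :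
    Tendsto (fun z : ℂ => 1 / (z - p) ^ (r + 1)) (Bornology.cobounded ℂ) (𝓝 0) := by
  have h : Tendsto (fun z : ℂ => (z - p)⁻¹ ^ (r + 1)) (Bornology.cobounded ℂ) (𝓝 (0 ^ (r + 1))) :=
    (tendsto_inv₀_cobounded.comp (tendsto_sub_cobounded p)).pow _
  simpa using h

theorem principalPart_tendsto (ψ : ℂ → ℂ) (p : ℂ) (m : ℕ) :
    Tendsto (principalPart ψ p m) (Bornology.cobounded ℂ) (𝓝 0) := by
  have : Tendsto (principalPart ψ p m) (Bornology.cobounded ℂ)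
      (𝓝 (∑ r ∈ Finset.range (m + 1), iteratedDeriv (m - r) ψ p / (m - r)! * 0)) := by
    refine tendsto_finsetSum _ fun r _ => ?_
    refine ((tendsto_inv_pow p r).const_mul _).congr fun z => ?_
    ring
  simpa using this

theorem tendsto_mul_inv_sub (p : ℂ) :
    Tendsto (fun z : ℂ => z * (1 / (z - p))) (Bornology.cobounded ℂ) (𝓝 1) := by
  have h : Tendsto (fun z : ℂ => 1 + p * (1 / (z - p) ^ (0 + 1))) (Bornology.cobounded ℂ)
      (𝓝 (1 + p * 0)) := ((tendsto_inv_pow p 0).const_mul p).const_add 1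
  rw [mul_zero, add_zero] at h
  refine h.congr' ?_
  filter_upwards [(Bornology.isBounded_singleton (x := p) : Bornology.IsBounded {p})] with z hz
  have : z - p ≠ 0 := sub_ne_zero.2 hz
  field_simp
  ring

/-- Only the simple pole `r = 0` survives multiplication by `z`. This is the source of the closed
formula for `q`. -/
theorem tendsto_mul_principalPart (ψ : ℂ → ℂ) (p : ℂ) (m : ℕ) :
    Tendsto (fun z => z * principalPart ψ p m z) (Bornology.cobounded ℂ)
      (𝓝 (iteratedDeriv m ψ p / m !)) := by
  have : Tendsto (fun z => z * principalPart ψ p m z) (Bornology.cobounded ℂ)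
      (𝓝 (∑ r ∈ Finset.range (m + 1),
        iteratedDeriv (m - r) ψ p / (m - r)! * (if r = 0 then 1 else 0))) := by
    unfold principalPart
    simp_rw [Finset.mul_sum]
    refine tendsto_finsetSum _ fun r _ => ?_
    rcases r with _ | r
    · refine ((tendsto_mul_inv_sub p).const_mul _).congr fun z => ?_
      simp; ring
    · have := (tendsto_mul_inv_sub p).mul (tendsto_inv_pow p r)
      simp only [mul_zero] at this
      simp only [Nat.add_eq_zero_iff, one_ne_zero, and_false, if_false]
      refine (this.const_mul _).congr fun z => ?_
      rw [pow_succ (z - p) (r + 1)]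
      simp only [div_eq_mul_inv, mul_inv]
      ring
  simpa [Finset.sum_range_succ'] using this

/-- Taylor's formula with remainder of order `m + 1`, divided by `(z - p)^(m+1)`. -/
theorem principalPart_polarRel {ψ : ℂ → ℂ} {p : ℂ} (m : ℕ) (h : AnalyticAt ℂ ψ p) :
    PolarRel (principalPart ψ p m) ψ p m := by
  have h0 : AnalyticAt ℂ (fun w => ψ (w + p)) 0 :=
    AnalyticAt.comp (g := ψ) (f := fun w => w + p) (by simpa using h) (by fun_prop)
  obtain ⟨F, hF, he⟩ := h0.exists_eventuallyEq_sum_add_pow_mul (m + 1)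
  have hF' : AnalyticAt ℂ (fun z => -F (z - p)) p :=
    (AnalyticAt.comp (g := F) (f := fun w => w - p) (by simpa using hF) (by fun_prop)).neg
  refine ⟨_, hF', ?_⟩
  have hc : Tendsto (fun z : ℂ => z - p) (𝓝[≠] p) (𝓝 0) := by
    have : ContinuousAt (fun z : ℂ => z - p) p := by fun_prop
    have := this.tendsto
    rw [sub_self] at this
    exact this.mono_left nhdsWithin_le_nhds
  filter_upwards [hc.eventually he, self_mem_nhdsWithin] with z hz hz'
  have h3 : z - p ≠ 0 := sub_ne_zero.2 hz'
  rw [sub_add_cancel] at hz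
  rw [hz, add_div, smul_eq_mul, mul_div_cancel_left₀ _ (pow_ne_zero _ h3), add_assoc,
    add_neg_cancel, add_zero, Finset.sum_div, principalPart,
    ← Finset.sum_range_reflect]
  refine Finset.sum_congr rfl fun r hr => ?_
  rw [Finset.mem_range] at hr
  have e1 : m + 1 - 1 - r = m - r := by omega
  have e2 : m - (m - r) = r := by omega
  have e3 : m + 1 = (m - r + 1) + r := by omega
  have e4 := iteratedDeriv_comp_add_const (n := r) (f := ψ) (s := p)
  rw [e1, e2]
  have e5 : iteratedDeriv r (fun w => ψ (w + p)) 0 = iteratedDeriv r ψ p := by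
    rw [e4]; simp
  rw [e5, smul_eq_mul]
  conv_rhs => rw [e3, pow_add]
  field_simp

/-- Leibniz' rule, with `r! / (z - p)^(r+1)` as the `r`-th derivative of the Cauchy kernel. It is
the reason why the Taylor coefficients in the algebraic system are principal parts. -/
theorem principalPart_eq {ψ : ℂ → ℂ} {p z : ℂ} (m : ℕ) (h : AnalyticAt ℂ ψ p) (hz : z ≠ p) :
    iteratedDeriv m (fun ν => ψ ν / (z - ν)) p / m ! = principalPart ψ p m z := by
  have hd : ∀ r, iteratedDeriv r (fun ν : ℂ => (z - ν)⁻¹) p = r ! / (z - p) ^ (r + 1) := by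
    intro r
    have h1 := congrFun (iteratedDeriv_comp_const_sub (n := r) (f := fun w : ℂ => w⁻¹) (s := z)) p
    rw [h1, iteratedDeriv_eq_iterate, iter_deriv_inv]
    have h3 : z - p ≠ 0 := sub_ne_zero.2 hz
    have : (-1 - (r : ℤ)) = -((r + 1 : ℕ) : ℤ) := by push_cast; ring
    rw [this, zpow_neg, zpow_natCast, smul_eq_mul, ← mul_assoc, ← mul_assoc, ← mul_pow]
    simp [div_eq_mul_inv]
  have ha : AnalyticAt ℂ (fun ν : ℂ => (z - ν)⁻¹) p :=
    AnalyticAt.inv (by fun_prop) (sub_ne_zero.2 hz)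
  have := iteratedDeriv_mul (n := m) (x := p) ha.contDiffAt h.contDiffAt
  have e : (fun ν => ψ ν / (z - ν)) = (fun ν : ℂ => (z - ν)⁻¹) * ψ := by
    ext ν; simp [div_eq_mul_inv, mul_comm]
  rw [e, this, Finset.sum_div, principalPart]
  refine Finset.sum_congr rfl fun r hr => ?_
  rw [Finset.mem_range] at hr
  rw [hd, Nat.cast_choose ℂ (by omega : r ≤ m)]
  have h1 : (m ! : ℂ) ≠ 0 := by exact_mod_cast m.factorial_ne_zero
  have h2 : (r ! : ℂ) ≠ 0 := by exact_mod_cast r.factorial_ne_zero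
  field_simp

/-! ### Residue conditions and Liouville's theorem -/

theorem hasResidue_pow_mul {a h : ℂ → ℂ} {c : ℂ} {m r : ℕ} (hr : r ≤ m) (hh : AnalyticAt ℂ h c)
    (e : ∀ᶠ z in 𝓝[≠] c, a z = h z / (z - c) ^ (m + 1)) :
    HasResidue (fun z => (z - c) ^ r * a z) c (iteratedDeriv (m - r) h c / (m - r)!) := by
  obtain ⟨s, hs, ha⟩ := hh.exists_mem_nhds_analyticOnNhd
  obtain ⟨ε, hε, hball⟩ := Metric.mem_nhds_iff.1 (inter_mem hs (eventually_nhdsWithin_iff.1 e))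
  refine (Ioo_mem_nhdsGT hε : Set.Ioo 0 ε ∈ 𝓝[>] (0:ℝ)) |> fun hmem => ?_
  filter_upwards [hmem] with R hR
  have hsub : Metric.closedBall c R ⊆ Metric.ball c ε := Metric.closedBall_subset_ball hR.2
  have hd : DifferentiableOn ℂ h (Metric.closedBall c R) := fun z hz =>
    (ha z (hball (hsub hz)).1).differentiableAt.differentiableWithinAt
  have key := hd.circleIntegral_one_div_sub_center_pow_smul hR.1 (m - r)
  have : (∮ z in C(c, R), (z - c) ^ r * a z)
      = ∮ z in C(c, R), (1 / (z - c) ^ (m - r + 1)) • h z := by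
    refine circleIntegral.integral_congr hR.1.le fun z hz => ?_
    have hz' : z ≠ c := by
      rintro rfl
      simp at hz
      exact hR.1.ne hz
    have h3 : z - c ≠ 0 := sub_ne_zero.2 hz'
    have := (hball (hsub (Metric.sphere_subset_closedBall hz))).2 hz'
    rw [this, smul_eq_mul, show m + 1 = (m - r + 1) + r by omega, pow_add]
    field_simp
  rw [this, key, smul_eq_mul]
  have h2 : ((m - r)! : ℂ) ≠ 0 := by exact_mod_cast (m - r).factorial_ne_zero
  have h4 : (Real.pi : ℂ) ≠ 0 := by exact_mod_cast Real.pi_ne_zero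
  field_simp [I_ne_zero]

theorem HasResidue.unique {g : ℂ → ℂ} {c ρ ρ' : ℂ} (h : HasResidue g c ρ) (h' : HasResidue g c ρ') :
    ρ = ρ' := by
  obtain ⟨r, h1, h2⟩ := (h.and h').exists
  exact h1.symm.trans h2

theorem hasResidue_of_analyticAt {g : ℂ → ℂ} {c : ℂ} (h : AnalyticAt ℂ g c) :
    HasResidue g c 0 := by
  have := hasResidue_pow_mul (a := g) (h := fun z => (z - c) ^ 1 * g z) (c := c) (m := 0) (r := 0)
    le_rfl (by fun_prop) (by
      filter_upwards [self_mem_nhdsWithin] with z hz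
      have h3 : z - c ≠ 0 := sub_ne_zero.2 hz
      simp only [zero_add, pow_one]
      field_simp)
  simpa using this

theorem PolarRel.hasResidue {a ψ : ℂ → ℂ} {p : ℂ} {m r : ℕ} (h : PolarRel a ψ p m) (hr : r ≤ m)
    (hψ : AnalyticAt ℂ ψ p) :
    HasResidue (fun z => (z - p) ^ r * a z) p (iteratedDeriv (m - r) ψ p / (m - r)!) := by
  obtain ⟨k, hk, he⟩ := h
  have hv : VanishesTo (fun z => (ψ z + (z - p) ^ (m + 1) * k z) - ψ z) p (m + 1) :=
    ⟨k, hk, Eventually.of_forall fun z => by ring⟩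
  rw [VanishesTo.sub_iff_iteratedDeriv (by fun_prop) hψ] at hv
  rw [← hv (m - r) (by omega)]
  refine hasResidue_pow_mul hr (by fun_prop) ?_
  filter_upwards [he, self_mem_nhdsWithin] with z hz hz'
  have h3 : z - p ≠ 0 := sub_ne_zero.2 hz'
  rw [hz]; field_simp

/-- Since the pole has order at most `m + 1`, `a` is `H / (z - p)^(m+1)` with `H` analytic. The
residues of `(z - p)^r a` for `r ≤ m` are then the Taylor coefficients of `H` up to order `m`, so
`H` and `ψ` have the same jet. -/
theorem polarRel_of_hasResidue {a ψ : ℂ → ℂ} {p : ℂ} {m : ℕ} (ha : MeromorphicAt a p)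
    (ho : ((-((m + 1 : ℕ) : ℤ) : ℤ) : WithTop ℤ) ≤ meromorphicOrderAt a p) (hψ : AnalyticAt ℂ ψ p)
    (h : ∀ r ≤ m, HasResidue (fun z => (z - p) ^ r * a z) p
      (iteratedDeriv (m - r) ψ p / (m - r)!)) : PolarRel a ψ p m := by
  have hb : MeromorphicAt (fun z => (z - p) ^ (m + 1) * a z) p := by fun_prop
  have hob : 0 ≤ meromorphicOrderAt (fun z => (z - p) ^ (m + 1) * a z) p := by
    have h1 : MeromorphicAt (fun z => (z - p) ^ (m + 1)) p := by fun_prop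
    have h2 : meromorphicOrderAt (fun z => (z - p) ^ (m + 1)) p = ((m + 1 : ℕ) : ℤ) := by
      rw [meromorphicOrderAt_eq_int_iff h1]
      exact ⟨fun _ => 1, analyticAt_const, one_ne_zero, Eventually.of_forall fun z => by
        rw [zpow_natCast]; simp⟩
    have h3 := meromorphicOrderAt_mul h1 ha
    have h4 : (fun z => (z - p) ^ (m + 1) * a z) = (fun z => (z - p) ^ (m + 1)) * a := rfl
    rw [h4, h3, h2]
    have : (0 : WithTop ℤ) = (((m + 1 : ℕ) : ℤ) : WithTop ℤ)
        + ((-((m + 1 : ℕ) : ℤ) : ℤ) : WithTop ℤ) := by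
      rw [← WithTop.coe_add, add_neg_cancel]; rfl
    rw [this]
    gcongr
  obtain ⟨H, hH, he⟩ : ∃ H, AnalyticAt ℂ H p ∧
      ∀ᶠ z in 𝓝[≠] p, (z - p) ^ (m + 1) * a z = H z := by
    rcases eq_or_ne (meromorphicOrderAt (fun z => (z - p) ^ (m + 1) * a z) p) ⊤ with ht | ht
    · exact ⟨fun _ => 0, analyticAt_const, by
        simpa using meromorphicOrderAt_eq_top_iff.1 ht⟩
    · obtain ⟨n, hn⟩ := WithTop.ne_top_iff_exists.1 ht
      obtain ⟨g, hg, -, hge⟩ := (meromorphicOrderAt_eq_int_iff hb).1 hn.symm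
      rw [← hn] at hob
      have hn0 : 0 ≤ n := by exact_mod_cast hob
      lift n to ℕ using hn0
      refine ⟨fun z => (z - p) ^ n * g z, by fun_prop, ?_⟩
      filter_upwards [hge] with z hz
      rw [hz, zpow_natCast, smul_eq_mul]
  have he' : ∀ᶠ z in 𝓝[≠] p, a z = H z / (z - p) ^ (m + 1) := by
    filter_upwards [he, self_mem_nhdsWithin] with z hz hz'
    have h3 : z - p ≠ 0 := sub_ne_zero.2 hz'
    rw [← hz]; field_simp
  have hj : ∀ i < m + 1, iteratedDeriv i H p = iteratedDeriv i ψ p := by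
    intro i hi
    have h1 := h (m - i) (by omega)
    have h2 := hasResidue_pow_mul (m := m) (r := m - i) (by omega) hH he'
    have := h2.unique h1
    rw [show m - (m - i) = i by omega] at this
    have h2 : (i ! : ℂ) ≠ 0 := by exact_mod_cast i.factorial_ne_zero
    field_simp at this
    exact this
  obtain ⟨k, hk, hke⟩ := (VanishesTo.sub_iff_iteratedDeriv hH hψ).2 hj
  refine ⟨k, hk, ?_⟩
  filter_upwards [he', hke.filter_mono nhdsWithin_le_nhds, self_mem_nhdsWithin] with z h1 h2 h3
  have h3 : z - p ≠ 0 := sub_ne_zero.2 h3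
  rw [h1, sub_eq_iff_eq_add.1 h2]; field_simp; ring

/-- Filling in the removable singularities gives an entire function with a limit at infinity, and
Liouville's theorem applies. -/
theorem eq_const_of_removable {f : ℂ → ℂ} {S : Set ℂ} (hS : S.Finite) {α : ℂ}
    (hf : ∀ z ∉ S, AnalyticAt ℂ f z)
    (hr : ∀ p ∈ S, ∃ k, AnalyticAt ℂ k p ∧ ∀ᶠ z in 𝓝[≠] p, f z = k z)
    (hlim : Tendsto f (Bornology.cobounded ℂ) (𝓝 α)) : ∀ z ∉ S, f z = α := by
  classical
  choose! k hk he using hr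
  set F : ℂ → ℂ := fun z => if z ∈ S then k z z else f z with hF
  have hdiff : Differentiable ℂ F := by
    intro z
    by_cases hz : z ∈ S
    · refine (hk z hz).differentiableAt.congr_of_eventuallyEq ?_
      have h1 : ∀ᶠ w in 𝓝[≠] z, w ∉ S := by
        have : (S \ {z})ᶜ ∈ 𝓝 z := (hS.subset Set.sdiff_subset).isClosed.isOpen_compl.mem_nhds
          (by simp)
        filter_upwards [mem_nhdsWithin_of_mem_nhds this, self_mem_nhdsWithin] with w h1 h2 h3
        exact h1 ⟨h3, h2⟩
      have h2 : ∀ᶠ w in 𝓝[≠] z, F w = k z w := by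
        filter_upwards [h1, he z hz] with w h1 h2
        simp [hF, h1, h2]
      rw [eventually_nhdsWithin_iff] at h2
      filter_upwards [h2] with w hw
      by_cases hwz : w = z
      · subst hwz; simp [hF, hz]
      · exact hw hwz
    · refine (hf z hz).differentiableAt.congr_of_eventuallyEq ?_
      filter_upwards [hS.isClosed.isOpen_compl.mem_nhds hz] with w hw
      simp only [hF]
      rw [if_neg hw]
  have hlim' : Tendsto F (cocompact ℂ) (𝓝 α) := by
    rw [← Metric.cobounded_eq_cocompact]
    refine hlim.congr' ?_
    filter_upwards [hS.isBounded] with z hz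
    simp only [hF]
    rw [if_neg hz]
  intro z hz
  have := hdiff.apply_eq_of_tendsto_cocompact z hlim'
  simp only [hF] at this
  rwa [if_neg hz] at this

/-! ### Jets of `e^{sθ} P` and their dependence on `(x,t)` -/

section ExpJet

theorem contDiff_fderiv_apply {E : Type*} [NormedAddCommGroup E] [NormedSpace ℂ E] {F : E → ℂ}
    (hF : ContDiff ℂ ∞ F) (v : E) : ContDiff ℂ ∞ (fun q => fderiv ℂ F q v) :=
  (hF.fderiv_right (m := ∞) (by simp)).clm_apply contDiff_const

theorem fderiv_apply_comm {E : Type*} [NormedAddCommGroup E] [NormedSpace ℂ E] {F : E → ℂ}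
    (hF : ContDiff ℂ ∞ F) (v w : E) :
    (fun q => fderiv ℂ (fun q => fderiv ℂ F q v) q w)
      = fun q => fderiv ℂ (fun q => fderiv ℂ F q w) q v := by
  ext q
  have hd : DifferentiableAt ℂ (fderiv ℂ F) q :=
    ((hF.fderiv_right (m := ∞) (by simp)).differentiable (by simp)).differentiableAt
  have h : ∀ v w, fderiv ℂ (fun q => fderiv ℂ F q v) q w = fderiv ℂ (fderiv ℂ F) q w v := by
    intro v w
    rw [fderiv_clm_apply hd (differentiableAt_const v)]
    simp
  rw [h, h]
  have hs : IsSymmSndFDerivAt ℂ F q := by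
    refine (hF.contDiffAt (x := q)).isSymmSndFDerivAt ?_
    rw [minSmoothness_of_isRCLikeNormedField]
    exact (WithTop.coe_le_coe.2 le_top : ((2 : ℕ∞) : ℕ∞ω) ≤ ((⊤ : ℕ∞) : ℕ∞ω))
  exact hs w v

variable {E : Type*} [NormedAddCommGroup E] [NormedSpace ℂ E]

/-- The derivative of `F` in the direction `v`. -/
def dirDeriv (v : E) (F : E → ℂ) (q : E) : ℂ := fderiv ℂ F q v

theorem contDiff_iterate_dirDeriv {F : E → ℂ} (hF : ContDiff ℂ ∞ F) (v : E) (j : ℕ) :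
    ContDiff ℂ ∞ ((dirDeriv v)^[j] F) := by
  induction j generalizing F with
  | zero => exact hF
  | succ j ih =>
    rw [Function.iterate_succ_apply]
    exact ih (contDiff_fderiv_apply hF v)

/-- Symmetry of second derivatives, iterated. It moves the derivative in `(x,t)` past the
derivatives in the spectral parameter. -/
theorem dirDeriv_iterate_comm {F : E → ℂ} (hF : ContDiff ℂ ∞ F) (v w : E) (j : ℕ) :
    dirDeriv w ((dirDeriv v)^[j] F) = (dirDeriv v)^[j] (dirDeriv w F) := by
  induction j generalizing F with
  | zero => rfl
  | succ j ih =>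
    rw [Function.iterate_succ_apply, Function.iterate_succ_apply,
      ih (F := dirDeriv v F) (contDiff_fderiv_apply hF v)]
    congr 1
    exact fderiv_apply_comm hF v w

theorem iteratedDeriv_eq_dirDeriv {F : ℂ × ℂ × ℂ → ℂ} (hF : ContDiff ℂ ∞ F) (x t : ℂ) (j : ℕ) :
    iteratedDeriv j (fun z => F (x, t, z)) = fun z => (dirDeriv (0, 0, 1))^[j] F (x, t, z) := by
  induction j generalizing F with
  | zero => simp
  | succ j ih =>
    rw [iteratedDeriv_succ', Function.iterate_succ_apply,
      ← ih (F := dirDeriv _ F) (contDiff_fderiv_apply hF _)]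
    congr 1
    ext z
    have h1 : HasFDerivAt F (fderiv ℂ F (x, t, z)) (x, t, z) :=
      (hF.differentiable (by simp)).differentiableAt.hasFDerivAt
    have h2 : HasDerivAt (fun z : ℂ => (x, t, z)) (0, 0, 1) z :=
      (hasDerivAt_const z x).prodMk ((hasDerivAt_const z t).prodMk (hasDerivAt_id z))
    exact (h1.comp_hasDerivAt z h2).deriv

/-- `e^{sθ(x,t;z)} P(z)` as a function of three complex variables. -/
def expPoly (s : ℂ) (P : ℂ[X]) (q : ℂ × ℂ × ℂ) : ℂ :=
  exp (s * (q.2.2 * q.1 + 4 * q.2.2 ^ 3 * q.2.1)) * P.eval q.2.2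

theorem contDiff_expPoly (s : ℂ) (P : ℂ[X]) : ContDiff ℂ ∞ (expPoly s P) := by
  unfold expPoly
  have h1 : ContDiff ℂ ∞ (fun z : ℂ => P.eval z) := P.differentiable.contDiff
  have h2 : ContDiff ℂ ∞ (fun q : ℂ × ℂ × ℂ => P.eval q.2.2) :=
    h1.comp (contDiff_snd.comp contDiff_snd)
  refine ContDiff.mul (ContDiff.cexp ?_) h2
  fun_prop

/-- The derivative of the phase along `(a, b)`, as a polynomial in the spectral parameter. -/
def phasePoly (a b : ℝ) : ℂ[X] :=
  Polynomial.C (a : ℂ) * Polynomial.X + Polynomial.C (4 * b : ℂ) * Polynomial.X ^ 3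

theorem dirDeriv_expPoly (s : ℂ) (P : ℂ[X]) (a b : ℝ) :
    dirDeriv ((a : ℂ), (b : ℂ), 0) (expPoly s P)
      = expPoly s (Polynomial.C s * phasePoly a b * P) := by
  ext q
  have h1 : HasFDerivAt (expPoly s P) (fderiv ℂ (expPoly s P) q) q :=
    ((contDiff_expPoly s P).differentiable (by simp)).differentiableAt.hasFDerivAt
  have h2 : HasDerivAt (fun τ : ℂ => (q.1 + τ * a, q.2.1 + τ * b, q.2.2)) ((a : ℂ), (b : ℂ), 0) 0 :=
    ((((hasDerivAt_id (0 : ℂ)).mul_const (a : ℂ)).const_add q.1).congr_deriv (by simp)).prodMk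
      (((((hasDerivAt_id (0 : ℂ)).mul_const (b : ℂ)).const_add q.2.1).congr_deriv (by simp)).prodMk
      (hasDerivAt_const _ _))
  have h3 : HasDerivAt (fun τ : ℂ => expPoly s P (q.1 + τ * a, q.2.1 + τ * b, q.2.2))
      (fderiv ℂ (expPoly s P) q ((a : ℂ), (b : ℂ), 0)) 0 := by
    refine HasFDerivAt.comp_hasDerivAt (f := fun τ : ℂ => (q.1 + τ * a, q.2.1 + τ * b, q.2.2))
      (l := expPoly s P) 0 ?_ h2
    simpa using h1
  have h4 : HasDerivAt (fun τ : ℂ => s * (q.2.2 * (q.1 + τ * a)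
      + 4 * q.2.2 ^ 3 * (q.2.1 + τ * b))) (s * (q.2.2 * a + 4 * q.2.2 ^ 3 * b)) 0 := by
    have := ((((hasDerivAt_id (0 : ℂ)).mul_const (a : ℂ)).const_add q.1).const_mul q.2.2).add
      ((((hasDerivAt_id (0 : ℂ)).mul_const (b : ℂ)).const_add q.2.1).const_mul (4 * q.2.2 ^ 3))
    simpa using this.const_mul s
  have h5 := (h4.cexp.mul_const (P.eval q.2.2))
  have h6 := h3.unique h5
  rw [dirDeriv, h6]
  simp [expPoly, phasePoly]
  ring

/-- The `j`-th derivative at `p` of `z ↦ e^{sθ(x,t;z)} P(z)`, linear in `P`. -/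
def expJet (s : ℂ) (x t : ℝ) (j : ℕ) (p : ℂ) : ℂ[X] →ₗ[ℂ] ℂ where
  toFun P := iteratedDeriv j (fun z => exp (s * phase x t z) * P.eval z) p
  map_add' P Q := by
    have h : ∀ P : ℂ[X], ContDiffAt ℂ j (fun z => exp (s * phase x t z) * P.eval z) p := by
      intro P
      unfold phase
      have h1 : ContDiff ℂ j (fun z : ℂ => P.eval z) := P.differentiable.contDiff
      exact (ContDiff.mul (by fun_prop) h1).contDiffAt
    rw [← iteratedDeriv_fun_add (h P) (h Q)]
    congr 1; ext z; simp; ring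
  map_smul' c P := by
    simp only [RingHom.id_apply]
    rw [← iteratedDeriv_const_smul_field]
    congr 1; ext z; simp; ring

theorem expJet_eq (s : ℂ) (x t : ℝ) (j : ℕ) (p : ℂ) (P : ℂ[X]) :
    expJet s x t j p P = (dirDeriv (0, 0, 1))^[j] (expPoly s P) ((x : ℂ), (t : ℂ), p) := by
  have := congrFun (iteratedDeriv_eq_dirDeriv (contDiff_expPoly s P) x t j) p
  rw [← this]
  rfl

theorem contDiff_expJet (s : ℂ) (j : ℕ) (p : ℂ) (P : ℂ[X]) :
    ContDiff ℝ ∞ (fun q : ℝ × ℝ => expJet s q.1 q.2 j p P) := by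
  simp_rw [expJet_eq]
  have h1 := (contDiff_iterate_dirDeriv (contDiff_expPoly s P) (0, 0, 1) j).restrict_scalars ℝ
  have h2 : ContDiff ℝ ∞ (fun q : ℝ × ℝ => ((q.1 : ℂ), (q.2 : ℂ), p)) :=
    (ofRealCLM.contDiff.comp contDiff_fst).prodMk
      ((ofRealCLM.contDiff.comp contDiff_snd).prodMk contDiff_const)
  exact h1.comp h2

/-- Differentiating the exponential brings down `s` times a polynomial in the spectral parameter,
which can be absorbed into `P`. Jets of this kind are thus closed under differentiation in `x` and
`t`, which drives the Lax equations. -/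
theorem hasDerivAt_expJet (s : ℂ) (x t a b : ℝ) (j : ℕ) (p : ℂ) (P : ℂ[X]) :
    HasDerivAt (fun τ : ℝ => expJet s (x + τ * a) (t + τ * b) j p P)
      (expJet s x t j p (Polynomial.C s * phasePoly a b * P)) 0 := by
  simp_rw [expJet_eq]
  rw [← dirDeriv_expPoly, ← dirDeriv_iterate_comm (contDiff_expPoly s P)]
  have hc := contDiff_iterate_dirDeriv (contDiff_expPoly s P) (0, 0, 1) j
  set F := (dirDeriv (0, 0, 1))^[j] (expPoly s P)
  have h1 : HasFDerivAt F (fderiv ℂ F ((x : ℂ), (t : ℂ), p)) ((x : ℂ), (t : ℂ), p) :=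
    (hc.differentiable (by simp)).differentiableAt.hasFDerivAt
  have h2 : ∀ x a : ℝ, HasDerivAt (fun τ : ℝ => ((x + τ * a : ℝ) : ℂ)) (a : ℂ) 0 := fun x a =>
    ((((hasDerivAt_id (0 : ℝ)).mul_const a).const_add x).congr_deriv (by simp)).ofReal_comp
  have h3 : HasDerivAt (fun τ : ℝ => (((x + τ * a : ℝ) : ℂ), ((t + τ * b : ℝ) : ℂ), p))
      ((a : ℂ), (b : ℂ), 0) 0 := (h2 x a).prodMk ((h2 t b).prodMk (hasDerivAt_const _ _))
  refine HasFDerivAt.comp_hasDerivAt (l := F) (l' := (fderiv ℂ F ((x : ℂ), (t : ℂ), p)).restrictScalars ℝ)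
    (f := fun τ : ℝ => (((x + τ * a : ℝ) : ℂ), ((t + τ * b : ℝ) : ℂ), p)) 0 ?_ h3
  simpa using h1.restrictScalars ℝ

end ExpJet

/-- An injective square system is invertible, and inversion is smooth at invertible operators. -/
theorem exists_contDiff_solution {V E F : Type*} [NormedAddCommGroup V] [NormedSpace ℝ V]
    [NormedAddCommGroup E] [NormedSpace ℝ E] [FiniteDimensional ℝ E]
    [NormedAddCommGroup F] [NormedSpace ℝ F] [FiniteDimensional ℝ F]
    (hdim : Module.finrank ℝ E = Module.finrank ℝ F) (L : V → E →ₗ[ℝ] F)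
    (hL : ∀ u, ContDiff ℝ ∞ (fun q => L q u)) (hinj : ∀ q u, L q u = 0 → u = 0)
    {r : V → F} (hr : ContDiff ℝ ∞ r) :
    ∃ u : V → E, ContDiff ℝ ∞ u ∧ ∀ q, L q (u q) = r q := by
  have : CompleteSpace E := FiniteDimensional.complete ℝ E
  have hker : ∀ q, LinearMap.ker (L q) = ⊥ := fun q => LinearMap.ker_eq_bot'.2 (hinj q)
  set e : V → E ≃L[ℝ] F := fun q =>
    (LinearEquiv.ofInjectiveOfFinrankEq (L q) (LinearMap.ker_eq_bot.1 (hker q)) hdim).toContinuousLinearEquiv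
  have he : ∀ q u, e q u = L q u := fun q u => rfl
  have hc : ContDiff ℝ ∞ (fun q => (e q : E →L[ℝ] F)) := contDiff_clm_apply_iff.2 hL
  refine ⟨fun q => ContinuousLinearMap.inverse (e q : E →L[ℝ] F) (r q), ?_, fun q => ?_⟩
  · refine ContDiff.clm_apply ?_ hr
    rw [contDiff_iff_contDiffAt]
    intro q
    exact (contDiffAt_map_inverse (e q)).comp q hc.contDiffAt
  · simp only [ContinuousLinearMap.inverse_equiv, ← he]
    exact (e q).apply_symm_apply _

/-! ### Residue conditions on polynomial numerators -/

/-- Conjugation of the coefficients of a polynomial. -/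
abbrev conjPoly (P : ℂ[X]) : ℂ[X] := P.map (starRingEnd ℂ)

theorem eval_conjPoly (P : ℂ[X]) (z : ℂ) : (conjPoly P).eval z = conj (P.eval (conj z)) := by
  conv_lhs => rw [← Complex.conj_conj z]
  rw [Polynomial.eval_map, Polynomial.eval₂_at_apply]

theorem conjPoly_conjPoly (P : ℂ[X]) : conjPoly (conjPoly P) = P := by
  ext n; simp

theorem analyticAt_eval (P : ℂ[X]) (p : ℂ) : AnalyticAt ℂ (fun z => P.eval z) p :=
  P.differentiable.analyticAt p

theorem analyticAt_exp_phase (s : ℂ) (x t : ℝ) (p : ℂ) :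
    AnalyticAt ℂ (fun z => exp (s * phase x t z)) p := by
  unfold phase; fun_prop

theorem conj_phase (x t : ℝ) (z : ℂ) : conj (phase x t z) = phase x t (conj z) := by
  have : conj (4 : ℂ) = 4 := Complex.conj_ofNat 4
  simp [phase, this]

theorem conj_exp_phase (x t : ℝ) (z : ℂ) :
    conj (exp (-2 * I * phase x t (conj z))) = exp (2 * I * phase x t z) := by
  rw [← Complex.exp_conj]
  congr 1
  have : conj (2 : ℂ) = 2 := Complex.conj_ofNat 2
  simp [conj_phase, this]

/-- Spectral data of a reflectionless problem without redundancy: distinct points of the upper half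
plane, their orders, and polynomial residue constants. -/
structure PoleData (ι : Type*) (n : ℕ) where
  /-- the points -/
  pt : ι → ℂ
  /-- one less than the pole orders -/
  ord : ι → ℕ
  /-- the residue constants -/
  g : ι → Fin n → ℂ[X]
  inj : Function.Injective pt
  im_pos : ∀ a, 0 < (pt a).im

namespace PoleData

variable {ι : Type*} [Fintype ι] {n : ℕ} (D : PoleData ι n)

/-- The monic polynomial with the prescribed zeros in the upper half plane. -/
def W : ℂ[X] := ∏ a, (Polynomial.X - Polynomial.C (D.pt a)) ^ (D.ord a + 1)

open Classical in
/-- The part of `W` which does not vanish at the point with index `a`. -/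
def cof (a : ι) : ℂ[X] :=
  ∏ b ∈ Finset.univ.erase a, (Polynomial.X - Polynomial.C (D.pt b)) ^ (D.ord b + 1)

/-- The common denominators of the entries of a row. -/
def den : Unit ⊕ Fin n → ℂ[X] := Sum.elim (fun _ => D.W) (fun _ => conjPoly D.W)

/-- The degree of `W`. -/
def deg : ℕ := ∑ a, (D.ord a + 1)

open Classical in
theorem W_eq (a : ι) : D.W = (Polynomial.X - Polynomial.C (D.pt a)) ^ (D.ord a + 1) * D.cof a :=
  (Finset.mul_prod_erase Finset.univ
    (fun b => (Polynomial.X - Polynomial.C (D.pt b)) ^ (D.ord b + 1)) (Finset.mem_univ a)).symm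

theorem W_monic : D.W.Monic :=
  Polynomial.monic_prod_of_monic _ _ fun _ _ => (Polynomial.monic_X_sub_C _).pow _

theorem W_natDegree : D.W.natDegree = D.deg := by
  unfold W deg
  rw [Polynomial.natDegree_prod_of_monic _ _ fun _ _ => (Polynomial.monic_X_sub_C _).pow _]
  simp

theorem conjPoly_W_monic : (conjPoly D.W).Monic := D.W_monic.map _

theorem conjPoly_W_natDegree : (conjPoly D.W).natDegree = D.deg := by
  rw [Polynomial.natDegree_map, W_natDegree]

theorem den_monic (j : Unit ⊕ Fin n) : (D.den j).Monic := by
  rcases j with _ | _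
  · exact D.W_monic
  · exact D.conjPoly_W_monic

theorem den_natDegree (j : Unit ⊕ Fin n) : (D.den j).natDegree = D.deg := by
  rcases j with _ | _
  · exact D.W_natDegree
  · exact D.conjPoly_W_natDegree

theorem eval_W_ne_zero {z : ℂ} (hz : ∀ a, z ≠ D.pt a) : D.W.eval z ≠ 0 := by
  unfold W
  rw [Polynomial.eval_prod, Finset.prod_ne_zero_iff]
  intro a _
  simpa using sub_ne_zero.2 (hz a)

open Classical in
theorem eval_cof_ne_zero (a : ι) : (D.cof a).eval (D.pt a) ≠ 0 := by
  unfold cof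
  rw [Polynomial.eval_prod, Finset.prod_ne_zero_iff]
  intro b hb
  simpa using sub_ne_zero.2 fun h => (Finset.ne_of_mem_erase hb) (D.inj h).symm

theorem eval_conjW_ne_zero {z : ℂ} (hz : ∀ a, z ≠ conj (D.pt a)) : (conjPoly D.W).eval z ≠ 0 := by
  rw [eval_conjPoly]
  refine (map_ne_zero _).2 (D.eval_W_ne_zero fun a h => hz a ?_)
  rw [← h, Complex.conj_conj]

theorem eval_conjW_ne_zero_of_im_pos {z : ℂ} (hz : 0 < z.im) : (conjPoly D.W).eval z ≠ 0 := by
  refine D.eval_conjW_ne_zero fun a h => ?_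
  have := D.im_pos a
  rw [h, Complex.conj_im] at hz
  linarith

theorem isCoprime_W : IsCoprime D.W (conjPoly D.W) := by
  have : conjPoly D.W
      = ∏ a, (Polynomial.X - Polynomial.C (conj (D.pt a))) ^ (D.ord a + 1) := by
    simp [conjPoly, W, Polynomial.map_prod]
  rw [this, W]
  refine IsCoprime.prod_left fun a _ => IsCoprime.prod_right fun b _ => IsCoprime.pow ?_
  refine Polynomial.isCoprime_X_sub_C_of_isUnit_sub (sub_ne_zero.2 fun h => ?_).isUnit
  have h1 := D.im_pos a
  have h2 := D.im_pos b
  rw [h, Complex.conj_im] at h1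
  linarith

theorem W_dvd {P : ℂ[X]}
    (h : ∀ a, (Polynomial.X - Polynomial.C (D.pt a)) ^ (D.ord a + 1) ∣ P) : D.W ∣ P := by
  refine Finset.prod_dvd_of_coprime (fun a _ b _ hab => IsCoprime.pow ?_) fun a _ => h a
  exact Polynomial.isCoprime_X_sub_C_of_isUnit_sub (sub_ne_zero.2 (D.inj.ne hab)).isUnit

/-- The expression whose vanishing to order `ord a + 1` at `pt a` is the residue condition there. -/
def condUp (x t : ℝ) (P : Unit ⊕ Fin n → ℂ[X]) (a : ι) (z : ℂ) : ℂ :=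
  (P (.inl ())).eval z * (conjPoly D.W).eval z
    - exp (2 * I * phase x t z) * ∑ i, (P (.inr i)).eval z * (D.g a i * D.cof a).eval z

/-- The expression whose vanishing to order `ord a + 1` at `conj (pt a)` is the residue
condition there. -/
def condLow (x t : ℝ) (P : Unit ⊕ Fin n → ℂ[X]) (a : ι) (i : Fin n) (z : ℂ) : ℂ :=
  (P (.inr i)).eval z * D.W.eval z
    + exp (-2 * I * phase x t z)
      * ((P (.inl ())).eval z * (conjPoly (D.g a i * D.cof a)).eval z)

/-- The row `P_j / den_j` satisfies the residue conditions. -/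
def Cond (x t : ℝ) (P : Unit ⊕ Fin n → ℂ[X]) : Prop :=
  (∀ a, VanishesTo (D.condUp x t P a) (D.pt a) (D.ord a + 1)) ∧
  ∀ a i, VanishesTo (D.condLow x t P a i) (conj (D.pt a)) (D.ord a + 1)

variable {D} {x t : ℝ} {P P' : Unit ⊕ Fin n → ℂ[X]}

theorem Cond.add (h : D.Cond x t P) (h' : D.Cond x t P') :
    D.Cond x t (fun j => P j + P' j) := by
  refine ⟨fun a => ((h.1 a).add (h'.1 a)).congr' fun z => ?_,
    fun a i => ((h.2 a i).add (h'.2 a i)).congr' fun z => ?_⟩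
  · simp only [condUp, Polynomial.eval_add, add_mul, Finset.sum_add_distrib]; ring
  · simp only [condLow, Polynomial.eval_add]; ring

/-- Rows subject to the conditions form a module over the polynomials in `z`; this is what lets the
Lax operators act on them. -/
theorem Cond.mul_left (h : D.Cond x t P) (R : ℂ[X]) : D.Cond x t (fun j => R * P j) := by
  refine ⟨fun a => ((h.1 a).mul_left (analyticAt_eval R _)).congr' fun z => ?_,
    fun a i => ((h.2 a i).mul_left (analyticAt_eval R _)).congr' fun z => ?_⟩
  · simp only [condUp, Polynomial.eval_mul, mul_sub, Finset.mul_sum]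
    congr 1
    · ring
    · exact Finset.sum_congr rfl fun i _ => by ring
  · simp only [condLow, Polynomial.eval_mul]; ring

theorem Cond.sub (h : D.Cond x t P) (h' : D.Cond x t P') :
    D.Cond x t (fun j => P j - P' j) := by
  have := h.add (h'.mul_left (-1))
  simpa [sub_eq_add_neg] using this

theorem Cond.zero : D.Cond x t (fun _ => 0) :=
  ⟨fun a => VanishesTo.zero.congr' fun z => by simp [condUp],
    fun a i => VanishesTo.zero.congr' fun z => by simp [condLow]⟩

theorem Cond.sum {κ : Type*} (s : Finset κ) {Q : κ → Unit ⊕ Fin n → ℂ[X]}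
    (h : ∀ k ∈ s, D.Cond x t (Q k)) : D.Cond x t (fun j => ∑ k ∈ s, Q k j) := by
  classical
  induction s using Finset.induction_on with
  | empty => simpa using Cond.zero
  | insert a s ha ih =>
    simp only [Finset.sum_insert ha]
    exact (h a (by simp)).add (ih fun i hi => h i (by simp [hi]))

/-- Multiply `condUp` for `P` by the conjugate of `P'_L`, and add the products of `P_R` with the
conjugated `condLow` for `P'`. The exponential terms are opposite and cancel, and `W*` times the
pairing remains. Since `W*` does not vanish in the upper half plane, it can be divided out near each
point. -/
theorem Cond.W_dvd_pairing (h : D.Cond x t P) (h' : D.Cond x t P') :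
    D.W ∣ ∑ j, P j * conjPoly (P' j) := by
  refine D.W_dvd fun a => ?_
  refine VanishesTo.dvd ?_
  have h1 := (h.1 a).mul_left (analyticAt_eval (conjPoly (P' (.inl ()))) _)
  have h2 : ∀ i, VanishesTo (fun z => (P (.inr i)).eval z
      * conj (D.condLow x t P' a i (conj z))) (D.pt a) (D.ord a + 1) := fun i =>
    VanishesTo.mul_left (VanishesTo.conj_conj (h'.2 a i)) (analyticAt_eval (P (.inr i)) _)
  have h3 := h1.add (VanishesTo.sum Finset.univ fun i _ => h2 i)
  have hne := D.eval_conjW_ne_zero_of_im_pos (D.im_pos a)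
  have hinv : AnalyticAt ℂ (fun z => ((conjPoly D.W).eval z)⁻¹) (D.pt a) :=
    (analyticAt_eval _ _).inv hne
  refine (h3.mul_left hinv).congr ?_
  have hne' : ∀ᶠ z in 𝓝 (D.pt a), (conjPoly D.W).eval z ≠ 0 :=
    (analyticAt_eval (conjPoly D.W) (D.pt a)).continuousAt.eventually_ne hne
  filter_upwards [hne'] with z hz
  rw [eq_inv_mul_iff_mul_eq₀ hz]
  simp only [condUp, condLow, map_add, map_mul, conj_exp_phase, ← eval_conjPoly,
    conjPoly_conjPoly, Fintype.sum_sum_type, Finset.univ_unique, Finset.sum_singleton,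
    Polynomial.eval_add, Polynomial.eval_mul, Polynomial.eval_finsetSum, mul_add, mul_sub,
    Finset.sum_add_distrib, Finset.mul_sum]
  simp only [PUnit.default_eq_unit]
  have key : ∀ {A B X Y A' B' : ℂ}, A = A' → X = Y → B = B' → A + B = A' - X + (B' + Y) := by
    rintro A B X Y _ _ rfl rfl rfl; ring
  refine key ?_ ?_ ?_
  · ring
  · exact Finset.sum_congr rfl fun i _ => by ring
  · exact Finset.sum_congr rfl fun i _ => by ring

theorem Cond.dvd_pairing (h : D.Cond x t P) (h' : D.Cond x t P') :
    D.W * conjPoly D.W ∣ ∑ j, P j * conjPoly (P' j) := by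
  refine D.isCoprime_W.mul_dvd (h.W_dvd_pairing h') ?_
  -- Conjugating the pairing exchanges the two rows, so divisibility by `W*` is the conjugate of
  -- divisibility by `W` for the exchanged pair.
  have := map_dvd (Polynomial.mapRingHom (starRingEnd ℂ)) (h'.W_dvd_pairing h)
  simp only [Polynomial.coe_mapRingHom, Polynomial.map_sum, Polynomial.map_mul,
    conjPoly_conjPoly] at this
  refine this.trans (dvd_of_eq (Finset.sum_congr rfl fun j _ => mul_comm _ _))

/-- The pairing of the row with itself has degree less than `2 deg` but is a multiple of `W W*`,
which has degree `2 deg`; so it is zero. At real points it equals `∑ |P_j|²`, hence each `P_j` has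
infinitely many zeros. -/
theorem Cond.eq_zero (h : D.Cond x t P) (hdeg : ∀ j, (P j).degree < (D.deg : WithBot ℕ)) (j) :
    P j = 0 := by
  have hdvd := h.dvd_pairing h
  have hz : ∑ j, P j * conjPoly (P j) = 0 := by
    refine Polynomial.eq_zero_of_dvd_of_degree_lt hdvd ?_
    have hd : (D.W * conjPoly D.W).degree = ((D.deg + D.deg : ℕ) : WithBot ℕ) := by
      rw [Polynomial.degree_mul, Polynomial.degree_eq_natDegree D.W_monic.ne_zero,
        Polynomial.degree_eq_natDegree D.conjPoly_W_monic.ne_zero, D.W_natDegree,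
        D.conjPoly_W_natDegree]
      rfl
    rw [hd]
    refine (Polynomial.degree_sum_le _ _).trans_lt ?_
    rw [Finset.sup_lt_iff (WithBot.bot_lt_coe _)]
    intro j _
    rcases eq_or_ne (P j) 0 with h0 | h0
    · simp [h0]
    have h1 := hdeg j
    rw [Polynomial.degree_mul, Polynomial.degree_map, Polynomial.degree_eq_natDegree h0] at *
    norm_cast at *
    omega
  have hreal : ∀ s : ℝ, (P j).eval (s : ℂ) = 0 := by
    intro s
    have h1 := congrArg (Polynomial.eval (s : ℂ)) hz
    simp only [Polynomial.eval_finsetSum, Polynomial.eval_mul, eval_conjPoly,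
      Complex.conj_ofReal, Complex.mul_conj, Polynomial.eval_zero] at h1
    have h2 : ∑ j, Complex.normSq ((P j).eval (s : ℂ)) = 0 := by exact_mod_cast h1
    rw [Finset.sum_eq_zero_iff_of_nonneg fun j _ => Complex.normSq_nonneg _] at h2
    exact Complex.normSq_eq_zero.1 (h2 j (Finset.mem_univ j))
  refine Polynomial.eq_zero_of_infinite_isRoot _ (Set.Infinite.mono ?_
    (Set.infinite_range_of_injective Complex.ofReal_injective))
  rintro _ ⟨s, rfl⟩
  exact hreal s

/-- The term without exponential is written as a jet with `s = 0`, so that `hasDerivAt_expJet`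
governs both terms. -/
theorem condUp_vanishesTo_iff (a : ι) :
    VanishesTo (D.condUp x t P a) (D.pt a) (D.ord a + 1) ↔ ∀ j < D.ord a + 1,
      expJet 0 x t j (D.pt a) (P (.inl ()) * conjPoly D.W)
        - ∑ i, expJet (2 * I) x t j (D.pt a) (P (.inr i) * (D.g a i * D.cof a)) = 0 := by
  have h1 : AnalyticAt ℂ (fun z => exp (0 * phase x t z)
      * (P (.inl ()) * conjPoly D.W).eval z) (D.pt a) :=
    (analyticAt_exp_phase _ x t _).mul (analyticAt_eval _ _)
  have h2 : AnalyticAt ℂ (fun z => exp (2 * I * phase x t z)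
      * (∑ i, P (.inr i) * (D.g a i * D.cof a)).eval z) (D.pt a) :=
    (analyticAt_exp_phase _ x t _).mul (analyticAt_eval _ _)
  have e : D.condUp x t P a = fun z => exp (0 * phase x t z)
      * (P (.inl ()) * conjPoly D.W).eval z - exp (2 * I * phase x t z)
      * (∑ i, P (.inr i) * (D.g a i * D.cof a)).eval z := by
    ext z; simp [condUp, Polynomial.eval_finsetSum]
  rw [e, VanishesTo.sub_iff_iteratedDeriv h1 h2]
  refine forall₂_congr fun j _ => ?_
  rw [← map_sum, sub_eq_zero]
  rfl

theorem condLow_vanishesTo_iff (a : ι) (i : Fin n) :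
    VanishesTo (D.condLow x t P a i) (conj (D.pt a)) (D.ord a + 1) ↔ ∀ j < D.ord a + 1,
      expJet 0 x t j (conj (D.pt a)) (P (.inr i) * D.W)
        + expJet (-2 * I) x t j (conj (D.pt a)) (P (.inl ()) * conjPoly (D.g a i * D.cof a))
        = 0 := by
  have h1 : AnalyticAt ℂ (fun z => exp (0 * phase x t z)
      * (P (.inr i) * D.W).eval z) (conj (D.pt a)) :=
    (analyticAt_exp_phase _ x t _).mul (analyticAt_eval _ _)
  have h2 : AnalyticAt ℂ (fun z => exp (-2 * I * phase x t z)
      * (-(P (.inl ()) * conjPoly (D.g a i * D.cof a))).eval z) (conj (D.pt a)) :=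
    (analyticAt_exp_phase _ x t _).mul (analyticAt_eval _ _)
  have e : D.condLow x t P a i = fun z => exp (0 * phase x t z)
      * (P (.inr i) * D.W).eval z - exp (-2 * I * phase x t z)
      * (-(P (.inl ()) * conjPoly (D.g a i * D.cof a))).eval z := by
    ext z; simp [condLow]
  rw [e, VanishesTo.sub_iff_iteratedDeriv h1 h2]
  refine forall₂_congr fun j _ => ?_
  rw [add_eq_zero_iff_eq_neg, ← map_neg]
  rfl

/-! ### Existence, smoothness and differentiation of the numerators -/

/-- The polynomial of degree less than `K` with given coefficients. -/
def toPoly {K : ℕ} : (Fin K → ℂ) →ₗ[ℂ] ℂ[X] where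
  toFun v := ∑ k : Fin K, v k • (Polynomial.X : ℂ[X]) ^ (k : ℕ)
  map_add' u v := by simp [add_smul, Finset.sum_add_distrib]
  map_smul' c v := by simp [mul_smul, Finset.smul_sum]

theorem toPoly_coeff {K : ℕ} (v : Fin K → ℂ) (k : Fin K) : (toPoly v).coeff k = v k := by
  simp [toPoly, Polynomial.coeff_X_pow, Fin.val_inj]

theorem toPoly_degree {K : ℕ} (v : Fin K → ℂ) : (toPoly v).degree < (K : WithBot ℕ) := by
  rw [Polynomial.degree_lt_iff_coeff_zero]
  intro m hm
  simp only [toPoly, LinearMap.coe_mk, AddHom.coe_mk, Polynomial.finsetSum_coeff,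
    Polynomial.coeff_smul, Polynomial.coeff_X_pow]
  exact Finset.sum_eq_zero fun k _ => by
    rw [if_neg (by have := k.2; omega), smul_zero]

variable (D) in
/-- All residue conditions as one linear map. -/
def condMap (x t : ℝ) :
    (Unit ⊕ Fin n → ℂ[X]) →ₗ[ℂ] ((Σ a, Fin (D.ord a + 1)) → Unit ⊕ Fin n → ℂ) where
  toFun P s := Sum.elim
    (fun _ => expJet 0 x t s.2 (D.pt s.1) (P (.inl ()) * conjPoly D.W)
        - ∑ i, expJet (2 * I) x t s.2 (D.pt s.1) (P (.inr i) * (D.g s.1 i * D.cof s.1)))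
    (fun i => expJet 0 x t s.2 (conj (D.pt s.1)) (P (.inr i) * D.W)
        + expJet (-2 * I) x t s.2 (conj (D.pt s.1))
          (P (.inl ()) * conjPoly (D.g s.1 i * D.cof s.1)))
  map_add' P Q := by
    ext s j
    rcases j with _ | i
    · simp only [Pi.add_apply, add_mul, map_add, Finset.sum_add_distrib, Sum.elim_inl]; ring
    · simp only [Pi.add_apply, add_mul, map_add, Sum.elim_inr]; ring
  map_smul' c P := by
    ext s j
    rcases j with _ | i
    · simp only [Pi.smul_apply, smul_mul_assoc, map_smul, Sum.elim_inl, smul_eq_mul,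
        RingHom.id_apply, mul_sub, Finset.mul_sum]
    · simp only [Pi.smul_apply, smul_mul_assoc, map_smul, Sum.elim_inr, smul_eq_mul,
        RingHom.id_apply, mul_add]

theorem cond_iff : D.Cond x t P ↔ D.condMap x t P = 0 := by
  simp only [Cond, condUp_vanishesTo_iff, condLow_vanishesTo_iff]
  constructor
  · rintro ⟨h1, h2⟩
    ext s j
    rcases j with _ | i
    · exact h1 s.1 s.2 s.2.2
    · exact h2 s.1 i s.2 s.2.2
  · intro h
    exact ⟨fun a j hj => congrFun (congrFun h ⟨a, j, hj⟩) (.inl ()),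
      fun a i j hj => congrFun (congrFun h ⟨a, j, hj⟩) (.inr i)⟩

theorem contDiff_condMap (P : Unit ⊕ Fin n → ℂ[X]) :
    ContDiff ℝ ∞ (fun q : ℝ × ℝ => D.condMap q.1 q.2 P) := by
  rw [contDiff_pi]
  intro s
  rw [contDiff_pi]
  rintro (_ | i)
  · exact (contDiff_expJet _ _ _ _).sub (ContDiff.sum fun i _ => contDiff_expJet _ _ _ _)
  · exact (contDiff_expJet _ _ _ _).add (contDiff_expJet _ _ _ _)

/-- The family of the polynomials with given coefficients. -/
def toPolyRow : (Unit ⊕ Fin n → Fin D.deg → ℂ) →ₗ[ℂ] (Unit ⊕ Fin n → ℂ[X]) :=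
  LinearMap.pi fun j => toPoly.comp (LinearMap.proj j)

-- For each row the ansatz is the denominator in the diagonal entry plus unknown polynomials of
-- degree less than `deg`. The conditions then form an inhomogeneous linear system that is square
-- and, by `Cond.eq_zero`, injective.
variable (D) in
theorem exists_smooth_cond : ∃ u : ℝ × ℝ → Unit ⊕ Fin n → Unit ⊕ Fin n → Fin D.deg → ℂ,
    ContDiff ℝ ∞ u ∧ ∀ x t i,
      D.Cond x t (fun j => (if i = j then D.den j else 0) + toPoly (u (x, t) i j)) := by
  have h : ∀ i : Unit ⊕ Fin n, ∃ u : ℝ × ℝ → Unit ⊕ Fin n → Fin D.deg → ℂ, ContDiff ℝ ∞ u ∧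
      ∀ q, ((D.condMap q.1 q.2).comp (toPolyRow (D := D))).restrictScalars ℝ (u q)
        = -D.condMap q.1 q.2 (fun j => if i = j then D.den j else 0) := by
    intro i
    refine exists_contDiff_solution ?_ _ (fun u => ?_) (fun q u hu => ?_) (contDiff_condMap _).neg
    -- There are `n + 1` polynomials with `deg` coefficients each, against `n + 1` conditions for
    -- each pole and each order up to `ord`. Both counts are `(n + 1) deg` over the complex numbers.
    · simp only [Module.finrank_pi_fintype, Complex.finrank_real_complex, Finset.sum_const,
        Finset.card_univ, Fintype.card_sum, Fintype.card_unit, Fintype.card_fin,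
        Fintype.card_sigma, smul_eq_mul]
      simp only [deg]
      ring
    · exact contDiff_condMap (toPolyRow u)
    · have h1 : D.Cond q.1 q.2 (toPolyRow u) := cond_iff.2 hu
      ext j k
      have h2 := h1.eq_zero (fun j => toPoly_degree (u j)) j
      rw [← toPoly_coeff (u j) k]
      change (toPolyRow u j).coeff k = 0
      rw [h2, Polynomial.coeff_zero]
  choose u hu hsol using h
  refine ⟨fun q i => u i q, contDiff_pi.2 hu, fun x t i => ?_⟩
  rw [cond_iff]
  have h1 := hsol i (x, t)
  have h2 : (fun j => (if i = j then D.den j else 0) + toPoly (u i (x, t) j))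
      = (fun j => if i = j then D.den j else 0) + toPolyRow (u i (x, t)) := rfl
  rw [h2, map_add]
  have h3 : D.condMap x t (toPolyRow (u i (x, t)))
    = -D.condMap x t (fun j => if i = j then D.den j else 0) := h1
  rw [h3, add_neg_cancel]

/-- The product rule: one term differentiates the coefficients, the other the exponential. -/
theorem hasDerivAt_expJet_toPoly {K : ℕ} (s : ℂ) (x t a b : ℝ) (j : ℕ) (p : ℂ) (R Q : ℂ[X])
    {v : ℝ → Fin K → ℂ} {v' : Fin K → ℂ} (hv : HasDerivAt v v' 0) :
    HasDerivAt (fun τ => expJet s (x + τ * a) (t + τ * b) j p ((R + toPoly (v τ)) * Q))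
      (expJet s x t j p (toPoly v' * Q
        + Polynomial.C s * phasePoly a b * ((R + toPoly (v 0)) * Q))) 0 := by
  have h0 := hasDerivAt_expJet s x t a b j p (R * Q)
  have h1 : ∀ k : Fin K, HasDerivAt
      (fun τ => v τ k * expJet s (x + τ * a) (t + τ * b) j p (Polynomial.X ^ (k : ℕ) * Q)) _ 0 :=
    fun k => (hasDerivAt_pi.1 hv k).mul
      (hasDerivAt_expJet s x t a b j p (Polynomial.X ^ (k : ℕ) * Q))
  have h2 := h0.add (HasDerivAt.fun_sum fun k (_ : k ∈ Finset.univ) => h1 k)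
  refine (h2.congr_deriv ?_).congr_of_eventuallyEq (Eventually.of_forall fun τ => ?_)
  · simp only [zero_mul, add_zero, Finset.sum_add_distrib, toPoly, LinearMap.coe_mk,
      AddHom.coe_mk, add_mul, mul_add, map_add, Finset.sum_mul, Finset.mul_sum, map_sum,
      smul_mul_assoc, mul_smul_comm, map_smul, smul_eq_mul]
    ring
  · simp only [toPoly, LinearMap.coe_mk, Pi.add_apply,
      AddHom.coe_mk, add_mul, map_add, Finset.sum_mul, map_sum,
      smul_mul_assoc, map_smul, smul_eq_mul]

variable (n) in
/-- The signs `1, -1, …, -1` times the imaginary unit. -/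
def sgn : Unit ⊕ Fin n → ℂ := Sum.elim (fun _ => I) (fun _ => -I)

/-- The dressing step. Differentiating the conditions at the upper poles adds `2iϕ` times the right
entries, and at the lower poles `-2iϕ` times the left entry. Shifting by a multiple of the original
row brings both to the same form, in which the derivative is corrected by `-iϕ` on the left and `iϕ`
on the right. -/
theorem Cond.dirDeriv {a b : ℝ} {R : Unit ⊕ Fin n → ℂ[X]} {K : ℕ}
    {v : ℝ → Unit ⊕ Fin n → Fin K → ℂ} {v' : Unit ⊕ Fin n → Fin K → ℂ} (hv : HasDerivAt v v' 0)
    (h : ∀ τ, D.Cond (x + τ * a) (t + τ * b) (fun j => R j + toPoly (v τ j))) :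
    D.Cond x t (fun j => toPoly (v' j)
      - Polynomial.C (sgn n j) * phasePoly a b * (R j + toPoly (v 0 j))) := by
  have h0 : D.Cond x t (fun j => R j + toPoly (v 0 j)) := by simpa using h 0
  have hvj := hasDerivAt_pi.1 hv
  set ϕ := phasePoly a b with hϕ
  constructor
  · intro k
    have h1 : VanishesTo (D.condUp x t (Sum.elim (fun _ => toPoly (v' (.inl ())))
        (fun i => toPoly (v' (.inr i)) + Polynomial.C (2 * I) * ϕ * (R (.inr i) + toPoly (v 0 (.inr i))))) k)
        (D.pt k) (D.ord k + 1) := by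
      rw [condUp_vanishesTo_iff]
      intro j hj
      have d1 := hasDerivAt_expJet_toPoly 0 x t a b j (D.pt k) (R (.inl ())) (conjPoly D.W)
        (hvj (.inl ()))
      have d2 := fun i => hasDerivAt_expJet_toPoly (2 * I) x t a b j (D.pt k) (R (.inr i))
        (D.g k i * D.cof k) (hvj (.inr i))
      have d3 := d1.sub (HasDerivAt.fun_sum fun i (_ : i ∈ Finset.univ) => d2 i)
      have d4 := d3.unique ((hasDerivAt_const (0 : ℝ) (0 : ℂ)).congr_of_eventuallyEq
        (Eventually.of_forall fun τ => (condUp_vanishesTo_iff k).1 ((h τ).1 k) j hj))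
      refine Eq.trans ?_ d4
      simp only [Sum.elim_inl, Sum.elim_inr, map_zero, zero_mul, add_zero, ← hϕ]
      congr 1
      refine Finset.sum_congr rfl fun i _ => ?_
      congr 1
      ring
    -- Subtracting `iϕ` times the row splits the correction `2iϕ` evenly between left and right.
    have h2 := (h0.1 k).mul_left (analyticAt_eval (Polynomial.C I * ϕ) (D.pt k))
    refine (h1.sub h2).congr' fun z => ?_
    simp only [condUp, Polynomial.eval_sub, Polynomial.eval_add, Polynomial.eval_mul,
      Polynomial.eval_C, sgn, Sum.elim_inl, Sum.elim_inr]
    have : ∀ A B A' X Y X' : ℂ, A = A' - B → X = X' - Y → A - X = A' - X' - (B - Y) := by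
      rintro A B A' X Y X' rfl rfl; ring
    simp only [mul_sub]
    refine this _ _ _ _ _ _ (by ring) ?_
    simp only [Finset.mul_sum]
    rw [← Finset.sum_sub_distrib]
    exact Finset.sum_congr rfl fun i _ => by ring
  · intro k i
    have h1 : VanishesTo (D.condLow x t (Sum.elim (fun _ => toPoly (v' (.inl ()))
          + Polynomial.C (-2 * I) * ϕ * (R (.inl ()) + toPoly (v 0 (.inl ()))))
        (fun i => toPoly (v' (.inr i)))) k i)
        (conj (D.pt k)) (D.ord k + 1) := by
      rw [condLow_vanishesTo_iff]
      intro j hj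
      have d1 := hasDerivAt_expJet_toPoly 0 x t a b j (conj (D.pt k)) (R (.inr i)) D.W
        (hvj (.inr i))
      have d2 := hasDerivAt_expJet_toPoly (-2 * I) x t a b j (conj (D.pt k)) (R (.inl ()))
        (conjPoly (D.g k i * D.cof k)) (hvj (.inl ()))
      have d4 := (d1.add d2).unique ((hasDerivAt_const (0 : ℝ) (0 : ℂ)).congr_of_eventuallyEq
        (Eventually.of_forall fun τ => (condLow_vanishesTo_iff k i).1 ((h τ).2 k i) j hj))
      refine Eq.trans ?_ d4
      simp only [Sum.elim_inl, Sum.elim_inr, map_zero, zero_mul, add_zero, ← hϕ]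
      congr 2
      ring
    -- Here the correction sits on the left entry with the opposite sign, so the same multiple of
    -- the row is added.
    have h2 := (h0.2 k i).mul_left (analyticAt_eval (Polynomial.C I * ϕ) (conj (D.pt k)))
    refine (h1.add h2).congr' fun z => ?_
    simp only [condLow, Polynomial.eval_sub, Polynomial.eval_add, Polynomial.eval_mul,
      Polynomial.eval_C, sgn, Sum.elim_inl, Sum.elim_inr]
    ring

end PoleData

/-! ### From the Laurent recursion to the matrix modified Korteweg-de Vries equation -/

section Recursion

variable {A : Type*} [NormedRing A] [NormedAlgebra ℝ A]

theorem anticomm_of_hasDerivAt {s : A} {P : ℝ → A} {P' : A} {x : ℝ} (h : ∀ y, P y * s = -(s * P y))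
    (hd : HasDerivAt P P' x) : P' * s = -(s * P') := by
  have h1 := hd.mul_const s
  have h2 := (hd.const_mul s).neg
  exact h1.unique (h2.congr_of_eventuallyEq (Eventually.of_forall h))

/-- The evolution of the off-diagonal part of the first Laurent coefficient, from the recursion for
the diagonal parts `E, E₂` and the off-diagonal parts `P, P₂, P₃`. -/
theorem offDiag_evolution {s : A} (hs : s * s = -1) {P E P₂ E₂ P₃ p₁ p₂ : ℝ → A} {p₃ : A} {x : ℝ}
    (aP : ∀ y, P y * s = -(s * P y))
    (hP₁ : ∀ y, HasDerivAt P (p₁ y) y) (hP₂ : ∀ y, HasDerivAt p₁ (p₂ y) y)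
    (hP₃ : HasDerivAt p₂ p₃ x)
    (hE : ∀ y, HasDerivAt E ((2 : ℝ) • (s * P y * P y)) y)
    (hE₂ : ∀ y, HasDerivAt E₂ ((2 : ℝ) • (s * P y * P₂ y)) y)
    (rP : ∀ y, p₁ y = (-2 : ℝ) • (s * P₂ y) + (2 : ℝ) • (s * P y * E y))
    {P₂' : ℝ → A} {P₃' : A} (hP₂' : ∀ y, HasDerivAt P₂ (P₂' y) y) (hP₃' : HasDerivAt P₃ P₃' x)
    (rP₂ : ∀ y, P₂' y = (-2 : ℝ) • (s * P₃ y) + (2 : ℝ) • (s * P y * E₂ y)) :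
    (4 : ℝ) • P₃' - (4 : ℝ) • (p₁ x * E₂ x + (2 : ℝ) • (s * P x * P x) * P₂ x)
      + ((-4 : ℝ) • P₂' x + (4 : ℝ) • (p₁ x * E x + (2 : ℝ) • (s * P x * P x) * P x)) * E x
      + ((-4 : ℝ) • ((2 : ℝ) • (s * P x * P₂ x))
        + (4 : ℝ) • (p₁ x * P x + (2 : ℝ) • (s * P x * P x) * E x)) * P x
      = - p₃ + (12 : ℝ) • (p₁ x * (P x * P x) + P x * P x * p₁ x) := by
  have a₁ : ∀ y, p₁ y * s = -(s * p₁ y) := fun y => anticomm_of_hasDerivAt aP (hP₁ y)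
  have a₂ : ∀ y, p₂ y * s = -(s * p₂ y) := fun y => anticomm_of_hasDerivAt a₁ (hP₂ y)
  have a₃ : p₃ * s = -(s * p₃) := anticomm_of_hasDerivAt a₂ hP₃
  have hs' : ∀ z, s * (s * z) = -z := fun z => by rw [← mul_assoc, hs, neg_one_mul]
  -- Because `s² = -1`, the recursion can be solved for the next off-diagonal part. Iterating this
  -- expresses `P₂` and `P₃` through the derivatives of `P` and the diagonal parts.
  have e₂ : ∀ y, P₂ y = (2⁻¹ : ℝ) • (s * p₁ y) + P y * E y := by
    intro y
    rw [rP y]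
    simp only [mul_add, mul_smul_comm, mul_assoc, hs']
    module
  have d₂ : ∀ y, P₂' y = (2⁻¹ : ℝ) • (s * p₂ y)
      + (p₁ y * E y + P y * ((2 : ℝ) • (s * P y * P y))) := by
    intro y
    have := (((hP₂ y).const_mul s).const_smul (2⁻¹ : ℝ)).add ((hP₁ y).mul (hE y))
    exact (hP₂' y).unique (this.congr_of_eventuallyEq (Eventually.of_forall e₂))
  have e₃ : ∀ y, P₃ y = (2⁻¹ : ℝ) • (s * ((2⁻¹ : ℝ) • (s * p₂ y)
      + (p₁ y * E y + P y * ((2 : ℝ) • (s * P y * P y))))) + P y * E₂ y := by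
    intro y
    rw [← d₂, rP₂ y]
    simp only [mul_add, mul_smul_comm, mul_assoc, hs']
    module
  have d₃ : P₃' = _ := hP₃'.unique
    (((((((hP₃.const_mul s).const_smul (2⁻¹ : ℝ)).add (((hP₂ x).mul (hE x)).add
      ((hP₁ x).mul ((((hP₁ x).const_mul s).mul (hP₁ x)).const_smul (2 : ℝ))))).const_mul
      s).const_smul (2⁻¹ : ℝ)).add ((hP₁ x).mul (hE₂ x))).congr_of_eventuallyEq
      (Eventually.of_forall e₃))
  rw [d₃, d₂, e₂]
  -- Anticommutation moves every `s` to the left, after which both sides agree as linear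
  -- combinations of words; all terms with `E` or `E₂` cancel.
  have b₀ : ∀ z, P x * (s * z) = -(s * (P x * z)) := fun z => by
    rw [← mul_assoc, aP, neg_mul, mul_assoc]
  have b₁ : ∀ z, p₁ x * (s * z) = -(s * (p₁ x * z)) := fun z => by
    rw [← mul_assoc, a₁, neg_mul, mul_assoc]
  simp only [mul_add, add_mul, smul_mul_assoc, mul_smul_comm, mul_assoc, Pi.smul_apply, Pi.mul_apply,
    hs', b₀, b₁, mul_neg, neg_mul, smul_neg, neg_neg, smul_add]
  module

/-- Here `s` stands for `iσ`, `m_k` for the coefficient of `z^{-k}`, and the `B_k` for the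
coefficients of the `t`-operator `B₁ z² + B₂ z + B₃`. The `x`-recursion expresses everything local
through the part of `m₁` that anticommutes with `s`. -/
theorem evolution_of_recursion {s : A} (hs : s * s = -1) {m₁ m₂ m₃ m₄ Q : ℝ → A} {mt : A} {x : ℝ}
    (hQ : ∀ y, Q y = s * m₁ y - m₁ y * s) (hm : ContDiff ℝ ∞ m₁)
    (h₁ : ∀ y, HasDerivAt m₁ (m₂ y * s - s * m₂ y + Q y * m₁ y) y)
    (h₂ : ∀ y, HasDerivAt m₂ (m₃ y * s - s * m₃ y + Q y * m₂ y) y)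
    (h₃ : ∀ y, HasDerivAt m₃ (m₄ y * s - s * m₄ y + Q y * m₃ y) y)
    {B₁ B₂ B₃ : A} (hB₁ : B₁ = (4 : ℝ) • Q x)
    (hB₂ : B₂ = (4 : ℝ) • (s * m₂ x - m₂ x * s) - B₁ * m₁ x)
    (hB₃ : B₃ = (4 : ℝ) • (s * m₃ x - m₃ x * s) - B₁ * m₂ x - B₂ * m₁ x)
    (ht : mt = (4 : ℝ) • (m₄ x * s - s * m₄ x) + B₁ * m₃ x + B₂ * m₂ x + B₃ * m₁ x) :
    (s * mt - mt * s) + iteratedDeriv 3 Q x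
      = (3 : ℝ) • (deriv Q x * (Q x * Q x) + Q x * Q x * deriv Q x) := by
  have hs' : ∀ z, s * (s * z) = -z := fun z => by rw [← mul_assoc, hs, neg_one_mul]
  -- Projections onto the parts which anticommute and commute with `s`; for `s = iσ` they are the
  -- off-diagonal and diagonal blocks.
  set off : A → A := fun m => (2⁻¹ : ℝ) • (m + s * m * s) with hoff
  set dia : A → A := fun m => (2⁻¹ : ℝ) • (m - s * m * s) with hdia
  have hsplit : ∀ m, m = off m + dia m := fun m => by simp only [hoff, hdia]; module
  have aoff : ∀ m, off m * s = -(s * off m) := fun m => by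
    simp only [hoff, smul_mul_assoc, mul_smul_comm, add_mul, mul_add, mul_assoc, hs, hs', mul_neg,
      mul_one]
    module
  have cdia : ∀ m, dia m * s = s * dia m := fun m => by
    simp only [hdia, smul_mul_assoc, mul_smul_comm, sub_mul, mul_sub, mul_assoc, hs, hs', mul_neg,
      mul_one]
    module
  have doff : ∀ {m : ℝ → A} {m' : A} {y : ℝ}, HasDerivAt m m' y →
      HasDerivAt (fun y => off (m y)) (off m') y := fun h =>
    (h.add ((h.const_mul s).mul_const s)).const_smul (2⁻¹ : ℝ)
  have ddia : ∀ {m : ℝ → A} {m' : A} {y : ℝ}, HasDerivAt m m' y →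
      HasDerivAt (fun y => dia (m y)) (dia m') y := fun h =>
    (h.sub ((h.const_mul s).mul_const s)).const_smul (2⁻¹ : ℝ)
  have hQ' : ∀ y, Q y = (2 : ℝ) • (s * off (m₁ y)) := fun y => by
    simp only [hQ, hoff, mul_smul_comm, mul_add, mul_assoc, hs']
    module
  have off_of : ∀ {o d : A}, o * s = -(s * o) → d * s = s * d → off (o + d) = o := by
    intro o d ho hd
    simp only [hoff, mul_add, add_mul, mul_assoc, ho, hd, mul_neg, hs', neg_neg]
    module
  have dia_of : ∀ {o d : A}, o * s = -(s * o) → d * s = s * d → dia (o + d) = d := by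
    intro o d ho hd
    simp only [hdia, mul_add, add_mul, mul_assoc, ho, hd, mul_neg, hs', neg_neg]
    module
  have aoff' : ∀ m z, off m * (s * z) = -(s * (off m * z)) := fun m z => by
    rw [← mul_assoc, aoff, neg_mul, mul_assoc]
  have cdia' : ∀ m z, dia m * (s * z) = s * (dia m * z) := fun m z => by
    rw [← mul_assoc, cdia, mul_assoc]
  have hstep : ∀ y m k, m * s - s * m + Q y * k
      = ((-2 : ℝ) • (s * off m) + (2 : ℝ) • (s * off (m₁ y) * dia k))
        + (2 : ℝ) • (s * off (m₁ y) * off k) := by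
    intro y m k
    rw [hQ']
    conv_lhs => rw [hsplit m, hsplit k]
    simp only [mul_add, add_mul, aoff, cdia, smul_mul_assoc]
    module
  have hoffstep : ∀ y m k, off (m * s - s * m + Q y * k)
      = (-2 : ℝ) • (s * off m) + (2 : ℝ) • (s * off (m₁ y) * dia k) := by
    intro y m k
    rw [hstep]
    refine off_of ?_ ?_
    · simp only [mul_add, add_mul, mul_assoc, smul_mul_assoc, mul_smul_comm, aoff, cdia, aoff',
        mul_neg, smul_neg, neg_add]
    · simp only [mul_assoc, smul_mul_assoc, mul_smul_comm, aoff, aoff', mul_neg, neg_neg]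
  have hdiastep : ∀ y m k, dia (m * s - s * m + Q y * k)
      = (2 : ℝ) • (s * off (m₁ y) * off k) := by
    intro y m k
    rw [hstep]
    refine dia_of ?_ ?_
    · simp only [mul_add, add_mul, mul_assoc, smul_mul_assoc, mul_smul_comm, aoff, cdia, aoff',
        mul_neg, smul_neg, neg_add]
    · simp only [mul_assoc, smul_mul_assoc, mul_smul_comm, aoff, aoff', mul_neg, neg_neg]
  have hPs : ContDiff ℝ ∞ (fun y => off (m₁ y)) := by
    simp only [hoff]
    exact (hm.add ((contDiff_const.mul hm).mul contDiff_const)).const_smul _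
  have sm : ∀ k, Differentiable ℝ (iteratedDeriv k (fun y => off (m₁ y))) := fun k =>
    hPs.differentiable_iteratedDeriv k (by exact_mod_cast WithTop.coe_lt_top _)
  have hd : ∀ k y, HasDerivAt (iteratedDeriv k (fun y => off (m₁ y)))
      (iteratedDeriv (k + 1) (fun y => off (m₁ y)) y) y := fun k y => by
    rw [iteratedDeriv_succ]
    exact (sm k y).hasDerivAt
  have hd0 : ∀ y, HasDerivAt (fun y => off (m₁ y))
      (iteratedDeriv 1 (fun y => off (m₁ y)) y) y := fun y => by simpa using hd 0 y
  set p₁ := iteratedDeriv 1 (fun y => off (m₁ y)) with hp₁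
  set p₂ := iteratedDeriv 2 (fun y => off (m₁ y)) with hp₂
  set p₃ := iteratedDeriv 3 (fun y => off (m₁ y)) x with hp₃
  have key := offDiag_evolution hs (P := fun y => off (m₁ y)) (E := fun y => dia (m₁ y))
    (P₂ := fun y => off (m₂ y)) (E₂ := fun y => dia (m₂ y)) (P₃ := fun y => off (m₃ y))
    (p₁ := p₁) (p₂ := p₂) (p₃ := p₃) (x := x) (fun y => aoff _) hd0 (hd 1) (hd 2 x)
    (fun y => (hdiastep y (m₂ y) (m₁ y)) ▸ ddia (h₁ y))
    (fun y => (hdiastep y (m₃ y) (m₂ y)) ▸ ddia (h₂ y))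
    (fun y => ((hd0 y).unique (doff (h₁ y))).trans (hoffstep _ _ _))
    (fun y => doff (h₂ y)) (doff (h₃ x)) (fun y => hoffstep _ _ _)
  have r₁ : p₁ x = off (m₂ x * s - s * m₂ x + Q x * m₁ x) := (hd0 x).unique (doff (h₁ x))
  have D₁ := hdiastep x (m₂ x) (m₁ x)
  have D₂ := hdiastep x (m₃ x) (m₂ x)
  set m₁' := m₂ x * s - s * m₂ x + Q x * m₁ x with hm₁'
  set m₂' := m₃ x * s - s * m₃ x + Q x * m₂ x with hm₂'
  set m₃' := m₄ x * s - s * m₄ x + Q x * m₃ x with hm₃'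
  -- The commutators in the `B_k` are `x`-derivatives in disguise. Substituting the recursion
  -- expresses `B₂`, `B₃` and `mt` by `m₁`, `m₂` and `m₁'`, `m₂'`, `m₃'`, so `m₄` disappears.
  have hB₂' : B₂ = (-4 : ℝ) • m₁' := by rw [hB₂, hB₁, hm₁', smul_mul_assoc]; module
  have hB₃' : B₃ = (-4 : ℝ) • m₂' + (4 : ℝ) • (m₁' * m₁ x) := by
    rw [hB₃, hB₂', hB₁, hm₂']; simp only [smul_mul_assoc]; module
  have ht' : mt = (4 : ℝ) • m₃' - (4 : ℝ) • (m₁' * m₂ x)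
      + ((-4 : ℝ) • m₂' + (4 : ℝ) • (m₁' * m₁ x)) * m₁ x := by
    rw [ht, hB₃', hB₂', hB₁, hm₃']; simp only [smul_mul_assoc]; module
  have hofft : off mt = - p₃ + (12 : ℝ) • (p₁ x * (off (m₁ x) * off (m₁ x))
      + off (m₁ x) * off (m₁ x) * p₁ x) := by
    rw [← key, ← D₁, ← D₂, r₁]
    have : mt = ((4 : ℝ) • off m₃' - (4 : ℝ) • (off m₁' * dia (m₂ x) + dia m₁' * off (m₂ x))
      + ((-4 : ℝ) • off m₂' + (4 : ℝ) • (off m₁' * dia (m₁ x) + dia m₁' * off (m₁ x))) * dia (m₁ x)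
      + ((-4 : ℝ) • dia m₂'
        + (4 : ℝ) • (off m₁' * off (m₁ x) + dia m₁' * dia (m₁ x))) * off (m₁ x)) +
        ((4 : ℝ) • dia m₃' - (4 : ℝ) • (off m₁' * off (m₂ x) + dia m₁' * dia (m₂ x))
      + ((-4 : ℝ) • off m₂' + (4 : ℝ) • (off m₁' * dia (m₁ x) + dia m₁' * off (m₁ x))) * off (m₁ x)
      + ((-4 : ℝ) • dia m₂'
        + (4 : ℝ) • (off m₁' * off (m₁ x) + dia m₁' * dia (m₁ x))) * dia (m₁ x)) := by
      rw [ht']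
      conv_lhs => rw [hsplit m₃', hsplit m₁', hsplit m₂', hsplit (m₁ x), hsplit (m₂ x)]
      simp only [mul_add, add_mul, smul_mul_assoc, mul_assoc, smul_add]
      module
    conv_lhs => rw [this]
    refine off_of ?_ ?_
    · simp only [mul_add, add_mul, mul_sub, sub_mul, mul_assoc, smul_mul_assoc, mul_smul_comm,
        aoff, cdia, aoff', cdia', mul_neg, neg_neg, smul_neg, smul_add]
      module
    · simp only [mul_add, add_mul, mul_sub, sub_mul, mul_assoc, smul_mul_assoc, mul_smul_comm,
        aoff, cdia, aoff', cdia', mul_neg, neg_neg, smul_add]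
  -- The commutator with `s` does not see the diagonal part, so the evolution of the off-diagonal
  -- part suffices.
  have hst : s * mt - mt * s = (2 : ℝ) • (s * off mt) := by
    simp only [hoff, mul_smul_comm, mul_add, mul_assoc, hs']
    module
  have hQf : Q = fun y => (2 : ℝ) • (s * off (m₁ y)) := funext hQ'
  have hQ1 : deriv Q x = (2 : ℝ) • (s * p₁ x) := by
    rw [hQf]; exact (((hd0 x).const_mul s).const_smul (2 : ℝ)).deriv
  have hQ3 : iteratedDeriv 3 Q x = (2 : ℝ) • (s * p₃) := by
    have e1 : deriv Q = fun y => (2 : ℝ) • (s * p₁ y) := by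
      ext y; rw [hQf]; exact (((hd0 y).const_mul s).const_smul (2 : ℝ)).deriv
    have e2 : iteratedDeriv 2 Q = fun y => (2 : ℝ) • (s * p₂ y) := by
      ext y; rw [iteratedDeriv_succ, iteratedDeriv_one, e1]
      exact (((hd 1 y).const_mul s).const_smul (2 : ℝ)).deriv
    rw [iteratedDeriv_succ, e2]
    exact (((hd 2 x).const_mul s).const_smul (2 : ℝ)).deriv
  rw [hst, hofft, hQ1, hQ3, hQ']
  simp only [mul_add, mul_assoc, smul_mul_assoc, mul_smul_comm, aoff', mul_neg, neg_neg, hs',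
    smul_smul]
  module

end Recursion

/-! ### Expansion at infinity by division with remainder -/

section Laurent

open Polynomial

/-- The polynomial part of `P / w` for monic `w`. -/
def polyPart (w : ℂ[X]) (hw : w.Monic) : ℂ[X] →ₗ[ℂ] ℂ[X] where
  toFun P := P /ₘ w
  map_add' P Q := by
    refine (div_modByMonic_unique (f := P + Q) (g := w) (P /ₘ w + Q /ₘ w) (P %ₘ w + Q %ₘ w) hw
      ⟨?_, ?_⟩).1
    · conv_rhs => rw [← modByMonic_add_div P w, ← modByMonic_add_div Q w]
      ring
    · exact (degree_add_le _ _).trans_lt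
        (max_lt (degree_modByMonic_lt _ hw) (degree_modByMonic_lt _ hw))
  map_smul' c P := by
    refine (div_modByMonic_unique (f := c • P) (g := w) (c • (P /ₘ w)) (c • (P %ₘ w)) hw
      ⟨?_, ?_⟩).1
    · conv_rhs => rw [← modByMonic_add_div P w]
      rw [smul_add, mul_smul_comm]
    · exact (degree_smul_le _ _).trans_lt (degree_modByMonic_lt _ hw)

variable {w : ℂ[X]} {hw : w.Monic}

theorem polyPart_eq_zero_iff {P : ℂ[X]} : polyPart w hw P = 0 ↔ P.degree < w.degree :=
  divByMonic_eq_zero_iff hw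

theorem polyPart_self : polyPart w hw w = 1 := by
  have := mul_divByMonic_cancel_left 1 hw
  rwa [mul_one] at this

theorem polyPart_C_mul (c : ℂ) (P : ℂ[X]) : polyPart w hw (C c * P) = C c * polyPart w hw P := by
  rw [← smul_eq_C_mul, map_smul, smul_eq_C_mul]

/-- The coefficient of `z^{-k}` in the expansion of `P / w` at infinity. -/
def laurent (w : ℂ[X]) (hw : w.Monic) (k : ℕ) : ℂ[X] →ₗ[ℂ] ℂ :=
  (lcoeff ℂ 0).comp ((polyPart w hw).comp (LinearMap.mulLeft ℂ (X ^ k)))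

theorem laurent_eq (k : ℕ) (P : ℂ[X]) :
    laurent w hw k P = (polyPart w hw (X ^ k * P)).coeff 0 := rfl

/-- Multiplication by `X` shifts the expansion at infinity by one place; only the former `1/z`
coefficient newly enters the polynomial part. -/
theorem polyPart_X_mul (P : ℂ[X]) :
    polyPart w hw (X * P) = X * polyPart w hw P + C ((polyPart w hw (X * P)).coeff 0) := by
  have h1 : X * P = X * (P %ₘ w) + w * (X * (P /ₘ w)) := by
    conv_lhs => rw [← modByMonic_add_div P w]
    ring
  have h2 : polyPart w hw (w * (X * (P /ₘ w))) = X * (P /ₘ w) := mul_divByMonic_cancel_left _ hw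
  have h3 : (polyPart w hw (X * (P %ₘ w))).degree ≤ 0 := by
    rcases eq_or_ne (P %ₘ w) 0 with h0 | h0
    · simp [h0]
    have hd := degree_modByMonic_lt P hw
    have hlt : (P %ₘ w).natDegree < w.natDegree := natDegree_lt_natDegree h0 hd
    have : (X * (P %ₘ w) /ₘ w).natDegree = 0 := by
      rw [natDegree_divByMonic _ hw, natDegree_X_mul h0]; omega
    exact natDegree_eq_zero_iff_degree_le_zero.1 this
  have h4 : polyPart w hw (X * P) = polyPart w hw (X * (P %ₘ w)) + X * polyPart w hw P := by
    conv_lhs => rw [h1, map_add, h2]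
    rfl
  rw [h4, eq_C_of_degree_le_zero h3]
  simp [add_comm]

theorem laurent_X_mul (k : ℕ) (P : ℂ[X]) : laurent w hw k (X * P) = laurent w hw (k + 1) P := by
  rw [laurent_eq, laurent_eq, pow_succ, mul_assoc]

theorem polyPart_X_pow_succ_mul (k : ℕ) (P : ℂ[X]) : polyPart w hw (X ^ (k + 1) * P)
    = X * polyPart w hw (X ^ k * P) + C (laurent w hw (k + 1) P) := by
  rw [laurent_eq, pow_succ', mul_assoc]
  exact polyPart_X_mul _

/-- Subtracting the right multiple of the monic `w` from `X * P` lowers the degree below that of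
`w`, so the quotient is this constant. -/
theorem laurent_one_of_degree_lt {P : ℂ[X]} (h : P.degree < w.degree) :
    laurent w hw 1 P = P.coeff (w.natDegree - 1) := by
  rw [laurent_eq, pow_one]
  rcases eq_or_ne P 0 with rfl | h0
  · simp
  have hlt : P.natDegree < w.natDegree := natDegree_lt_natDegree h0 h
  have h1 : X * P = P.coeff (w.natDegree - 1) • w
      + (X * P - P.coeff (w.natDegree - 1) • w) := by ring
  have h2 : polyPart w hw (X * P - P.coeff (w.natDegree - 1) • w) = 0 := by
    rw [polyPart_eq_zero_iff, degree_eq_natDegree hw.ne_zero, degree_lt_iff_coeff_zero]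
    intro m hm
    obtain ⟨m, rfl⟩ : ∃ k, m = k + 1 := ⟨m - 1, by omega⟩
    rw [coeff_sub, coeff_X_mul, coeff_smul, smul_eq_mul]
    rcases hm.eq_or_lt with h | h
    · have h3 : w.coeff (m + 1) = 1 := by rw [← h]; exact hw
      rw [h3, h]; simp
    · rw [coeff_eq_zero_of_natDegree_lt h, coeff_eq_zero_of_natDegree_lt (by omega)]; simp
  rw [h1, map_add, h2, map_smul, polyPart_self]
  simp

end Laurent

/-! ### The solution and its Lax equations -/

namespace PoleData

variable {ι : Type*} [Fintype ι] {n : ℕ} (D : PoleData ι n)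

/-- The coefficients of the numerators of the solution. -/
def coef : ℝ × ℝ → Unit ⊕ Fin n → Unit ⊕ Fin n → Fin D.deg → ℂ := D.exists_smooth_cond.choose

theorem contDiff_coef : ContDiff ℝ ∞ D.coef := D.exists_smooth_cond.choose_spec.1

/-- The numerators of the entries of the solution. -/
def num (x t : ℝ) (i j : Unit ⊕ Fin n) : ℂ[X] :=
  (if i = j then D.den j else 0) + toPoly (D.coef (x, t) i j)

theorem cond_num (x t : ℝ) (i : Unit ⊕ Fin n) : D.Cond x t (D.num x t i) :=
  D.exists_smooth_cond.choose_spec.2 x t i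

/-- The derivative of the numerators in the direction `(a, b)`. -/
def dnum (a b x t : ℝ) (i j : Unit ⊕ Fin n) : ℂ[X] :=
  toPoly (fderiv ℝ D.coef (x, t) (a, b) i j)

theorem hasDerivAt_coef (a b x t : ℝ) :
    HasDerivAt (fun τ : ℝ => D.coef (x + τ * a, t + τ * b)) (fderiv ℝ D.coef (x, t) (a, b)) 0 := by
  have h1 : HasFDerivAt D.coef (fderiv ℝ D.coef (x, t)) (x, t) :=
    (D.contDiff_coef.differentiable (by simp)).differentiableAt.hasFDerivAt
  have h2 : ∀ x a : ℝ, HasDerivAt (fun τ : ℝ => x + τ * a) a 0 := fun x a =>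
    (((hasDerivAt_id (0 : ℝ)).mul_const a).const_add x).congr_deriv (by simp)
  refine HasFDerivAt.comp_hasDerivAt (f := fun τ : ℝ => (x + τ * a, t + τ * b)) (l := D.coef) 0 ?_
    ((h2 x a).prodMk (h2 t b))
  simpa using h1

theorem cond_dnum (a b x t : ℝ) (i : Unit ⊕ Fin n) :
    D.Cond x t (fun j => D.dnum a b x t i j
      - Polynomial.C (sgn n j) * phasePoly a b * D.num x t i j) := by
  have h := Cond.dirDeriv (D := D) (x := x) (t := t) (a := a) (b := b)
    (R := fun j => if i = j then D.den j else 0)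
    (v := fun τ => D.coef (x + τ * a, t + τ * b) i) (hasDerivAt_pi.1 (D.hasDerivAt_coef a b x t) i)
    (fun τ => D.cond_num _ _ i)
  simpa [num, dnum] using h

/-- The coefficient of `z^{-k}` in the expansion of the `j`-th entry of a row at infinity. -/
def rowLaurent (j : Unit ⊕ Fin n) (k : ℕ) : ℂ[X] →ₗ[ℂ] ℂ := laurent (D.den j) (D.den_monic j) k

/-- The coefficient of `z^{-k}` in the expansion of the solution at infinity. -/
def lcoef (k : ℕ) (x t : ℝ) : BlockMat n := Matrix.of fun i j => D.rowLaurent j k (D.num x t i j)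

/-- The derivative of `lcoef` in the direction `(a, b)`. -/
def dlcoef (a b : ℝ) (k : ℕ) (x t : ℝ) : BlockMat n :=
  Matrix.of fun i j => D.rowLaurent j k (D.dnum a b x t i j)

variable (n) in
/-- The diagonal matrix `i σ`. -/
def sgnMat : BlockMat n := Matrix.diagonal (sgn n)

theorem degree_den (j : Unit ⊕ Fin n) : (D.den j).degree = (D.deg : WithBot ℕ) := by
  rw [Polynomial.degree_eq_natDegree (D.den_monic j).ne_zero, D.den_natDegree]

theorem polyPart_dnum (a b x t : ℝ) (i j : Unit ⊕ Fin n) :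
    polyPart (D.den j) (D.den_monic j) (D.dnum a b x t i j) = 0 := by
  rw [polyPart_eq_zero_iff, degree_den]
  exact toPoly_degree _

theorem polyPart_num (x t : ℝ) (i j : Unit ⊕ Fin n) :
    polyPart (D.den j) (D.den_monic j) (D.num x t i j) = if i = j then 1 else 0 := by
  have : polyPart (D.den j) (D.den_monic j) (toPoly (D.coef (x, t) i j)) = 0 := by
    rw [polyPart_eq_zero_iff, degree_den]
    exact toPoly_degree _
  rw [num, map_add, this, add_zero]
  split_ifs with h
  · exact polyPart_self
  · exact map_zero _

theorem polyPart_X_num (x t : ℝ) (i j : Unit ⊕ Fin n) :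
    polyPart (D.den j) (D.den_monic j) (Polynomial.X * D.num x t i j)
      = Polynomial.X * (if i = j then 1 else 0) + Polynomial.C (D.lcoef 1 x t i j) := by
  have := polyPart_X_pow_succ_mul (hw := D.den_monic j) 0 (D.num x t i j)
  simp only [zero_add, pow_one, pow_zero, one_mul, polyPart_num] at this
  exact this

theorem polyPart_X_sq_num (x t : ℝ) (i j : Unit ⊕ Fin n) :
    polyPart (D.den j) (D.den_monic j) (Polynomial.X ^ 2 * D.num x t i j)
      = Polynomial.X * (Polynomial.X * (if i = j then 1 else 0) + Polynomial.C (D.lcoef 1 x t i j))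
        + Polynomial.C (D.lcoef 2 x t i j) := by
  have := polyPart_X_pow_succ_mul (hw := D.den_monic j) 1 (D.num x t i j)
  rw [pow_one, polyPart_X_num] at this
  exact this

theorem polyPart_X_cube_num (x t : ℝ) (i j : Unit ⊕ Fin n) :
    polyPart (D.den j) (D.den_monic j) (Polynomial.X ^ 3 * D.num x t i j)
      = Polynomial.X * (Polynomial.X * (Polynomial.X * (if i = j then 1 else 0)
        + Polynomial.C (D.lcoef 1 x t i j)) + Polynomial.C (D.lcoef 2 x t i j))
        + Polynomial.C (D.lcoef 3 x t i j) := by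
  have := polyPart_X_pow_succ_mul (hw := D.den_monic j) 2 (D.num x t i j)
  rw [polyPart_X_sq_num] at this
  exact this

variable {D} in
theorem Cond.eq_zero_of_polyPart {x t : ℝ} {P : Unit ⊕ Fin n → ℂ[X]} (h : D.Cond x t P)
    (h' : ∀ j, polyPart (D.den j) (D.den_monic j) (P j) = 0) (j) : P j = 0 :=
  h.eq_zero (fun j => by have := polyPart_eq_zero_iff.1 (h' j); rwa [degree_den] at this) j

/-- The off-diagonal matrix `[iσ, M₁]`. -/
def pot (x t : ℝ) : BlockMat n := sgnMat n * D.lcoef 1 x t - D.lcoef 1 x t * sgnMat n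

theorem sgnMat_mul_apply (M : BlockMat n) (i j) : (sgnMat n * M) i j = sgn n i * M i j := by
  simp [sgnMat]

theorem mul_sgnMat_apply (M : BlockMat n) (i j) : (M * sgnMat n) i j = M i j * sgn n j := by
  simp [sgnMat]

/-- This is `M_x + z [iσ, M] = Q M` on numerators. The left side minus the right satisfies `Cond`,
and `Q = [iσ, M₁]` is exactly what cancels its polynomial part; uniqueness does the rest. -/
theorem lax_x (x t : ℝ) (i j : Unit ⊕ Fin n) :
    D.dnum 1 0 x t i j
      - Polynomial.C (sgn n j) * (Polynomial.X * D.num x t i j)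
      + Polynomial.C (sgn n i) * (Polynomial.X * D.num x t i j)
      - ∑ k, Polynomial.C (D.pot x t i k) * D.num x t k j = 0 := by
  have hϕ : phasePoly 1 0 = Polynomial.X := by simp [phasePoly]
  have h1 := D.cond_dnum 1 0 x t i
  rw [hϕ] at h1
  have h2 := (h1.add ((D.cond_num x t i).mul_left (Polynomial.C (sgn n i) * Polynomial.X))).sub
    (Cond.sum Finset.univ fun k _ => (D.cond_num x t k).mul_left (Polynomial.C (D.pot x t i k)))
  have h3 := h2.eq_zero_of_polyPart (fun j => ?_) j
  · rw [← h3]; ring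
  · simp only [map_add, map_sub, map_sum, mul_assoc, polyPart_C_mul, polyPart_X_num, polyPart_num,
      polyPart_dnum]
    simp only [mul_ite, mul_one, mul_zero, Finset.sum_ite_eq', Finset.mem_univ, if_true]
    rw [pot, Matrix.sub_apply, sgnMat_mul_apply, mul_sgnMat_apply, Polynomial.C_sub,
      Polynomial.C_mul, Polynomial.C_mul]
    split_ifs with h
    · subst h; ring
    · ring

theorem dlcoef_x (k : ℕ) (x t : ℝ) : D.dlcoef 1 0 k x t
    = D.lcoef (k + 1) x t * sgnMat n - sgnMat n * D.lcoef (k + 1) x t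
      + D.pot x t * D.lcoef k x t := by
  ext i j
  have h := congrArg (D.rowLaurent j k) (D.lax_x x t i j)
  simp only [map_add, map_sub, map_sum, map_zero, ← Polynomial.smul_eq_C_mul, map_smul] at h
  have h2 : ∀ i, D.rowLaurent j k (Polynomial.X * D.num x t i j) = D.lcoef (k + 1) x t i j :=
    fun i => laurent_X_mul _ _
  simp only [h2, smul_eq_mul] at h
  have h3 : (D.pot x t * D.lcoef k x t) i j
      = ∑ l, D.pot x t i l * D.rowLaurent j k (D.num x t l j) := rfl
  rw [Matrix.add_apply, Matrix.sub_apply, mul_sgnMat_apply, sgnMat_mul_apply, h3]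
  have h4 : D.dlcoef 1 0 k x t i j = D.rowLaurent j k (D.dnum 1 0 x t i j) := rfl
  rw [h4]
  linear_combination h

/-- The same argument for `M_t + 4 z³ [iσ, M] = (B₁ z² + B₂ z + B₃) M`. The cubic term drops out
because `iσ` commutes with the identity, and the coefficients of `z²`, `z`, `1` determine `B₁`,
`B₂`, `B₃` successively. -/
theorem lax_t (x t : ℝ) {B₁ B₂ B₃ : BlockMat n}
    (hB₁ : B₁ = (4 : ℝ) • D.pot x t)
    (hB₂ : B₂ = (4 : ℝ) • (sgnMat n * D.lcoef 2 x t - D.lcoef 2 x t * sgnMat n)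
      - B₁ * D.lcoef 1 x t)
    (hB₃ : B₃ = (4 : ℝ) • (sgnMat n * D.lcoef 3 x t - D.lcoef 3 x t * sgnMat n)
      - B₁ * D.lcoef 2 x t - B₂ * D.lcoef 1 x t) (i j : Unit ⊕ Fin n) :
    D.dnum 0 1 x t i j
      - Polynomial.C (4 * sgn n j) * (Polynomial.X ^ 3 * D.num x t i j)
      + Polynomial.C (4 * sgn n i) * (Polynomial.X ^ 3 * D.num x t i j)
      - ∑ k, (Polynomial.C (B₁ i k) * (Polynomial.X ^ 2 * D.num x t k j)
        + Polynomial.C (B₂ i k) * (Polynomial.X * D.num x t k j)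
        + Polynomial.C (B₃ i k) * D.num x t k j) = 0 := by
  have hϕ : phasePoly 0 1 = Polynomial.C 4 * Polynomial.X ^ 3 := by simp [phasePoly]
  have h1 := D.cond_dnum 0 1 x t i
  rw [hϕ] at h1
  have h2 := (h1.add ((D.cond_num x t i).mul_left (Polynomial.C (4 * sgn n i)
    * Polynomial.X ^ 3))).sub (Cond.sum Finset.univ fun k _ => (D.cond_num x t k).mul_left
      (Polynomial.C (B₁ i k) * Polynomial.X ^ 2 + Polynomial.C (B₂ i k) * Polynomial.X
        + Polynomial.C (B₃ i k)))
  have h3 := h2.eq_zero_of_polyPart (fun j => ?_) j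
  · have hs : ∑ k, (Polynomial.C (B₁ i k) * (Polynomial.X ^ 2 * D.num x t k j)
          + Polynomial.C (B₂ i k) * (Polynomial.X * D.num x t k j)
          + Polynomial.C (B₃ i k) * D.num x t k j)
        = ∑ k, (Polynomial.C (B₁ i k) * Polynomial.X ^ 2 + Polynomial.C (B₂ i k) * Polynomial.X
          + Polynomial.C (B₃ i k)) * D.num x t k j :=
      Finset.sum_congr rfl fun k _ => by ring
    rw [hs]
    rw [Polynomial.C_mul] at h3 ⊢
    rw [Polynomial.C_mul]
    linear_combination h3
  · have e1 : B₁ i j = 4 * (sgn n i * D.lcoef 1 x t i j - D.lcoef 1 x t i j * sgn n j) := by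
      rw [hB₁, pot, Matrix.smul_apply, Matrix.sub_apply, sgnMat_mul_apply, mul_sgnMat_apply,
        Complex.real_smul]
      simp
    have e2 : (B₁ * D.lcoef 1 x t) i j + B₂ i j
        = 4 * (sgn n i * D.lcoef 2 x t i j - D.lcoef 2 x t i j * sgn n j) := by
      rw [hB₂, Matrix.sub_apply, Matrix.smul_apply, Matrix.sub_apply, sgnMat_mul_apply,
        mul_sgnMat_apply, Complex.real_smul]
      simp
    have e3 : (B₁ * D.lcoef 2 x t) i j + (B₂ * D.lcoef 1 x t) i j + B₃ i j
        = 4 * (sgn n i * D.lcoef 3 x t i j - D.lcoef 3 x t i j * sgn n j) := by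
      rw [hB₃, Matrix.sub_apply, Matrix.sub_apply, Matrix.smul_apply, Matrix.sub_apply,
        sgnMat_mul_apply, mul_sgnMat_apply, Complex.real_smul]
      simp
    have hsum : polyPart (D.den j) (D.den_monic j) (∑ k, (Polynomial.C (B₁ i k) * Polynomial.X ^ 2
          + Polynomial.C (B₂ i k) * Polynomial.X + Polynomial.C (B₃ i k)) * D.num x t k j)
        = Polynomial.X ^ 2 * Polynomial.C (B₁ i j)
          + Polynomial.X * Polynomial.C ((B₁ * D.lcoef 1 x t) i j + B₂ i j)
          + Polynomial.C ((B₁ * D.lcoef 2 x t) i j + (B₂ * D.lcoef 1 x t) i j + B₃ i j) := by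
      rw [map_sum]
      have : ∀ k, polyPart (D.den j) (D.den_monic j) ((Polynomial.C (B₁ i k) * Polynomial.X ^ 2
            + Polynomial.C (B₂ i k) * Polynomial.X + Polynomial.C (B₃ i k)) * D.num x t k j)
          = Polynomial.X ^ 2 * (if k = j then Polynomial.C (B₁ i k) else 0)
          + Polynomial.X * (Polynomial.C (B₁ i k * D.lcoef 1 x t k j)
            + if k = j then Polynomial.C (B₂ i k) else 0)
          + (Polynomial.C (B₁ i k * D.lcoef 2 x t k j) + Polynomial.C (B₂ i k * D.lcoef 1 x t k j)
            + if k = j then Polynomial.C (B₃ i k) else 0) := by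
        intro k
        simp only [add_mul, map_add, mul_assoc, polyPart_C_mul, polyPart_X_num, polyPart_num,
          polyPart_X_sq_num, Polynomial.C_mul]
        split_ifs <;> ring
      simp only [this, Finset.sum_add_distrib, ← Finset.mul_sum, ← map_sum, Finset.sum_ite_eq',
        Finset.mem_univ, if_true, Matrix.mul_apply, Polynomial.C_add]
    rw [map_sub, hsum, e1, e2, e3]
    simp only [map_add, map_sub, mul_assoc, polyPart_C_mul, polyPart_X_cube_num, polyPart_dnum]
    simp only [Polynomial.C_mul, Polynomial.C_sub]
    split_ifs with h
    · subst h; ring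
    · ring

theorem dlcoef_t (x t : ℝ) {B₁ B₂ B₃ : BlockMat n}
    (hB₁ : B₁ = (4 : ℝ) • D.pot x t)
    (hB₂ : B₂ = (4 : ℝ) • (sgnMat n * D.lcoef 2 x t - D.lcoef 2 x t * sgnMat n)
      - B₁ * D.lcoef 1 x t)
    (hB₃ : B₃ = (4 : ℝ) • (sgnMat n * D.lcoef 3 x t - D.lcoef 3 x t * sgnMat n)
      - B₁ * D.lcoef 2 x t - B₂ * D.lcoef 1 x t) :
    D.dlcoef 0 1 1 x t
      = (4 : ℝ) • (D.lcoef 4 x t * sgnMat n - sgnMat n * D.lcoef 4 x t) + B₁ * D.lcoef 3 x t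
        + B₂ * D.lcoef 2 x t + B₃ * D.lcoef 1 x t := by
  ext i j
  have h := congrArg (D.rowLaurent j 1) (D.lax_t x t hB₁ hB₂ hB₃ i j)
  simp only [map_add, map_sub, map_sum, map_zero, ← Polynomial.smul_eq_C_mul, map_smul] at h
  have h1 : ∀ i, D.rowLaurent j 1 (D.num x t i j) = D.lcoef 1 x t i j := fun i => rfl
  have h2 : ∀ i, D.rowLaurent j 1 (Polynomial.X * D.num x t i j) = D.lcoef 2 x t i j :=
    fun i => laurent_X_mul _ _
  have h3 : ∀ i, D.rowLaurent j 1 (Polynomial.X ^ 2 * D.num x t i j) = D.lcoef 3 x t i j := by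
    intro i
    rw [pow_two, mul_assoc]
    exact (laurent_X_mul _ _).trans (laurent_X_mul _ _)
  have h4 : ∀ i, D.rowLaurent j 1 (Polynomial.X ^ 3 * D.num x t i j) = D.lcoef 4 x t i j := by
    intro i
    rw [pow_succ', pow_two, mul_assoc, mul_assoc]
    exact (laurent_X_mul _ _).trans ((laurent_X_mul _ _).trans (laurent_X_mul _ _))
  simp only [h1, h2, h3, h4, smul_eq_mul, Finset.sum_add_distrib] at h
  simp only [Matrix.add_apply, Matrix.smul_apply, Matrix.sub_apply, mul_sgnMat_apply,
    sgnMat_mul_apply, Complex.real_smul]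
  simp only [Matrix.mul_apply]
  have h5 : D.dlcoef 0 1 1 x t i j = D.rowLaurent j 1 (D.dnum 0 1 x t i j) := rfl
  rw [h5]
  push_cast
  linear_combination h

theorem hasDerivAt_lcoef_apply (a b x t : ℝ) (k : ℕ) (i j : Unit ⊕ Fin n) :
    HasDerivAt (fun τ : ℝ => D.lcoef k (x + τ * a) (t + τ * b) i j) (D.dlcoef a b k x t i j) 0 := by
  have h := hasDerivAt_pi.1 (hasDerivAt_pi.1 (D.hasDerivAt_coef a b x t) i) j
  let L : (Fin D.deg → ℂ) →L[ℝ] ℂ :=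
    LinearMap.toContinuousLinearMap (((D.rowLaurent j k).comp toPoly).restrictScalars ℝ)
  have h1 := (L.hasFDerivAt.comp_hasDerivAt (0 : ℝ) h).const_add
    (D.rowLaurent j k (if i = j then D.den j else 0))
  refine h1.congr_of_eventuallyEq (Eventually.of_forall fun τ => ?_)
  change D.rowLaurent j k (D.num _ _ i j) = _
  rw [num, map_add]
  rfl

theorem contDiff_lcoef_apply (k : ℕ) (i j : Unit ⊕ Fin n) :
    ContDiff ℝ ∞ (fun q : ℝ × ℝ => D.lcoef k q.1 q.2 i j) := by
  have h := contDiff_pi.1 (contDiff_pi.1 D.contDiff_coef i) j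
  let L : (Fin D.deg → ℂ) →L[ℝ] ℂ :=
    LinearMap.toContinuousLinearMap (((D.rowLaurent j k).comp toPoly).restrictScalars ℝ)
  have h1 := (contDiff_const (c := D.rowLaurent j k (if i = j then D.den j else 0))).add
    (L.contDiff.comp h)
  have h2 : (fun q : ℝ × ℝ => D.lcoef k q.1 q.2 i j) = fun q =>
      D.rowLaurent j k (if i = j then D.den j else 0) + (L ∘ fun q => D.coef q i j) q := by
    ext q
    change D.rowLaurent j k (D.num _ _ i j) = _
    rw [num, map_add]
    rfl
  rw [h2]
  exact h1

end PoleData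

theorem iteratedDeriv_clm_apply {E F : Type*} [NormedAddCommGroup E] [NormedSpace ℝ E]
    [NormedAddCommGroup F] [NormedSpace ℝ F] (L : E →L[ℝ] F) {f : ℝ → E} (hf : ContDiff ℝ ∞ f)
    (k : ℕ) : iteratedDeriv k (fun y => L (f y)) = fun y => L (iteratedDeriv k f y) := by
  induction k with
  | zero => simp
  | succ k ih =>
    ext y
    have h : HasDerivAt (iteratedDeriv k f) (deriv (iteratedDeriv k f) y) y :=
      (hf.differentiable_iteratedDeriv k (by exact_mod_cast WithTop.coe_lt_top _)).differentiableAt.hasDerivAt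
    rw [iteratedDeriv_succ, iteratedDeriv_succ, ih]
    exact (L.hasFDerivAt.comp_hasDerivAt y h).deriv

/-! ### Unitarity, the potential and the evolution equation -/

namespace PoleData

variable {ι : Type*} [Fintype ι] {n : ℕ} (D : PoleData ι n)

theorem den_mul_conjPoly_den (j : Unit ⊕ Fin n) :
    D.den j * conjPoly (D.den j) = D.W * conjPoly D.W := by
  rcases j with _ | j
  · rfl
  · change conjPoly D.W * conjPoly (conjPoly D.W) = _
    rw [conjPoly_conjPoly, mul_comm]

theorem pairing_sub (x t : ℝ) (i j : Unit ⊕ Fin n) :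
    (∑ l, D.num x t i l * conjPoly (D.num x t j l)) - (if i = j then D.W * conjPoly D.W else 0)
      = D.den i * conjPoly (toPoly (D.coef (x, t) j i))
        + toPoly (D.coef (x, t) i j) * conjPoly (D.den j)
        + ∑ l, toPoly (D.coef (x, t) i l) * conjPoly (toPoly (D.coef (x, t) j l)) := by
  have : ∀ l, D.num x t i l * conjPoly (D.num x t j l)
      = (if i = l then (if j = l then D.den l * conjPoly (D.den l) else 0) else 0)
        + (if i = l then D.den l * conjPoly (toPoly (D.coef (x, t) j l)) else 0)
        + (if j = l then toPoly (D.coef (x, t) i l) * conjPoly (D.den l) else 0)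
        + toPoly (D.coef (x, t) i l) * conjPoly (toPoly (D.coef (x, t) j l)) := by
    intro l
    simp only [num]
    split_ifs <;> simp [conjPoly] <;> ring
  simp only [this, Finset.sum_add_distrib, Finset.sum_ite_eq, Finset.mem_univ, if_true,
    den_mul_conjPoly_den]
  have : (if j = i then D.W * conjPoly D.W else 0) = if i = j then D.W * conjPoly D.W else 0 := by
    simp [eq_comm]
  rw [this]
  ring

theorem natDegree_toPoly_le {K : ℕ} (v : Fin K → ℂ) : (toPoly v).natDegree ≤ K - 1 := by
  rcases eq_or_ne (toPoly v) 0 with h | h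
  · simp [h]
  have := toPoly_degree v
  rw [Polynomial.degree_eq_natDegree h] at this
  norm_cast at this
  omega

theorem degree_mul_lt {P Q : ℂ[X]} {K : ℕ} (hP : P.degree ≤ (K : WithBot ℕ))
    (hQ : Q.degree < (K : WithBot ℕ)) : (P * Q).degree < ((K + K : ℕ) : WithBot ℕ) := by
  rcases eq_or_ne P 0 with h0 | h0
  · simp [h0]
  rcases eq_or_ne Q 0 with h1 | h1
  · simp [h1]
  rw [Polynomial.degree_mul, Polynomial.degree_eq_natDegree h0, Polynomial.degree_eq_natDegree h1]
  rw [Polynomial.degree_eq_natDegree h0] at hP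
  rw [Polynomial.degree_eq_natDegree h1] at hQ
  norm_cast at *
  omega

/-- This is `M(z) M(conj z)ᴴ = 1` on numerators. Both terms of the difference are multiples of `W
W*`, while the leading products of denominators cancel and leave degree less than `2 deg`. -/
theorem pairing_num (x t : ℝ) (i j : Unit ⊕ Fin n) :
    ∑ l, D.num x t i l * conjPoly (D.num x t j l) = if i = j then D.W * conjPoly D.W else 0 := by
  rw [← sub_eq_zero]
  have hdvd : D.W * conjPoly D.W ∣ (∑ l, D.num x t i l * conjPoly (D.num x t j l))
      - (if i = j then D.W * conjPoly D.W else 0) := by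
    refine dvd_sub ((D.cond_num x t i).dvd_pairing (D.cond_num x t j)) ?_
    split_ifs
    · exact dvd_rfl
    · exact dvd_zero _
  refine Polynomial.eq_zero_of_dvd_of_degree_lt hdvd ?_
  have hd : (D.W * conjPoly D.W).degree = ((D.deg + D.deg : ℕ) : WithBot ℕ) := by
    rw [Polynomial.degree_mul, Polynomial.degree_eq_natDegree D.W_monic.ne_zero,
      Polynomial.degree_eq_natDegree D.conjPoly_W_monic.ne_zero, D.W_natDegree,
      D.conjPoly_W_natDegree]
    rfl
  rw [hd, pairing_sub]
  have hp : ∀ v : Fin D.deg → ℂ, (conjPoly (toPoly v)).degree < (D.deg : WithBot ℕ) := fun v => by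
    rw [Polynomial.degree_map]; exact toPoly_degree v
  refine (Polynomial.degree_add_le _ _).trans_lt (max_lt
    ((Polynomial.degree_add_le _ _).trans_lt (max_lt ?_ ?_)) ?_)
  · exact degree_mul_lt (D.degree_den i).le (hp _)
  · rw [mul_comm]
    refine degree_mul_lt ?_ (toPoly_degree _)
    rw [Polynomial.degree_map, D.degree_den]
  · refine (Polynomial.degree_sum_le _ _).trans_lt ?_
    rw [Finset.sup_lt_iff (WithBot.bot_lt_coe _)]
    exact fun l _ => degree_mul_lt (toPoly_degree _).le (hp _)

theorem lcoef_one_apply (x t : ℝ) (i j : Unit ⊕ Fin n) :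
    D.lcoef 1 x t i j = (toPoly (D.coef (x, t) i j)).coeff (D.deg - 1) := by
  have h0 : D.rowLaurent j 1 (if i = j then D.den j else 0) = 0 := by
    split_ifs
    · rw [rowLaurent, laurent_eq, pow_one, polyPart_X_mul, polyPart_self]
      have : polyPart (D.den j) (D.den_monic j) (Polynomial.X * D.den j) = Polynomial.X := by
        rw [mul_comm]; exact Polynomial.mul_divByMonic_cancel_left _ (D.den_monic j)
      simp [this]
    · exact map_zero _
  change D.rowLaurent j 1 (D.num x t i j) = _
  rw [num, map_add, h0, zero_add, rowLaurent, laurent_one_of_degree_lt, D.den_natDegree]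
  rw [D.degree_den]; exact toPoly_degree _

/-- The `1/z` term of `M(z) M(conj z)ᴴ = 1`, obtained as the coefficient of degree `2 deg - 1` of
the pairing identity. -/
theorem lcoef_one_antiHermitian (x t : ℝ) (i j : Unit ⊕ Fin n) :
    D.lcoef 1 x t i j = -conj (D.lcoef 1 x t j i) := by
  rw [lcoef_one_apply, lcoef_one_apply]
  -- Without poles the truncated subtraction `deg - 1` is not a genuine degree, but all correction
  -- polynomials are then zero.
  rcases Nat.eq_zero_or_pos D.deg with h | h
  · have : ∀ v : Fin D.deg → ℂ, toPoly v = 0 := fun v => by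
      ext k
      exact (Polynomial.degree_lt_iff_coeff_zero _ _).1 (toPoly_degree v) k (h ▸ Nat.zero_le k)
    simp [this]
  have h1 := D.pairing_sub x t i j
  rw [pairing_num, sub_self] at h1
  have h2 := congrArg (fun P : ℂ[X] => P.coeff (D.deg + (D.deg - 1))) h1.symm
  have hlead : ∀ j, (D.den j).coeff D.deg = 1 := fun j => by
    rw [← D.den_natDegree j]; exact D.den_monic j
  have hz : ∀ v : Fin D.deg → ℂ, (toPoly v).coeff D.deg = 0 := fun v =>
    Polynomial.coeff_eq_zero_of_degree_lt (toPoly_degree v)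
  have hnd : ∀ v : Fin D.deg → ℂ, (conjPoly (toPoly v)).natDegree ≤ D.deg - 1 := fun v => by
    rw [Polynomial.natDegree_map]; exact natDegree_toPoly_le v
  simp only [Polynomial.coeff_add, Polynomial.finsetSum_coeff, Polynomial.coeff_zero] at h2
  rw [Polynomial.coeff_mul_add_eq_of_natDegree_le (D.den_natDegree i).le (hnd _), hlead,
    mul_comm (toPoly (D.coef (x, t) i j)),
    Polynomial.coeff_mul_add_eq_of_natDegree_le (by rw [Polynomial.natDegree_map, D.den_natDegree])
      (natDegree_toPoly_le _), Polynomial.coeff_map, Polynomial.coeff_map, hlead,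
    Finset.sum_eq_zero fun l _ => by
      rw [Polynomial.coeff_mul_add_eq_of_natDegree_le ((natDegree_toPoly_le _).trans (Nat.sub_le _ _))
        (hnd _), hz, zero_mul]] at h2
  simp only [map_one, one_mul, add_zero] at h2
  linear_combination h2

/-- The complex vector `-2i lim z M_DL`. -/
def potential (x t : ℝ) (i : Fin n) : ℂ := -2 * I * D.lcoef 1 x t (.inr i) (.inl ())

theorem pot_eq_fromBlocks (x t : ℝ) : D.pot x t = Matrix.fromBlocks 0
    (Matrix.of fun _ j => -conj (D.potential x t j)) (Matrix.of fun i _ => D.potential x t i) 0 := by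
  have h2 : conj (2 : ℂ) = 2 := Complex.conj_ofNat 2
  ext i j
  rw [pot, Matrix.sub_apply, sgnMat_mul_apply, mul_sgnMat_apply]
  rcases i with i | i <;> rcases j with j | j
  · simp [sgn]; ring
  · simp [sgn, potential, h2]
    rw [D.lcoef_one_antiHermitian x t (.inl ()) (.inr j)]
    ring
  · simp [sgn, potential]; ring
  · simp [sgn]; ring

section Evolution

open scoped Matrix.Norms.Operator

/-- Expansion in matrix units passes from entries to the operator norm, which makes the matrices a
normed algebra as `evolution_of_recursion` requires. -/
theorem hasDerivAt_matrix {M : ℝ → BlockMat n} {M' : BlockMat n} {x : ℝ}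
    (h : ∀ i j, HasDerivAt (fun y => M y i j) (M' i j) x) : HasDerivAt M M' x := by
  have h1 : HasDerivAt (fun y => ∑ i, ∑ j, M y i j • Matrix.single i j (1 : ℂ))
      (∑ i, ∑ j, M' i j • Matrix.single i j (1 : ℂ)) x :=
    HasDerivAt.fun_sum fun i _ => HasDerivAt.fun_sum fun j _ => (h i j).smul_const _
  have h2 : ∀ M : BlockMat n, ∑ i, ∑ j, M i j • Matrix.single i j (1 : ℂ) = M := fun M => by
    simp only [Matrix.smul_single, smul_eq_mul, mul_one]
    exact (Matrix.matrix_eq_sum_single M).symm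
  simpa only [h2] using h1

theorem contDiff_matrix {M : ℝ → BlockMat n}
    (h : ∀ i j, ContDiff ℝ ∞ (fun y => M y i j)) : ContDiff ℝ ∞ M := by
  have h1 : ContDiff ℝ ∞ (fun y => ∑ i, ∑ j, M y i j • Matrix.single i j (1 : ℂ)) :=
    ContDiff.sum fun i _ => ContDiff.sum fun j _ => (h i j).smul contDiff_const
  have h2 : ∀ M : BlockMat n, ∑ i, ∑ j, M i j • Matrix.single i j (1 : ℂ) = M := fun M => by
    simp only [Matrix.smul_single, smul_eq_mul, mul_one]
    exact (Matrix.matrix_eq_sum_single M).symm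
  simpa only [h2] using h1

theorem hasDerivAt_lcoef_x (k : ℕ) (x t : ℝ) :
    HasDerivAt (fun y => D.lcoef k y t) (D.dlcoef 1 0 k x t) x := by
  refine hasDerivAt_matrix fun i j => ?_
  have h := D.hasDerivAt_lcoef_apply 1 0 x t k i j
  have h2 : HasDerivAt (fun y : ℝ => y - x) 1 x := (hasDerivAt_id x).sub_const x
  have h3 := HasDerivAt.scomp x (h := fun y : ℝ => y - x) (by simpa using h) h2
  simpa [Function.comp_def] using h3

theorem hasDerivAt_lcoef_t (k : ℕ) (x t : ℝ) :
    HasDerivAt (fun s => D.lcoef k x s) (D.dlcoef 0 1 k x t) t := by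
  refine hasDerivAt_matrix fun i j => ?_
  have h := D.hasDerivAt_lcoef_apply 0 1 x t k i j
  have h2 : HasDerivAt (fun y : ℝ => y - t) 1 t := (hasDerivAt_id t).sub_const t
  have h3 := HasDerivAt.scomp t (h := fun y : ℝ => y - t) (by simpa using h) h2
  simpa [Function.comp_def] using h3

theorem contDiff_lcoef_apply_x (k : ℕ) (i j : Unit ⊕ Fin n) (t : ℝ) :
    ContDiff ℝ ∞ (fun y => D.lcoef k y t i j) := by
  have h : ContDiff ℝ ∞ (fun y : ℝ => (y, t)) := contDiff_id.prodMk contDiff_const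
  have h' := ContDiff.comp (g := fun p : ℝ × ℝ => D.lcoef k p.1 p.2 i j) (D.contDiff_lcoef_apply k i j) h
  simpa only [Function.comp_def] using h'

theorem contDiff_lcoef_x (k : ℕ) (t : ℝ) : ContDiff ℝ ∞ (fun y => D.lcoef k y t) :=
  contDiff_matrix fun i j => D.contDiff_lcoef_apply_x k i j t

theorem contDiff_pot_x (t : ℝ) : ContDiff ℝ ∞ (fun y => D.pot y t) := by
  unfold pot
  exact (contDiff_const.mul (D.contDiff_lcoef_x 1 t)).sub
    ((D.contDiff_lcoef_x 1 t).mul contDiff_const)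

theorem hasDerivAt_pot_t (x t : ℝ) : HasDerivAt (fun s => D.pot x s)
    (sgnMat n * D.dlcoef 0 1 1 x t - D.dlcoef 0 1 1 x t * sgnMat n) t := by
  unfold pot
  exact ((D.hasDerivAt_lcoef_t 1 x t).const_mul _).sub ((D.hasDerivAt_lcoef_t 1 x t).mul_const _)

theorem pot_evolution (x t : ℝ) :
    (sgnMat n * D.dlcoef 0 1 1 x t - D.dlcoef 0 1 1 x t * sgnMat n)
      + iteratedDeriv 3 (fun y => D.pot y t) x
      = (3 : ℝ) • (deriv (fun y => D.pot y t) x * (D.pot x t * D.pot x t)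
        + D.pot x t * D.pot x t * deriv (fun y => D.pot y t) x) := by
  have hs : sgnMat n * sgnMat n = -1 := by
    have h : ∀ i, sgn n i * sgn n i = -1 := fun i => by rcases i with i | i <;> simp [sgn]
    rw [sgnMat, Matrix.diagonal_mul_diagonal]
    simp only [h]
    ext i j
    by_cases hij : i = j <;> simp [hij]
  have hd : ∀ k y, HasDerivAt (fun y => D.lcoef k y t)
      (D.lcoef (k + 1) y t * sgnMat n - sgnMat n * D.lcoef (k + 1) y t
      + D.pot y t * D.lcoef k y t) y := fun k y => by
    rw [← D.dlcoef_x]; exact D.hasDerivAt_lcoef_x k y t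
  exact evolution_of_recursion hs (m₁ := fun y => D.lcoef 1 y t) (m₂ := fun y => D.lcoef 2 y t)
    (m₃ := fun y => D.lcoef 3 y t) (m₄ := fun y => D.lcoef 4 y t) (Q := fun y => D.pot y t)
    (fun y => rfl) (D.contDiff_lcoef_x 1 t) (hd 1) (hd 2) (hd 3) rfl rfl rfl
    (D.dlcoef_t x t rfl rfl rfl)

variable (n) in
/-- The real part of the lower left block. -/
def lowerLeft : BlockMat n →L[ℝ] (Fin n → ℝ) :=
  LinearMap.toContinuousLinearMap
    { toFun := fun M i => (M (.inr i) (.inl ())).re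
      map_add' := fun M M' => by ext i; simp
      map_smul' := fun c M => by ext i; simp }

theorem lowerLeft_apply (M : BlockMat n) (i : Fin n) :
    lowerLeft n M i = (M (.inr i) (.inl ())).re := rfl

/-- For real `q` the matrix `Q` has blocks `-qᵀ` and `q`, so `Q²` is block diagonal with blocks
`-qᵀq` and `-q qᵀ`. The lower left block of the matrix equation is then the vector equation, with
the sign of the cubic term reversed. -/
theorem isVmKdVSolution (hreal : ∀ x t i, conj (D.potential x t i) = D.potential x t i) :
    IsVmKdVSolution (fun x t i => (D.potential x t i).re) := by
  set q : ℝ → ℝ → Fin n → ℝ := fun x t i => (D.potential x t i).re with hq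
  have hqc : ∀ x t i, D.potential x t i = (q x t i : ℂ) := fun x t i =>
    (Complex.conj_eq_iff_re.1 (hreal x t i)).symm
  have hblk : ∀ x t, D.pot x t = Matrix.fromBlocks 0 (Matrix.of fun _ j => -(q x t j : ℂ))
      (Matrix.of fun i _ => (q x t i : ℂ)) 0 := fun x t => by
    rw [pot_eq_fromBlocks]; simp [hqc]
  have hqL : ∀ x t, q x t = lowerLeft n (D.pot x t) := fun x t => by
    ext i; rw [lowerLeft_apply, hblk]; simp
  refine ⟨?_, fun x t => ?_⟩
  · rw [contDiff_pi]
    intro i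
    exact reCLM.contDiff.comp (contDiff_const.mul (D.contDiff_lcoef_apply 1 (.inr i) (.inl ())))
  have hdiff : DifferentiableAt ℝ (fun y => D.pot y t) x :=
    (D.contDiff_pot_x t).differentiable (by simp) x
  have hqd : Differentiable ℝ (fun y => q y t) := by
    simp_rw [hqL]
    exact (lowerLeft n).differentiable.comp ((D.contDiff_pot_x t).differentiable (by simp))
  have ht : deriv (fun s => q x s) t
      = lowerLeft n (sgnMat n * D.dlcoef 0 1 1 x t - D.dlcoef 0 1 1 x t * sgnMat n) := by
    simp_rw [hqL]
    exact ((lowerLeft n).hasFDerivAt.comp_hasDerivAt t (D.hasDerivAt_pot_t x t)).deriv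
  have hx3 : iteratedDeriv 3 (fun y => q y t) x
      = lowerLeft n (iteratedDeriv 3 (fun y => D.pot y t) x) := by
    simp_rw [hqL]
    exact congrFun (iteratedDeriv_clm_apply (lowerLeft n) (D.contDiff_pot_x t) 3) x
  have hdx : deriv (fun y => D.pot y t) x = Matrix.fromBlocks 0
      (Matrix.of fun _ j => -(deriv (fun y => q y t) x j : ℂ))
      (Matrix.of fun i _ => (deriv (fun y => q y t) x i : ℂ)) 0 := by
    have h1 := hasDerivAt_pi.1 (hqd x).hasDerivAt
    refine HasDerivAt.deriv (hasDerivAt_matrix fun i j => ?_)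
    simp_rw [hblk]
    rcases i with i | i <;> rcases j with j | j
    · simpa using hasDerivAt_const x (0 : ℂ)
    · simpa using (h1 j).ofReal_comp.fun_neg
    · simpa using (h1 i).ofReal_comp
    · simpa using hasDerivAt_const x (0 : ℂ)
  have key := congrArg (lowerLeft n) (D.pot_evolution x t)
  rw [map_add, ← ht, ← hx3, map_smul, hdx, hblk] at key
  rw [key]
  ext i
  simp only [Pi.add_apply, Pi.smul_apply, Pi.zero_apply, lowerLeft_apply, smul_eq_mul]
  simp only [Matrix.fromBlocks_multiply, Matrix.add_apply, Matrix.fromBlocks_apply₂₁]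
  simp [Matrix.mul_apply, dotProduct, Finset.sum_mul, Finset.mul_sum]
  have e1 : ∀ l, q x t l * q x t l * deriv (fun y => q y t) x i
      = deriv (fun y => q y t) x i * (q x t l * q x t l) := fun l => by ring
  have e2 : ∀ l, q x t l * deriv (fun y => q y t) x l * q x t i
      = q x t i * q x t l * deriv (fun y => q y t) x l := fun l => by ring
  simp only [e1, e2]
  ring

end Evolution

end PoleData

/-! ### Analytic rows: uniqueness and partial fractions -/

theorem PolarRel.sub {a b ψ χ : ℂ → ℂ} {p : ℂ} {m : ℕ} (h : PolarRel a ψ p m)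
    (h' : PolarRel b χ p m) : PolarRel (fun z => a z - b z) (fun z => ψ z - χ z) p m := by
  obtain ⟨k, hk, he⟩ := h
  obtain ⟨l, hl, he'⟩ := h'
  exact ⟨fun z => k z - l z, by fun_prop,
    by filter_upwards [he, he'] with z h1 h2 using by rw [h1, h2]; ring⟩

theorem tendsto_conj_cobounded :
    Tendsto (fun z : ℂ => conj z) (Bornology.cobounded ℂ) (Bornology.cobounded ℂ) := by
  rw [← tendsto_norm_atTop_iff_cobounded]
  simpa using tendsto_norm_cobounded_atTop (E := ℂ)

theorem tendsto_conj_punctured (p : ℂ) : Tendsto (fun z : ℂ => conj z) (𝓝[≠] p) (𝓝[≠] (conj p)) := by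
  refine tendsto_nhdsWithin_iff.2 ⟨?_, ?_⟩
  · exact Complex.continuous_conj.continuousAt.tendsto.mono_left nhdsWithin_le_nhds
  · filter_upwards [self_mem_nhdsWithin] with z hz h
    exact hz ((starRingEnd ℂ).injective h)

theorem exists_pole_avoiding (S : Set ℂ) (hS : S.Finite) (p : ℂ) : ∀ᶠ z in 𝓝[≠] p, z ∉ S := by
  have : (S \ {p})ᶜ ∈ 𝓝 p := (hS.subset Set.sdiff_subset).isClosed.isOpen_compl.mem_nhds (by simp)
  filter_upwards [mem_nhdsWithin_of_mem_nhds this, self_mem_nhdsWithin] with w h1 h2 h3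
  exact h1 ⟨h3, h2⟩

/-- A function analytic off a finite set of non-real points which vanishes on the real line is
zero. -/
theorem eq_zero_of_real {f : ℂ → ℂ} {S : Set ℂ} (hS : S.Finite) (hSr : ∀ s : ℝ, (s : ℂ) ∉ S)
    (hf : ∀ z ∉ S, AnalyticAt ℂ f z) (hr : ∀ s : ℝ, f s = 0) : ∀ z ∉ S, f z = 0 := by
  have hc : IsPreconnected Sᶜ :=
    (hS.countable.isConnected_compl_of_one_lt_rank (by simp)).isPreconnected
  refine fun z hz => AnalyticOnNhd.eqOn_zero_of_preconnected_of_frequently_eq_zero (z₀ := (0 : ℝ))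
    (f := f) (fun z hz => hf z hz) hc (hSr 0) ?_ hz
  have ht : Tendsto (fun s : ℝ => (s : ℂ)) (𝓝[≠] 0) (𝓝[≠] ((0 : ℝ) : ℂ)) := by
    refine tendsto_nhdsWithin_iff.2 ⟨?_, ?_⟩
    · exact Complex.continuous_ofReal.continuousAt.tendsto.mono_left nhdsWithin_le_nhds
    · filter_upwards [self_mem_nhdsWithin] with s hs h
      exact hs (Complex.ofReal_injective h)
  exact ht.frequently (Eventually.of_forall hr).frequently

namespace PoleData

variable {ι : Type*} [Fintype ι] {n : ℕ} (D : PoleData ι n)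

/-- The function whose principal part is prescribed at `pt c` for the first entry of a row. -/
def upper (x t : ℝ) (v : Unit ⊕ Fin n → ℂ → ℂ) (c : ι) (z : ℂ) : ℂ :=
  exp (2 * I * phase x t z) * ∑ j, v (.inr j) z * (D.g c j).eval z

/-- The function whose principal part is prescribed at `conj (pt c)` for the other entries of a
row. -/
def lower (x t : ℝ) (v : Unit ⊕ Fin n → ℂ → ℂ) (c : ι) (j : Fin n) (z : ℂ) : ℂ :=
  -(exp (-2 * I * phase x t z) * (v (.inl ()) z * (conjPoly (D.g c j)).eval z))

/-- `v` is a row of a solution of the reflectionless Riemann-Hilbert problem, normalized to `c` at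
infinity. -/
structure IsRow (x t : ℝ) (c : Unit ⊕ Fin n → ℂ) (v : Unit ⊕ Fin n → ℂ → ℂ) : Prop where
  analytic_left : ∀ z, (∀ k, z ≠ D.pt k) → AnalyticAt ℂ (v (.inl ())) z
  analytic_right : ∀ j z, (∀ k, z ≠ conj (D.pt k)) → AnalyticAt ℂ (v (.inr j)) z
  tendsto : ∀ j, Tendsto (v j) (Bornology.cobounded ℂ) (𝓝 (c j))
  polar_up : ∀ k, PolarRel (v (.inl ())) (D.upper x t v k) (D.pt k) (D.ord k)
  polar_low : ∀ k j, PolarRel (v (.inr j)) (D.lower x t v k j) (conj (D.pt k)) (D.ord k)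

variable {D}

theorem ne_conj_pt {z : ℂ} (hz : 0 ≤ z.im) (k : ι) : z ≠ conj (D.pt k) := fun h => by
  have := D.im_pos k
  rw [h, Complex.conj_im] at hz
  linarith

theorem ne_pt {z : ℂ} (hz : z.im ≤ 0) (k : ι) : z ≠ D.pt k := fun h => by
  have := D.im_pos k
  rw [h] at hz
  linarith

theorem conj_pt_ne_pt (k l : ι) : conj (D.pt k) ≠ D.pt l :=
  ne_pt (by simpa using (D.im_pos k).le) l

variable {x t : ℝ} {c c' : Unit ⊕ Fin n → ℂ} {v w : Unit ⊕ Fin n → ℂ → ℂ}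

theorem upper_analyticAt {k : ι} {z : ℂ} (h : ∀ j, AnalyticAt ℂ (v (.inr j)) z) :
    AnalyticAt ℂ (D.upper x t v k) z := by
  unfold upper
  exact (analyticAt_exp_phase _ _ _ _).mul
    (Finset.analyticAt_fun_sum _ fun j _ => (h j).mul (analyticAt_eval _ _))

theorem lower_analyticAt {k : ι} {j : Fin n} {z : ℂ} (h : AnalyticAt ℂ (v (.inl ())) z) :
    AnalyticAt ℂ (D.lower x t v k j) z := by
  unfold lower
  exact ((analyticAt_exp_phase _ _ _ _).mul (h.mul (analyticAt_eval _ _))).neg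

namespace IsRow

theorem analyticAt_upper (h : D.IsRow x t c v) (k l : ι) :
    AnalyticAt ℂ (D.upper x t v k) (D.pt l) :=
  upper_analyticAt fun j => h.analytic_right j _ (ne_conj_pt (D.im_pos l).le)

theorem analyticAt_lower (h : D.IsRow x t c v) (k l : ι) (j : Fin n) :
    AnalyticAt ℂ (D.lower x t v k j) (conj (D.pt l)) :=
  lower_analyticAt (h.analytic_left _ (conj_pt_ne_pt l))

theorem sub (h : D.IsRow x t c v) (h' : D.IsRow x t c' w) :
    D.IsRow x t (fun j => c j - c' j) (fun j z => v j z - w j z) where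
  analytic_left z hz := (h.analytic_left z hz).fun_sub (h'.analytic_left z hz)
  analytic_right j z hz := (h.analytic_right j z hz).fun_sub (h'.analytic_right j z hz)
  tendsto j := (h.tendsto j).sub (h'.tendsto j)
  polar_up k := ((h.polar_up k).sub (h'.polar_up k)).congr (Eventually.of_forall fun _ => rfl)
    (Eventually.of_forall fun z => by
      simp only [upper, sub_mul, Finset.sum_sub_distrib, mul_sub])
  polar_low k j := ((h.polar_low k j).sub (h'.polar_low k j)).congr
    (Eventually.of_forall fun _ => rfl)
    (Eventually.of_forall fun z => by simp only [lower]; ring)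

theorem conj_lower_conj (v : Unit ⊕ Fin n → ℂ → ℂ) (k : ι) (j : Fin n) (z : ℂ) :
    conj (D.lower x t v k j (conj z))
      = -(exp (2 * I * phase x t z) * (conj (v (.inl ()) (conj z)) * (D.g k j).eval z)) := by
  simp only [lower, map_neg, map_mul, conj_exp_phase, ← eval_conjPoly, conjPoly_conjPoly]

/-- Near a pole in the upper half plane, the product of the pole divisor and the conjugate of the
other entries is regular up to the prescribed terms. -/
theorem exists_regular (h : D.IsRow x t c v) (h' : D.IsRow x t c' w) (k : ι) :
    ∃ (l : ℂ → ℂ) (r : Fin n → ℂ → ℂ), AnalyticAt ℂ l (D.pt k) ∧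
      (∀ j, AnalyticAt ℂ (r j) (D.pt k)) ∧ ∀ᶠ z in 𝓝[≠] (D.pt k),
        ∑ j, v j z * conj (w j (conj z))
          = l z * conj (w (.inl ()) (conj z)) + ∑ j, v (.inr j) z * r j z := by
  obtain ⟨l, hl, el⟩ := h.polar_up k
  choose r hr er using h'.polar_low k
  refine ⟨l, fun j z => conj (r j (conj z)), hl, fun j => analyticAt_conj_conj (hr j), ?_⟩
  have er' := eventually_all.2 fun j => (tendsto_conj_punctured (D.pt k)).eventually (er j)
  filter_upwards [el, er'] with z h1 h2
  have h3 : ∀ j, conj (w (.inr j) (conj z))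
      = -(exp (2 * I * phase x t z) * (conj (w (.inl ()) (conj z)) * (D.g k j).eval z))
        / (z - D.pt k) ^ (D.ord k + 1) + conj (r j (conj z)) := fun j => by
    rw [h2 j, map_add, map_div₀, conj_lower_conj]
    simp
  rw [Fintype.sum_sum_type, Finset.univ_unique, Finset.sum_singleton, PUnit.default_eq_unit, h1]
  simp only [h3, mul_add, Finset.sum_add_distrib, upper, add_mul]
  -- The pole of the left entry of `v` and the poles of the conjugated right entries of `w` carry
  -- opposite terms, so they cancel in the pairing.
  have h4 : ∑ j, v (.inr j) z * (-(exp (2 * I * phase x t z)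
      * (conj (w (.inl ()) (conj z)) * (D.g k j).eval z)) / (z - D.pt k) ^ (D.ord k + 1))
      = -(exp (2 * I * phase x t z) * (∑ j, v (.inr j) z * (D.g k j).eval z)
        / (z - D.pt k) ^ (D.ord k + 1) * conj (w (.inl ()) (conj z))) := by
    rw [Finset.mul_sum, Finset.sum_div, Finset.sum_mul, ← Finset.sum_neg_distrib]
    exact Finset.sum_congr rfl fun j _ => by ring
  rw [h4]
  ring

variable (D) in
/-- The poles of both half planes. -/
def _root_.VmKdV.PoleData.poles : Set ℂ := Set.range D.pt ∪ Set.range fun k => conj (D.pt k)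

variable (D) in
theorem _root_.VmKdV.PoleData.poles_finite : D.poles.Finite :=
  (Set.finite_range _).union (Set.finite_range _)

theorem _root_.VmKdV.PoleData.ne_of_notMem_poles {z : ℂ} (hz : z ∉ D.poles) :
    (∀ k, z ≠ D.pt k) ∧ ∀ k, z ≠ conj (D.pt k) := by
  simp only [poles, Set.mem_union, Set.mem_range, not_or, not_exists] at hz
  exact ⟨fun k h => hz.1 k h.symm, fun k h => hz.2 k h.symm⟩

theorem _root_.VmKdV.PoleData.conj_notMem_poles {z : ℂ} (hz : z ∉ D.poles) : conj z ∉ D.poles := by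
  have h := ne_of_notMem_poles hz
  rintro (⟨k, hk⟩ | ⟨k, hk⟩)
  · exact h.2 k (by rw [hk, Complex.conj_conj])
  · exact h.1 k ((starRingEnd ℂ).injective hk.symm)

theorem _root_.VmKdV.PoleData.real_notMem_poles (s : ℝ) : (s : ℂ) ∉ D.poles := by
  rintro (⟨k, hk⟩ | ⟨k, hk⟩)
  · exact ne_pt (by simp) k hk.symm
  · exact ne_conj_pt (by simp) k hk.symm

theorem analyticAt (h : D.IsRow x t c v) {z : ℂ} (hz : z ∉ D.poles) (j : Unit ⊕ Fin n) :
    AnalyticAt ℂ (v j) z := by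
  rcases j with _ | j
  · exact h.analytic_left z (ne_of_notMem_poles hz).1
  · exact h.analytic_right j z (ne_of_notMem_poles hz).2

/-- The analytic counterpart of `Cond.dvd_pairing`, for rows not yet known to be rational: the
pairing has removable singularities and a limit at infinity. -/
theorem pairing_eq (h : D.IsRow x t c v) : ∀ z ∉ D.poles,
    ∑ j, v j z * conj (v j (conj z)) = ∑ j, c j * conj (c j) := by
  have hup : ∀ k, ∃ l, AnalyticAt ℂ l (D.pt k) ∧ ∀ᶠ z in 𝓝[≠] (D.pt k),
      ∑ j, v j z * conj (v j (conj z)) = l z := by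
    intro k
    obtain ⟨l, r, hl, hr, he⟩ := h.exists_regular h k
    refine ⟨_, ?_, he⟩
    have h1 := analyticAt_conj_conj (h.analytic_left (conj (D.pt k)) (conj_pt_ne_pt k))
    exact (hl.fun_mul h1).fun_add (Finset.analyticAt_fun_sum _ fun j _ =>
      (h.analytic_right j _ (ne_conj_pt (D.im_pos k).le)).mul (hr j))
  refine eq_const_of_removable D.poles_finite (fun z hz => ?_) ?_ ?_
  · exact Finset.analyticAt_fun_sum _ fun j _ => (h.analyticAt hz j).mul
      (analyticAt_conj_conj (h.analyticAt (conj_notMem_poles hz) j))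
  · rintro p (⟨k, rfl⟩ | ⟨k, rfl⟩)
    · exact hup k
    -- The pairing is its own Schwarz conjugate, so the lower poles follow from the upper ones.
    · obtain ⟨l, hl, he⟩ := hup k
      refine ⟨fun z => conj (l (conj z)), analyticAt_conj_conj (by simpa using hl), ?_⟩
      have h1 := tendsto_conj_punctured (conj (D.pt k))
      rw [Complex.conj_conj] at h1
      filter_upwards [h1.eventually he] with z hz
      rw [← hz, map_sum]
      refine Finset.sum_congr rfl fun j _ => ?_
      simp [mul_comm]
  · exact tendsto_finsetSum _ fun j _ => (h.tendsto j).mul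
      ((Complex.continuous_conj.tendsto _).comp ((h.tendsto j).comp tendsto_conj_cobounded))

/-- On the real line the pairing, here zero, is a sum of squared moduli. -/
theorem eq_zero_on_real (h : D.IsRow x t (fun _ => 0) v) (s : ℝ) (j) : v j s = 0 := by
  have h1 := h.pairing_eq s (real_notMem_poles s)
  simp only [Complex.conj_ofReal, zero_mul, Finset.sum_const_zero, Complex.mul_conj] at h1
  norm_cast at h1
  have := (Finset.sum_eq_zero_iff_of_nonneg fun j _ => normSq_nonneg _).1 h1 j (Finset.mem_univ _)
  exact normSq_eq_zero.1 this

theorem eq_left (h : D.IsRow x t c v) (h' : D.IsRow x t c w) {z : ℂ} (hz : ∀ k, z ≠ D.pt k) :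
    v (.inl ()) z = w (.inl ()) z := by
  have h0 : D.IsRow x t (fun _ => 0) (fun j z => v j z - w j z) := by simpa using h.sub h'
  refine sub_eq_zero.1 (eq_zero_of_real (f := fun z => v (.inl ()) z - w (.inl ()) z)
    (Set.finite_range D.pt) (fun s => ?_) (fun z hz => ?_)
    (fun s => h0.eq_zero_on_real s (.inl ())) z ?_)
  · rintro ⟨k, hk⟩; exact ne_pt (by simp) k hk.symm
  · exact h0.analytic_left z fun k hk => hz ⟨k, hk.symm⟩
  · rintro ⟨k, hk⟩; exact hz k hk.symm

theorem eq_right (h : D.IsRow x t c v) (h' : D.IsRow x t c w) {z : ℂ}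
    (hz : ∀ k, z ≠ conj (D.pt k)) (j : Fin n) : v (.inr j) z = w (.inr j) z := by
  have h0 : D.IsRow x t (fun _ => 0) (fun j z => v j z - w j z) := by simpa using h.sub h'
  refine sub_eq_zero.1 (eq_zero_of_real (f := fun z => v (.inr j) z - w (.inr j) z)
    (Set.finite_range fun k => conj (D.pt k)) (fun s => ?_)
    (fun z hz => ?_) (fun s => h0.eq_zero_on_real s (.inr j)) z ?_)
  · rintro ⟨k, hk⟩; exact ne_conj_pt (by simp) k hk.symm
  · exact h0.analytic_right j z fun k hk => hz ⟨k, hk.symm⟩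
  · rintro ⟨k, hk⟩; exact hz k hk.symm

/-- Subtracting all principal parts removes the poles, and Liouville's theorem leaves the value at
infinity. -/
theorem left_eq_sum (h : D.IsRow x t c v) {z : ℂ} (hz : ∀ k, z ≠ D.pt k) :
    v (.inl ()) z
      = c (.inl ()) + ∑ k, principalPart (D.upper x t v k) (D.pt k) (D.ord k) z := by
  rw [← sub_eq_iff_eq_add]
  refine eq_const_of_removable (f := fun z => v (.inl ()) z
    - ∑ k, principalPart (D.upper x t v k) (D.pt k) (D.ord k) z)
    (Set.finite_range D.pt) (fun z hz => ?_) ?_ ?_ z ?_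
  · have hz' : ∀ k, z ≠ D.pt k := fun k hk => hz ⟨k, hk.symm⟩
    exact (h.analytic_left z hz').fun_sub
      (Finset.analyticAt_fun_sum _ fun k _ => principalPart_analyticAt _ _ (hz' k))
  · rintro _ ⟨k, rfl⟩
    classical
    obtain ⟨l, hl, he⟩ := (h.polar_up k).sub_analytic
      (principalPart_polarRel (D.ord k) (h.analyticAt_upper k k))
    refine ⟨fun z => l z - ∑ k' ∈ Finset.univ.erase k,
      principalPart (D.upper x t v k') (D.pt k') (D.ord k') z, hl.fun_sub
      (Finset.analyticAt_fun_sum _ fun k' hk' => principalPart_analyticAt _ _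
        (D.inj.ne (Finset.ne_of_mem_erase hk').symm)), ?_⟩
    filter_upwards [he] with z hz
    rw [← hz, ← Finset.add_sum_erase _ _ (Finset.mem_univ k)]
    ring
  · have := (h.tendsto (.inl ())).sub
      (tendsto_finsetSum Finset.univ fun k _ =>
        principalPart_tendsto (D.upper x t v k) (D.pt k) (D.ord k))
    simpa using this
  · rintro ⟨k, hk⟩; exact hz k hk.symm

theorem right_eq_sum (h : D.IsRow x t c v) {z : ℂ} (hz : ∀ k, z ≠ conj (D.pt k)) (j : Fin n) :
    v (.inr j) z = c (.inr j)
      + ∑ k, principalPart (D.lower x t v k j) (conj (D.pt k)) (D.ord k) z := by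
  rw [← sub_eq_iff_eq_add]
  refine eq_const_of_removable (f := fun z => v (.inr j) z
    - ∑ k, principalPart (D.lower x t v k j) (conj (D.pt k)) (D.ord k) z)
    (Set.finite_range fun k => conj (D.pt k)) (fun z hz => ?_) ?_ ?_ z ?_
  · have hz' : ∀ k, z ≠ conj (D.pt k) := fun k hk => hz ⟨k, hk.symm⟩
    exact (h.analytic_right j z hz').fun_sub
      (Finset.analyticAt_fun_sum _ fun k _ => principalPart_analyticAt _ _ (hz' k))
  · rintro _ ⟨k, rfl⟩
    classical
    obtain ⟨l, hl, he⟩ := (h.polar_low k j).sub_analytic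
      (principalPart_polarRel (D.ord k) (h.analyticAt_lower k k j))
    refine ⟨fun z => l z - ∑ k' ∈ Finset.univ.erase k,
      principalPart (D.lower x t v k' j) (conj (D.pt k')) (D.ord k') z, hl.fun_sub
      (Finset.analyticAt_fun_sum _ fun k' hk' => principalPart_analyticAt _ _
        fun e => Finset.ne_of_mem_erase hk' (D.inj ((starRingEnd ℂ).injective e)).symm), ?_⟩
    filter_upwards [he] with z hz
    rw [← hz, ← Finset.add_sum_erase _ _ (Finset.mem_univ k)]
    ring
  · have := (h.tendsto (.inr j)).sub
      (tendsto_finsetSum Finset.univ fun k _ =>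
        principalPart_tendsto (D.lower x t v k j) (conj (D.pt k)) (D.ord k))
    simpa using this
  · rintro ⟨k, hk⟩; exact hz k hk.symm

end IsRow

/-! ### The constructed solution as an analytic matrix -/

/-- Division of the limits of a polynomial by a monic polynomial of at least its degree. -/
theorem tendsto_eval_div {P W : ℂ[X]} {K : ℕ} (hP : P.natDegree ≤ K) (hW : W.Monic)
    (hWd : W.natDegree = K) :
    Tendsto (fun z => P.eval z / W.eval z) (Bornology.cobounded ℂ) (𝓝 (P.coeff K)) := by
  have key : ∀ P : ℂ[X], P.natDegree ≤ K →
      Tendsto (fun z => P.eval z / z ^ K) (Bornology.cobounded ℂ) (𝓝 (P.coeff K)) := by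
    intro P hP
    have h1 : ∀ i ∈ Finset.range (K + 1), Tendsto (fun z : ℂ => P.coeff i * (z ^ i / z ^ K))
        (Bornology.cobounded ℂ) (𝓝 (P.coeff i * if i = K then 1 else 0)) := by
      intro i hi
      refine Tendsto.const_mul _ ?_
      have hne : ∀ᶠ z in Bornology.cobounded ℂ, z ≠ 0 := by
        filter_upwards [(Bornology.isBounded_singleton (x := (0 : ℂ)) :
          Bornology.IsBounded {(0 : ℂ)})] with z hz using hz
      split_ifs with h
      · subst h
        refine tendsto_const_nhds.congr' ?_
        filter_upwards [hne] with z hz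
        rw [div_self (pow_ne_zero _ hz)]
      · obtain ⟨r, rfl⟩ : ∃ r, K = i + (r + 1) :=
          ⟨K - i - 1, by have := Finset.mem_range.1 hi; omega⟩
        refine (tendsto_inv_pow 0 r).congr' ?_
        filter_upwards [hne] with z hz
        rw [sub_zero, pow_add]
        field_simp
        ring
    have h2 := tendsto_finsetSum _ h1
    simp only [mul_ite, mul_one, mul_zero, Finset.sum_ite_eq', Finset.mem_range,
      Nat.lt_succ_self, if_true] at h2
    refine h2.congr fun z => ?_
    rw [Polynomial.eval_eq_sum_range' (Nat.lt_succ_of_le hP), Finset.sum_div]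
    exact Finset.sum_congr rfl fun i _ => by ring
  have h3 := (key P hP).div (key W hWd.le) (by
    have : W.coeff K = 1 := hWd ▸ hW
    rw [this]; exact one_ne_zero)
  have hW1 : W.coeff K = 1 := hWd ▸ hW
  rw [hW1, div_one] at h3
  refine h3.congr' ?_
  filter_upwards [(Bornology.isBounded_singleton (x := (0 : ℂ)) :
    Bornology.IsBounded {(0 : ℂ)})] with z hz
  rw [Pi.div_apply, div_div_div_cancel_right₀ (pow_ne_zero _ hz)]

variable (D) in
/-- The solution of the Riemann-Hilbert problem as a function of the spectral parameter. -/
def sol (x t : ℝ) (z : ℂ) : BlockMat n :=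
  Matrix.of fun i j => (D.num x t i j).eval z / (D.den j).eval z

theorem eval_den_ne_zero {z : ℂ} (hz : z ∉ D.poles) (j : Unit ⊕ Fin n) : (D.den j).eval z ≠ 0 := by
  rcases j with _ | j
  · exact D.eval_W_ne_zero (ne_of_notMem_poles hz).1
  · exact D.eval_conjW_ne_zero (ne_of_notMem_poles hz).2

theorem conjPoly_W_eq (k : ι) : conjPoly D.W
    = (Polynomial.X - Polynomial.C (conj (D.pt k))) ^ (D.ord k + 1) * conjPoly (D.cof k) := by
  conv_lhs => rw [D.W_eq k]
  simp [conjPoly]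

/-- Near the pole `W = (z - p)^(ord+1) cof`, so dividing `condUp` by `W W*` leaves an analytic
remainder, as `cof` and `W*` do not vanish there. -/
theorem polar_up_of_cond {P : Unit ⊕ Fin n → ℂ[X]} (h : D.Cond x t P) (k : ι) :
    PolarRel (fun z => (P (.inl ())).eval z / D.W.eval z)
      (D.upper x t (fun j z => (P j).eval z / (D.den j).eval z) k) (D.pt k) (D.ord k) := by
  obtain ⟨l, hl, he⟩ := h.1 k
  have h1 := D.eval_cof_ne_zero k
  have h2 := D.eval_conjW_ne_zero_of_im_pos (D.im_pos k)
  refine ⟨fun z => l z / ((D.cof k).eval z * (conjPoly D.W).eval z), hl.fun_div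
    ((analyticAt_eval _ _).mul (analyticAt_eval _ _)) (mul_ne_zero h1 h2), ?_⟩
  have h1' := ((analyticAt_eval (D.cof k) (D.pt k)).continuousAt.eventually_ne h1).filter_mono
    (nhdsWithin_le_nhds (s := {D.pt k}ᶜ))
  have h2' := ((analyticAt_eval (conjPoly D.W) (D.pt k)).continuousAt.eventually_ne h2).filter_mono
    (nhdsWithin_le_nhds (s := {D.pt k}ᶜ))
  filter_upwards [he.filter_mono nhdsWithin_le_nhds, h1', h2', self_mem_nhdsWithin] with z h3 h4 h5 h6
  have h6 : (z - D.pt k) ^ (D.ord k + 1) ≠ 0 := pow_ne_zero _ (sub_ne_zero.2 h6)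
  have hW : D.W.eval z = (z - D.pt k) ^ (D.ord k + 1) * (D.cof k).eval z := by
    conv_lhs => rw [D.W_eq k]
    simp
  have hs : ∑ j, (P (.inr j)).eval z / (D.den (.inr j)).eval z * (D.g k j).eval z
      = (∑ i, (P (.inr i)).eval z * (D.g k i * D.cof k).eval z)
        / ((conjPoly D.W).eval z * (D.cof k).eval z) := by
    rw [Finset.sum_div]
    refine Finset.sum_congr rfl fun j _ => ?_
    change _ / (conjPoly D.W).eval z * _ = _
    rw [Polynomial.eval_mul]
    field_simp
  simp only [upper, hs, hW]
  rw [condUp] at h3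
  generalize (∑ i, (P (.inr i)).eval z * (D.g k i * D.cof k).eval z) = T at *
  generalize (conjPoly D.W).eval z = A at *
  field_simp
  linear_combination h3

theorem polar_low_of_cond {P : Unit ⊕ Fin n → ℂ[X]} (h : D.Cond x t P) (k : ι) (j : Fin n) :
    PolarRel (fun z => (P (.inr j)).eval z / (conjPoly D.W).eval z)
      (D.lower x t (fun j z => (P j).eval z / (D.den j).eval z) k j) (conj (D.pt k)) (D.ord k) := by
  obtain ⟨l, hl, he⟩ := h.2 k j
  have h1 : (conjPoly (D.cof k)).eval (conj (D.pt k)) ≠ 0 := by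
    rw [eval_conjPoly, Complex.conj_conj]; exact (map_ne_zero _).2 (D.eval_cof_ne_zero k)
  have h2 : D.W.eval (conj (D.pt k)) ≠ 0 := D.eval_W_ne_zero (conj_pt_ne_pt k)
  refine ⟨fun z => l z / ((conjPoly (D.cof k)).eval z * D.W.eval z), hl.fun_div
    ((analyticAt_eval _ _).mul (analyticAt_eval _ _)) (mul_ne_zero h1 h2), ?_⟩
  have h1' := ((analyticAt_eval (conjPoly (D.cof k)) _).continuousAt.eventually_ne h1).filter_mono
    (nhdsWithin_le_nhds (s := {conj (D.pt k)}ᶜ))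
  have h2' := ((analyticAt_eval D.W _).continuousAt.eventually_ne h2).filter_mono
    (nhdsWithin_le_nhds (s := {conj (D.pt k)}ᶜ))
  filter_upwards [he.filter_mono nhdsWithin_le_nhds, h1', h2', self_mem_nhdsWithin] with z h3 h4 h5 h6
  have h6 : (z - conj (D.pt k)) ^ (D.ord k + 1) ≠ 0 := pow_ne_zero _ (sub_ne_zero.2 h6)
  have hW : (conjPoly D.W).eval z
      = (z - conj (D.pt k)) ^ (D.ord k + 1) * (conjPoly (D.cof k)).eval z := by
    conv_lhs => rw [conjPoly_W_eq k]
    simp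
  have hm : (conjPoly (D.g k j * D.cof k)).eval z
      = (conjPoly (D.g k j)).eval z * (conjPoly (D.cof k)).eval z := by
    simp [conjPoly, Polynomial.map_mul]
  simp only [lower, hW]
  change _ = -(_ * (_ / D.W.eval z * _)) / _ + _
  rw [condLow, hm] at h3
  generalize (conjPoly (D.cof k)).eval z = A at *
  generalize (conjPoly (D.g k j)).eval z = B at *
  generalize exp (-2 * I * phase x t z) = e at *
  field_simp
  linear_combination h3

theorem natDegree_num_le (x t : ℝ) (i j : Unit ⊕ Fin n) : (D.num x t i j).natDegree ≤ D.deg := by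
  rw [num]
  refine (Polynomial.natDegree_add_le _ _).trans (max_le ?_ ?_)
  · split_ifs
    · exact (D.den_natDegree j).le
    · simp
  · exact (natDegree_toPoly_le _).trans (Nat.sub_le _ _)

theorem coeff_deg_num (x t : ℝ) (i j : Unit ⊕ Fin n) :
    (D.num x t i j).coeff D.deg = (1 : BlockMat n) i j := by
  have h1 : (D.den j).coeff D.deg = 1 := by rw [← D.den_natDegree j]; exact D.den_monic j
  rw [num, Polynomial.coeff_add, Polynomial.coeff_eq_zero_of_degree_lt (toPoly_degree _),
    Matrix.one_apply]
  split_ifs <;> simp [h1]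

theorem isRow_sol (x t : ℝ) (i : Unit ⊕ Fin n) :
    D.IsRow x t ((1 : BlockMat n) i) (fun j z => D.sol x t z i j) where
  analytic_left z hz := (analyticAt_eval _ _).fun_div (analyticAt_eval D.W _) (D.eval_W_ne_zero hz)
  analytic_right j z hz := (analyticAt_eval _ _).fun_div (analyticAt_eval (conjPoly D.W) _)
    (D.eval_conjW_ne_zero hz)
  tendsto j := by
    rw [← coeff_deg_num (D := D) x t i j]
    exact tendsto_eval_div (natDegree_num_le x t i j) (D.den_monic j) (D.den_natDegree j)
  polar_up k := polar_up_of_cond (D.cond_num x t i) k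
  polar_low k j := polar_low_of_cond (D.cond_num x t i) k j

theorem tendsto_mul_sol (x t : ℝ) {i j : Unit ⊕ Fin n} (hij : i ≠ j) :
    Tendsto (fun z => z * D.sol x t z i j) (Bornology.cobounded ℂ) (𝓝 (D.lcoef 1 x t i j)) := by
  have hnum : D.num x t i j = toPoly (D.coef (x, t) i j) := by rw [num, if_neg hij, zero_add]
  have hdeg : (Polynomial.X * D.num x t i j).natDegree ≤ D.deg := by
    rcases eq_or_ne (D.num x t i j) 0 with h | h
    · simp [h]
    · rw [Polynomial.natDegree_X_mul h]
      have h2 : (D.num x t i j).degree < (D.deg : WithBot ℕ) := hnum ▸ toPoly_degree _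
      rw [Polynomial.degree_eq_natDegree h] at h2
      exact_mod_cast h2
  have hco : (Polynomial.X * D.num x t i j).coeff D.deg = D.lcoef 1 x t i j := by
    rw [lcoef_one_apply, hnum]
    have h1 := (Polynomial.degree_lt_iff_coeff_zero _ _).1 (toPoly_degree (D.coef (x, t) i j))
    generalize toPoly (D.coef (x, t) i j) = P at *
    rcases Nat.eq_zero_or_pos D.deg with h | h
    · rw [h, Polynomial.coeff_X_mul_zero, h1 _ (by omega)]
    · obtain ⟨K, hK⟩ := Nat.exists_eq_succ_of_ne_zero h.ne'
      rw [hK, Nat.succ_sub_one, Polynomial.coeff_X_mul]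
  rw [← hco]
  refine (tendsto_eval_div hdeg (D.den_monic j) (D.den_natDegree j)).congr fun z => ?_
  simp [sol, mul_div_assoc]

theorem sol_mul_conjTranspose (x t : ℝ) {z : ℂ} (hz : z ∉ D.poles) :
    D.sol x t z * (D.sol x t (conj z))ᴴ = 1 := by
  ext i j
  have h1 := congrArg (Polynomial.eval z) (D.pairing_num x t i j)
  have hne : (D.W * conjPoly D.W).eval z ≠ 0 := by
    rw [Polynomial.eval_mul]
    exact mul_ne_zero (eval_den_ne_zero hz (.inl ()))
      (D.eval_conjW_ne_zero (ne_of_notMem_poles hz).2)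
  have h2 : ∀ l, D.sol x t z i l * (D.sol x t (conj z))ᴴ l j
      = (D.num x t i l * conjPoly (D.num x t j l)).eval z / (D.W * conjPoly D.W).eval z := by
    intro l
    rw [← den_mul_conjPoly_den D l]
    simp only [Matrix.conjTranspose_apply, sol, Matrix.of_apply, Polynomial.eval_mul,
      eval_conjPoly, star_def, map_div₀]
    rw [div_mul_div_comm]
  rw [Matrix.mul_apply]
  simp only [h2]
  rw [← Finset.sum_div, ← Polynomial.eval_finsetSum, h1, Matrix.one_apply]
  split_ifs
  · exact div_self hne
  · simp

theorem conjTranspose_mul_sol (x t : ℝ) {z : ℂ} (hz : z ∉ D.poles) :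
    (D.sol x t (conj z))ᴴ * D.sol x t z = 1 :=
  mul_eq_one_comm.1 (sol_mul_conjTranspose x t hz)

end PoleData

/-! ### Exact pole orders -/

namespace PolarRel

variable {a ψ : ℂ → ℂ} {p : ℂ} {m : ℕ}

theorem exists_eq_zpow (h : PolarRel a ψ p m) (hψ : AnalyticAt ℂ ψ p) :
    ∃ g, AnalyticAt ℂ g p ∧ g p = ψ p ∧
      ∀ᶠ z in 𝓝[≠] p, a z = (z - p) ^ (-((m + 1 : ℕ) : ℤ)) • g z := by
  obtain ⟨k, hk, he⟩ := h
  refine ⟨fun z => ψ z + (z - p) ^ (m + 1) * k z, by fun_prop, by simp, ?_⟩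
  filter_upwards [he, self_mem_nhdsWithin] with z h1 h2
  have h2 : (z - p) ^ (m + 1) ≠ 0 := pow_ne_zero _ (sub_ne_zero.2 h2)
  rw [h1, zpow_neg, zpow_natCast, smul_eq_mul]
  field_simp

theorem meromorphicAt (h : PolarRel a ψ p m) (hψ : AnalyticAt ℂ ψ p) : MeromorphicAt a p := by
  obtain ⟨k, hk, he⟩ := h
  have : MeromorphicAt (fun z => ψ z / (z - p) ^ (m + 1) + k z) p := by
    have h1 := hψ.meromorphicAt
    have h2 := hk.meromorphicAt
    fun_prop
  exact this.congr (by filter_upwards [he] with z hz using hz.symm)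

theorem meromorphicOrderAt_eq (h : PolarRel a ψ p m) (hψ : AnalyticAt ℂ ψ p) (h0 : ψ p ≠ 0) :
    meromorphicOrderAt a p = ((-((m + 1 : ℕ) : ℤ) : ℤ) : WithTop ℤ) := by
  obtain ⟨g, hg, hgp, he⟩ := h.exists_eq_zpow hψ
  exact (meromorphicOrderAt_eq_int_iff (h.meromorphicAt hψ)).2 ⟨g, hg, hgp ▸ h0, he⟩

theorem le_meromorphicOrderAt (h : PolarRel a ψ p m) (hψ : AnalyticAt ℂ ψ p) :
    ((-((m + 1 : ℕ) : ℤ) : ℤ) : WithTop ℤ) ≤ meromorphicOrderAt a p := by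
  obtain ⟨g, hg, -, he⟩ := h.exists_eq_zpow hψ
  have h1 : MeromorphicAt (fun z : ℂ => (z - p) ^ (-((m + 1 : ℕ) : ℤ))) p := by fun_prop
  have h2 : meromorphicOrderAt (fun z : ℂ => (z - p) ^ (-((m + 1 : ℕ) : ℤ))) p
      = ((-((m + 1 : ℕ) : ℤ) : ℤ) : WithTop ℤ) :=
    (meromorphicOrderAt_eq_int_iff h1).2 ⟨fun _ => 1, analyticAt_const, one_ne_zero,
      Eventually.of_forall fun z => by simp⟩
  have h3 : meromorphicOrderAt a p
      = meromorphicOrderAt ((fun z : ℂ => (z - p) ^ (-((m + 1 : ℕ) : ℤ))) * g) p :=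
    meromorphicOrderAt_congr he
  rw [h3, meromorphicOrderAt_mul h1 hg.meromorphicAt, h2]
  exact le_add_of_nonneg_right hg.meromorphicOrderAt_nonneg

end PolarRel

theorem eq_of_eventually_punctured {f g : ℂ → ℂ} {p : ℂ} (hf : ContinuousAt f p)
    (hg : ContinuousAt g p) (h : ∀ᶠ z in 𝓝[≠] p, f z = g z) : f p = g p :=
  tendsto_nhds_unique_of_eventuallyEq (hf.tendsto.mono_left nhdsWithin_le_nhds)
    (hg.tendsto.mono_left nhdsWithin_le_nhds) h

namespace PoleData

variable {ι : Type*} [Fintype ι] {n : ℕ} {D : PoleData ι n} {x t : ℝ}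

theorem eventually_notMem_poles (p : ℂ) : ∀ᶠ z in 𝓝[≠] p, z ∉ D.poles :=
  exists_pole_avoiding _ D.poles_finite p

theorem sum_conj_mul_sol (x t : ℝ) {z : ℂ} (hz : z ∉ D.poles) (l j : Unit ⊕ Fin n) :
    ∑ i, conj (D.sol x t (conj z) i l) * D.sol x t z i j = (1 : BlockMat n) l j := by
  rw [← conjTranspose_mul_sol x t hz, Matrix.mul_apply]
  rfl

/-- The right columns stay linearly independent at the pole, so they cannot annihilate the nonzero
vector `g(p)`, and the prescribed leading coefficient is nonzero in some row. -/
theorem exists_upper_ne_zero (x t : ℝ) {k : ι} (hg : ∃ j, (D.g k j).eval (D.pt k) ≠ 0) :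
    ∃ i, D.upper x t (fun j z => D.sol x t z i j) k (D.pt k) ≠ 0 := by
  by_contra! hcon
  obtain ⟨l, hl⟩ := hg
  choose r hr er using fun i => (D.isRow_sol x t i).polar_low k l
  have er' := eventually_all.2 fun i => (tendsto_conj_punctured (D.pt k)).eventually (er i)
  -- In `M(conj z)ᴴ M(z) = 1` the singular part of the conjugated column `l` is proportional to the
  -- conjugated left column, which is orthogonal to every right column of `M(z)`. The regular parts
  -- thus give row `l` of a left inverse of the right columns at the pole.
  have key : ∀ j : Fin n, ∑ i, conj (r i (conj (D.pt k))) * D.sol x t (D.pt k) i (.inr j)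
      = (1 : BlockMat n) (.inr l) (.inr j) := by
    intro j
    refine eq_of_eventually_punctured (p := D.pt k)
      (f := fun z => ∑ i, conj (r i (conj z)) * D.sol x t z i (.inr j))
      (g := fun _ => (1 : BlockMat n) (.inr l) (.inr j)) ?_ continuousAt_const ?_
    · refine AnalyticAt.continuousAt (𝕜 := ℂ) (Finset.analyticAt_fun_sum _ fun i _ => ?_)
      exact (analyticAt_conj_conj (hr i)).mul
        ((D.isRow_sol x t i).analytic_right j _ (ne_conj_pt (D.im_pos k).le))
    · filter_upwards [er', eventually_notMem_poles (D := D) (D.pt k)] with z h1 h2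
      have h3 : ∀ i, conj (D.sol x t (conj z) i (.inr l))
          = -(exp (2 * I * phase x t z) * (conj (D.sol x t (conj z) i (.inl ()))
            * (D.g k l).eval z)) / (z - D.pt k) ^ (D.ord k + 1) + conj (r i (conj z)) := fun i => by
        rw [h1 i, map_add, map_div₀, IsRow.conj_lower_conj]
        simp
      rw [← sum_conj_mul_sol x t h2]
      simp only [h3, add_mul, Finset.sum_add_distrib]
      have h4 : ∑ i, -(exp (2 * I * phase x t z) * (conj (D.sol x t (conj z) i (.inl ()))
          * (D.g k l).eval z)) / (z - D.pt k) ^ (D.ord k + 1) * D.sol x t z i (.inr j)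
          = -(exp (2 * I * phase x t z) * (D.g k l).eval z) / (z - D.pt k) ^ (D.ord k + 1)
            * ∑ i, conj (D.sol x t (conj z) i (.inl ())) * D.sol x t z i (.inr j) := by
        rw [Finset.mul_sum]
        exact Finset.sum_congr rfl fun i _ => by ring
      rw [h4, sum_conj_mul_sol x t h2]
      simp
  refine hl ?_
  have h5 : ∀ i, ∑ j, D.sol x t (D.pt k) i (.inr j) * (D.g k j).eval (D.pt k) = 0 := fun i =>
    (mul_eq_zero.1 (hcon i)).resolve_left (exp_ne_zero _)
  have h6 : ∑ j, (∑ i, conj (r i (conj (D.pt k))) * D.sol x t (D.pt k) i (.inr j))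
      * (D.g k j).eval (D.pt k) = 0 := by
    simp only [Finset.sum_mul]
    rw [Finset.sum_comm]
    refine Finset.sum_eq_zero fun i _ => ?_
    simp only [mul_assoc]
    rw [← Finset.mul_sum, h5, mul_zero]
  simpa [key, Matrix.one_apply] using h6

/-- The same device at a lower pole: the singular parts are combinations of conjugated right
columns, orthogonal to the left one, so the regular parts pair with the left column to `1`. -/
theorem exists_left_ne_zero (x t : ℝ) (k : ι) : ∃ i, D.sol x t (conj (D.pt k)) i (.inl ()) ≠ 0 := by
  by_contra! hcon
  set p := conj (D.pt k) with hp
  choose r hr er using fun i => (D.isRow_sol x t i).polar_up k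
  have ht := tendsto_conj_punctured p
  rw [hp, Complex.conj_conj, ← hp] at ht
  have er' := eventually_all.2 fun i => ht.eventually (er i)
  have key : ∑ i, conj (r i (conj p)) * D.sol x t p i (.inl ()) = 1 := by
    refine eq_of_eventually_punctured (p := p)
      (f := fun z => ∑ i, conj (r i (conj z)) * D.sol x t z i (.inl ()))
      (g := fun _ => 1) ?_ continuousAt_const ?_
    · refine AnalyticAt.continuousAt (𝕜 := ℂ) (Finset.analyticAt_fun_sum _ fun i _ => ?_)
      exact (analyticAt_conj_conj (by rw [hp, Complex.conj_conj]; exact hr i)).mul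
        ((D.isRow_sol x t i).analytic_left _ (conj_pt_ne_pt k))
    · filter_upwards [er', eventually_notMem_poles (D := D) p] with z h1 h2
      have h3 : ∀ i, conj (D.sol x t (conj z) i (.inl ()))
          = (∑ j, conj (D.sol x t (conj z) i (.inr j)) *
            (conj (exp (2 * I * phase x t (conj z))) * conj ((D.g k j).eval (conj z))
              / conj ((conj z - D.pt k) ^ (D.ord k + 1)))) + conj (r i (conj z)) := fun i => by
        rw [h1 i, map_add, map_div₀, upper, map_mul, map_sum, Finset.mul_sum, Finset.sum_div]
        congr 1
        refine Finset.sum_congr rfl fun j _ => ?_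
        rw [map_mul]
        ring
      have h5 := sum_conj_mul_sol (D := D) x t h2 (.inl ()) (.inl ())
      rw [Matrix.one_apply_eq] at h5
      rw [← h5]
      simp only [h3, add_mul, Finset.sum_add_distrib, Finset.sum_mul]
      rw [Finset.sum_comm, eq_comm, add_eq_right]
      refine Finset.sum_eq_zero fun j _ => ?_
      have h6 := sum_conj_mul_sol (D := D) x t h2 (.inr j) (.inl ())
      rw [Matrix.one_apply_ne (by simp)] at h6
      refine Eq.trans ?_ (Eq.trans (congrArg (fun T => T * (conj (exp (2 * I * phase x t (conj z)))
        * conj ((D.g k j).eval (conj z)) / conj ((conj z - D.pt k) ^ (D.ord k + 1)))) h6)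
        (zero_mul _))
      simp only [Finset.sum_mul]
      exact Finset.sum_congr rfl fun i _ => by ring
  simp [hcon] at key

theorem hasMatPole_pt (x t : ℝ) {k : ι} (hg : ∃ j, (D.g k j).eval (D.pt k) ≠ 0) :
    HasMatPole (D.sol x t) (D.pt k) (D.ord k + 1) := by
  have hR : ∀ i (j : Fin n), AnalyticAt ℂ (fun z => D.sol x t z i (.inr j)) (D.pt k) := fun i j =>
    (D.isRow_sol x t i).analytic_right j _ (ne_conj_pt (D.im_pos k).le)
  have hL := fun i => (D.isRow_sol x t i).polar_up k
  have hψ := fun i => (D.isRow_sol x t i).analyticAt_upper k k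
  refine ⟨fun i j => ?_, fun i j => ?_, ?_⟩
  · rcases j with _ | j
    · exact (hL i).meromorphicAt (hψ i)
    · exact (hR i j).meromorphicAt
  · rcases j with _ | j
    · exact (hL i).le_meromorphicOrderAt (hψ i)
    · refine le_trans ?_ (hR i j).meromorphicOrderAt_nonneg
      exact_mod_cast (by omega : -((D.ord k + 1 : ℕ) : ℤ) ≤ 0)
  · obtain ⟨i, hi⟩ := exists_upper_ne_zero x t hg
    exact ⟨i, .inl (), (hL i).meromorphicOrderAt_eq (hψ i) hi⟩

theorem hasMatPole_conj_pt (x t : ℝ) {k : ι} (hg : ∃ j, (D.g k j).eval (D.pt k) ≠ 0) :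
    HasMatPole (D.sol x t) (conj (D.pt k)) (D.ord k + 1) := by
  have hL : ∀ i, AnalyticAt ℂ (fun z => D.sol x t z i (.inl ())) (conj (D.pt k)) := fun i =>
    (D.isRow_sol x t i).analytic_left _ (conj_pt_ne_pt k)
  have hR := fun i => (D.isRow_sol x t i).polar_low k
  have hψ := fun i => (D.isRow_sol x t i).analyticAt_lower k k
  refine ⟨fun i j => ?_, fun i j => ?_, ?_⟩
  · rcases j with _ | j
    · exact (hL i).meromorphicAt
    · exact (hR i j).meromorphicAt (hψ i j)
  · rcases j with _ | j
    · refine le_trans ?_ (hL i).meromorphicOrderAt_nonneg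
      exact_mod_cast (by omega : -((D.ord k + 1 : ℕ) : ℤ) ≤ 0)
    · exact (hR i j).le_meromorphicOrderAt (hψ i j)
  · obtain ⟨i, hi⟩ := exists_left_ne_zero (D := D) x t k
    obtain ⟨j, hj⟩ := hg
    refine ⟨i, .inr j, (hR i j).meromorphicOrderAt_eq (hψ i j) ?_⟩
    refine neg_ne_zero.2 (mul_ne_zero (exp_ne_zero _) (mul_ne_zero hi ?_))
    rw [eval_conjPoly, Complex.conj_conj]
    exact (map_ne_zero _).2 hj

end PoleData

/-! ### Reduction of the discrete data and the symmetry `z ↦ -conj z` -/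

theorem iteratedDeriv_eval (P : ℂ[X]) (i : ℕ) (z : ℂ) :
    iteratedDeriv i (fun z => P.eval z) z = (Polynomial.derivative^[i] P).eval z := by
  induction i generalizing P with
  | zero => simp
  | succ i ih =>
    rw [iteratedDeriv_succ', Function.iterate_succ_apply, ← ih]
    congr 1
    ext z
    exact Polynomial.deriv P

theorem iterate_derivative_comp_neg (P : ℂ[X]) (i : ℕ) :
    Polynomial.derivative^[i] (P.comp (-Polynomial.X))
      = (-1) ^ i * (Polynomial.derivative^[i] P).comp (-Polynomial.X) := by
  induction i with
  | zero => simp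
  | succ i ih =>
    rw [Function.iterate_succ_apply', ih, Function.iterate_succ_apply']
    have : Polynomial.derivative ((-1 : ℂ[X]) ^ i) = 0 := by
      rw [show ((-1 : ℂ[X]) ^ i) = Polynomial.C ((-1) ^ i) by simp, Polynomial.derivative_C]
    rw [Polynomial.derivative_mul, this, Polynomial.derivative_comp]
    simp
    ring

namespace DiscreteData

variable {n N N₁ : ℕ} (d : DiscreteData n N N₁)

/-- The polynomial `conj (f (-conj z))`. -/
def fsharp (i : Fin n) : ℂ[X] := (conjPoly (d.f i)).comp (-Polynomial.X)

theorem eval_fsharp (i : Fin n) (z : ℂ) : (d.fsharp i).eval z = conj (d.fv (-conj z) i) := by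
  rw [fsharp, Polynomial.eval_comp, eval_conjPoly]
  simp [fv]

/-- The poles in the upper half plane without repetition, with polynomial residue constants. -/
def poleData : PoleData (Fin N ⊕ OffAxis N N₁) n where
  pt := Sum.elim d.pole fun k => -conj (d.pole k)
  ord := Sum.elim d.m fun k => d.m k
  g := Sum.elim (fun _ => d.f) fun k i => Polynomial.C ((-1) ^ (d.m k + 1)) * d.fsharp i
  inj := by
    refine Function.Injective.sumElim (fun k l h => ?_) (fun k l h => ?_) fun k l h => ?_
    · by_contra hkl
      exact (d.distinct k l hkl).1 h
    · by_contra hkl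
      exact (d.distinct k l fun h => hkl (Subtype.ext h)).1
        ((starRingEnd ℂ).injective (neg_injective h))
    -- A point equal to its own reflection would lie on the imaginary axis, which `OffAxis`
    -- excludes.
    · rcases eq_or_ne k l with rfl | hkl
      · have hre : (d.pole l).re = 0 := by
          have := congrArg Complex.re h
          simp at this
          linarith
        exact absurd ((d.re_eq_zero_iff _).1 hre) (not_lt.2 l.2)
      · exact (d.distinct k l hkl).2 h
  im_pos := by
    rintro (k | k)
    · exact d.im_pos k
    · simpa using d.im_pos k

@[simp] theorem poleData_pt_inl (k : Fin N) : d.poleData.pt (.inl k) = d.pole k := rfl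
@[simp] theorem poleData_pt_inr (k : OffAxis N N₁) :
    d.poleData.pt (.inr k) = -conj (d.pole k) := rfl
@[simp] theorem poleData_ord_inl (k : Fin N) : d.poleData.ord (.inl k) = d.m k := rfl
@[simp] theorem poleData_ord_inr (k : OffAxis N N₁) : d.poleData.ord (.inr k) = d.m k := rfl

theorem neg_conj_pole {k : Fin N} (hk : (k : ℕ) < N₁) : -conj (d.pole k) = d.pole k := by
  have := (d.re_eq_zero_iff k).2 hk
  apply Complex.ext <;> simp [this]

theorem neg_pole {k : Fin N} (hk : (k : ℕ) < N₁) : -d.pole k = conj (d.pole k) := by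
  simpa using congrArg conj (d.neg_conj_pole hk)

theorem range_pt : Set.range d.poleData.pt = d.upperPoles := by
  ext z
  constructor
  · rintro ⟨k | k, rfl⟩
    · exact ⟨k, .inl rfl⟩
    · exact ⟨k, .inr rfl⟩
  · rintro ⟨k, rfl | rfl⟩
    · exact ⟨.inl k, rfl⟩
    · rcases lt_or_ge (k : ℕ) N₁ with hk | hk
      · exact ⟨.inl k, (d.neg_conj_pole hk).symm⟩
      · exact ⟨.inr ⟨k, hk⟩, rfl⟩

theorem range_conj_pt : (Set.range fun k => conj (d.poleData.pt k)) = d.lowerPoles := by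
  have h1 : (Set.range fun k => conj (d.poleData.pt k)) = conj '' d.upperPoles := by
    rw [← range_pt, ← Set.range_comp]; rfl
  rw [h1]
  ext z
  constructor
  · rintro ⟨_, ⟨k, rfl | rfl⟩, rfl⟩
    · exact ⟨k, .inl rfl⟩
    · exact ⟨k, .inr (by simp)⟩
  · rintro ⟨k, rfl | rfl⟩
    · exact ⟨_, ⟨k, .inl rfl⟩, rfl⟩
    · exact ⟨_, ⟨k, .inr rfl⟩, by simp⟩

theorem notMem_upperPoles {z : ℂ} : z ∉ d.upperPoles ↔ ∀ k, z ≠ d.poleData.pt k := by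
  rw [← range_pt]
  simp [eq_comm]

theorem notMem_lowerPoles {z : ℂ} : z ∉ d.lowerPoles ↔ ∀ k, z ≠ conj (d.poleData.pt k) := by
  rw [← range_conj_pt, Set.mem_range]
  push Not
  exact forall_congr' fun k => ne_comm

/-- On the imaginary axis the residue constants are symmetric. -/
theorem vanishesTo_symm {k : Fin N} (hk : (k : ℕ) < N₁) (i : Fin n) :
    VanishesTo (fun z => (-1) ^ (d.m k + 1) * conj (d.fv (-conj z) i) - d.fv z i)
      (d.pole k) (d.m k + 1) := by
  have h1 : VanishesTo (fun z =>
      (Polynomial.C ((-1) ^ (d.m k + 1)) * d.fsharp i).eval z - (d.f i).eval z)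
      (d.pole k) (d.m k + 1) := by
    rw [VanishesTo.sub_iff_iteratedDeriv (analyticAt_eval _ _) (analyticAt_eval _ _)]
    intro j hj
    rw [iteratedDeriv_eval, iteratedDeriv_eval, Polynomial.iterate_derivative_C_mul, fsharp,
      iterate_derivative_comp_neg, conjPoly, Polynomial.iterate_derivative_map]
    have h2 := d.f_symm k hk (d.m k - j) (Nat.sub_le _ _) i
    have h3 : d.m k - (d.m k - j) = j := by omega
    rw [h3] at h2
    rw [h2]
    -- The first sign is that of `f_symm` at `r = m - j`, the second comes from differentiating `j`
    -- times through `z ↦ -z`.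
    have h4 : (-1 : ℂ) ^ (d.m k + 1) = (-1) ^ (d.m k - j + 1) * (-1) ^ j := by
      rw [← pow_add]; congr 1; omega
    have h5 : ((-1 : ℂ) ^ j) * (-1) ^ j = 1 := by rw [← mul_pow]; simp
    have h6 : ((Polynomial.derivative^[j] (d.f i)).map (starRingEnd ℂ)).eval (-(d.pole k))
        = conj ((Polynomial.derivative^[j] (d.f i)).eval (d.pole k)) := by
      have := eval_conjPoly (Polynomial.derivative^[j] (d.f i)) (-(d.pole k))
      rw [conjPoly, map_neg, d.neg_conj_pole hk] at this
      exact this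
    simp only [Polynomial.eval_mul, Polynomial.eval_C, Polynomial.eval_pow, Polynomial.eval_neg,
      Polynomial.eval_one, Polynomial.eval_comp, Polynomial.eval_X, h6, h4]
    linear_combination (-1) ^ (d.m k - j + 1) *
      conj ((Polynomial.derivative^[j] (d.f i)).eval (d.pole k)) * h5
  refine h1.congr' fun z => ?_
  simp [eval_fsharp, fv]

variable {d} {x t : ℝ} {c c' : Unit ⊕ Fin n → ℂ} {v w : Unit ⊕ Fin n → ℂ → ℂ}

theorem polar₁ (h : d.poleData.IsRow x t c v) (k : Fin N) :
    PolarRel (v (.inl ())) (fun z => exp (2 * I * phase x t z) * ∑ j, v (.inr j) z * d.fv z j)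
      (d.pole k) (d.m k) := h.polar_up (.inl k)

/-- Off the axis this is one of the defining conditions of the reduced data. On the axis the point
is `λ_k` itself, and the reflected constants have the same jet by `vanishesTo_symm`. -/
theorem polar₂ (h : d.poleData.IsRow x t c v) (k : Fin N) :
    PolarRel (v (.inl ())) (fun z => (-1) ^ (d.m k + 1) *
      (exp (2 * I * phase x t z) * ∑ j, v (.inr j) z * conj (d.fv (-conj z) j)))
      (-conj (d.pole k)) (d.m k) := by
  rcases lt_or_ge (k : ℕ) N₁ with hk | hk
  · rw [d.neg_conj_pole hk]
    refine (polar₁ h k).congr_vanishes ?_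
    have h1 := VanishesTo.sum Finset.univ fun j (_ : j ∈ Finset.univ) =>
      (d.vanishesTo_symm hk j).mul_left
        (h.analytic_right j (d.pole k) (PoleData.ne_conj_pt (d.im_pos k).le))
    refine (h1.mul_left (analyticAt_exp_phase (2 * I) x t _)).congr' fun z => ?_
    simp only [mul_sub, Finset.sum_sub_distrib, Finset.mul_sum]
    congr 1
    exact Finset.sum_congr rfl fun j _ => by ring
  · refine (h.polar_up (.inr ⟨k, hk⟩)).congr (Eventually.of_forall fun z => rfl)
      (Eventually.of_forall fun z => ?_)
    simp only [PoleData.upper, poleData, Sum.elim_inr, Polynomial.eval_mul, Polynomial.eval_C,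
      eval_fsharp, Finset.mul_sum]
    exact Finset.sum_congr rfl fun j _ => by ring

theorem polar₃ (h : d.poleData.IsRow x t c v) (k : Fin N) (j : Fin n) :
    PolarRel (v (.inr j))
      (fun z => -(exp (-2 * I * phase x t z) * v (.inl ()) z * conj (d.fv (conj z) j)))
      (conj (d.pole k)) (d.m k) := by
  refine (h.polar_low (.inl k) j).congr (Eventually.of_forall fun z => rfl)
      (Eventually.of_forall fun z => ?_)
  simp only [PoleData.lower, poleData, Sum.elim_inl, eval_conjPoly, fv]
  ring

theorem polar₄ (h : d.poleData.IsRow x t c v) (k : Fin N) (j : Fin n) :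
    PolarRel (v (.inr j)) (fun z => (-1) ^ d.m k *
      (exp (-2 * I * phase x t z) * v (.inl ()) z * d.fv (-z) j)) (-d.pole k) (d.m k) := by
  rcases lt_or_ge (k : ℕ) N₁ with hk | hk
  · rw [d.neg_pole hk]
    refine (polar₃ h k j).congr_vanishes ?_
    have h0 := VanishesTo.conj_conj (p := conj (d.pole k)) (f := fun z =>
      (-1) ^ (d.m k + 1) * conj (d.fv (-conj z) j) - d.fv z j) (N := d.m k + 1)
      (by rw [Complex.conj_conj]; exact d.vanishesTo_symm hk j)
    have hL : AnalyticAt ℂ (v (.inl ())) (conj (d.pole k)) :=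
      h.analytic_left _ (PoleData.conj_pt_ne_pt (D := d.poleData) (.inl k))
    have h1 := (h0.mul_left hL).mul_left (analyticAt_exp_phase (-2 * I) x t _)
    refine h1.neg.congr' fun z => ?_
    simp only [map_sub, map_mul, map_pow, map_neg, map_one, Complex.conj_conj]
    ring
  · have h1 := h.polar_low (.inr ⟨k, hk⟩) j
    have h2 : conj (d.poleData.pt (.inr ⟨k, hk⟩)) = -d.pole k := by simp
    rw [h2] at h1
    refine h1.congr (Eventually.of_forall fun z => rfl) (Eventually.of_forall fun z => ?_)
    have h3 : (conjPoly (d.poleData.g (.inr ⟨k, hk⟩) j)).eval z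
        = (-1) ^ (d.m k + 1) * d.fv (-z) j := by
      simp [poleData, conjPoly, fsharp, Polynomial.map_comp, Polynomial.map_map, fv,
        Polynomial.eval_comp]
    rw [PoleData.lower, h3]
    ring

theorem conj_exp_phase_neg (s : ℂ) (hs : conj s = -s) (x t : ℝ) (z : ℂ) :
    conj (exp (s * phase x t (-conj z))) = exp (s * phase x t z) := by
  rw [← Complex.exp_conj, map_mul, conj_phase, hs]
  congr 1
  simp [phase]
  ring

theorem tendsto_neg_conj_cobounded :
    Tendsto (fun z : ℂ => -conj z) (Bornology.cobounded ℂ) (Bornology.cobounded ℂ) := by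
  rw [← tendsto_norm_atTop_iff_cobounded]
  simpa using tendsto_norm_cobounded_atTop (E := ℂ)

theorem analyticAt_neg_conj {f : ℂ → ℂ} {p : ℂ} (h : AnalyticAt ℂ f (-conj p)) :
    AnalyticAt ℂ (fun z => conj (f (-conj z))) p := by
  refine analyticAt_conj_conj (f := fun z => f (-z)) ?_
  exact AnalyticAt.comp (g := f) (f := fun z => -z) h (by fun_prop)

theorem neg_conj_mem_upperPoles {z : ℂ} (h : -conj z ∈ d.upperPoles) : z ∈ d.upperPoles := by
  obtain ⟨k, hk | hk⟩ := h
  · exact ⟨k, .inr (by rw [← hk]; simp)⟩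
  · exact ⟨k, .inl ((starRingEnd ℂ).injective (neg_injective hk))⟩

theorem neg_conj_mem_lowerPoles {z : ℂ} (h : -conj z ∈ d.lowerPoles) : z ∈ d.lowerPoles := by
  obtain ⟨k, hk | hk⟩ := h
  · exact ⟨k, .inr (by simpa using congrArg (fun w => -conj w) hk)⟩
  · refine ⟨k, .inl ?_⟩
    rw [← neg_injective hk, Complex.conj_conj]

/-- The symmetry of rows under `z ↦ -conj z`. -/
theorem isRow_neg_conj (h : d.poleData.IsRow x t c v) :
    d.poleData.IsRow x t (fun j => conj (c j)) (fun j z => conj (v j (-conj z))) where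
  analytic_left z hz := analyticAt_neg_conj <| h.analytic_left _ <| d.notMem_upperPoles.1
    fun h => d.notMem_upperPoles.2 hz (neg_conj_mem_upperPoles h)
  analytic_right j z hz := analyticAt_neg_conj <| h.analytic_right j _ <| d.notMem_lowerPoles.1
    fun h => d.notMem_lowerPoles.2 hz (neg_conj_mem_lowerPoles h)
  tendsto j := (Complex.continuous_conj.tendsto _).comp
    ((h.tendsto j).comp tendsto_neg_conj_cobounded)
  polar_up := by
    have hI : conj (2 * I) = -(2 * I) := by simp [Complex.conj_ofNat]
    have hsq : ∀ m : ℕ, ((-1 : ℂ) ^ (m + 1)) * (-1) ^ (m + 1) = 1 := fun m => by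
      rw [← mul_pow]; simp
    rintro (k | k)
    -- The reflection exchanges the conditions at `λ_k` and `-conj λ_k`; the two signs `(-1)^(m+1)`
    -- multiply to one.
    · refine (polar₂ h k).conj_neg.congr (Eventually.of_forall fun z => rfl)
        (Eventually.of_forall fun z => ?_)
      simp only [PoleData.upper, poleData, Sum.elim_inl, map_mul, map_sum, map_pow, map_neg,
        map_one, Complex.conj_conj, conj_exp_phase_neg _ hI, neg_neg, fv]
      rw [← mul_assoc, hsq, one_mul]
    · have h1 := polar₁ h (k : Fin N)
      have h2 : d.pole k = -conj (-conj (d.pole k)) := by simp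
      rw [h2] at h1
      refine h1.conj_neg.congr (Eventually.of_forall fun z => rfl)
        (Eventually.of_forall fun z => ?_)
      simp only [PoleData.upper, poleData, Sum.elim_inr, Polynomial.eval_mul, Polynomial.eval_C,
        eval_fsharp, Finset.mul_sum, map_mul, map_sum, conj_exp_phase_neg _ hI]
      exact Finset.sum_congr rfl fun j _ => by ring
  polar_low := by
    have hI : conj (-2 * I) = -(-2 * I) := by simp [Complex.conj_ofNat]
    have hsq : ∀ m : ℕ, ((-1 : ℂ) ^ (m + 1)) * (-1) ^ m = -1 := fun m => by
      rw [pow_succ, mul_right_comm, ← mul_pow]; simp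
    rintro (k | k) j
    · have h1 := polar₄ h k j
      have h2 : -d.pole k = -conj (conj (d.pole k)) := by simp
      rw [h2] at h1
      refine h1.conj_neg.congr (Eventually.of_forall fun z => rfl)
        (Eventually.of_forall fun z => ?_)
      rw [PoleData.lower, eval_conjPoly]
      simp only [map_mul, conj_exp_phase_neg _ hI, map_pow, map_neg, map_one, neg_neg]
      have h3 : ∀ m : ℕ, ((-1 : ℂ) ^ (m + 1)) * (-1) ^ m = -1 := hsq
      simp only [poleData, Sum.elim_inl, fv, ← mul_assoc, hsq]
      ring
    · have h1 := polar₃ h (k : Fin N) j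
      have h2 : conj (d.pole k) = -conj (-(d.pole k)) := by simp
      rw [h2] at h1
      have h3 : conj (d.poleData.pt (.inr k)) = -d.pole k := by simp
      have h4 : ∀ z, (conjPoly (d.poleData.g (.inr k) j)).eval z
          = (-1) ^ (d.m k + 1) * d.fv (-z) j := fun z => by
        simp [poleData, conjPoly, fsharp, Polynomial.map_comp, Polynomial.map_map, fv,
          Polynomial.eval_comp]
      rw [h3]
      refine h1.conj_neg.congr (Eventually.of_forall fun z => rfl)
        (Eventually.of_forall fun z => ?_)
      rw [PoleData.lower, h4]
      rw [map_neg, map_mul, map_mul, conj_exp_phase_neg _ hI]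
      simp
      ring

theorem conj_one_row (i : Unit ⊕ Fin n) :
    (fun j => conj ((1 : BlockMat n) i j)) = (1 : BlockMat n) i := by
  ext j
  rw [Matrix.one_apply]
  split_ifs <;> simp

-- By uniqueness each row equals its reflection under `z ↦ -conj z`. In `z M_DL` the factor `z`
-- changes sign, so its limit `c` satisfies `c = -conj c`, and `-2i c` is real.
variable (d) in
theorem potential_real (x t : ℝ) (i : Fin n) :
    conj (d.poleData.potential x t i) = d.poleData.potential x t i := by
  have h1 := d.poleData.isRow_sol x t (.inr i)
  have h2 := isRow_neg_conj h1
  rw [conj_one_row] at h2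
  have h3 := PoleData.tendsto_mul_sol (D := d.poleData) x t (i := .inr i) (j := .inl ()) (by simp)
  set c := d.poleData.lcoef 1 x t (.inr i) (.inl ()) with hc
  have h4 := ((Complex.continuous_conj.tendsto _).comp (h3.comp tendsto_neg_conj_cobounded)).neg
  have h5 : c = -conj c := by
    refine tendsto_nhds_unique (h3.congr' ?_) h4
    filter_upwards [d.poleData.poles_finite.isBounded] with z hz
    have h6 := h1.eq_left h2 (PoleData.ne_of_notMem_poles hz).1
    simp only [Function.comp_apply, map_mul, map_neg, Complex.conj_conj]
    rw [h6]
    ring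
  have hI : conj (2 : ℂ) = 2 := Complex.conj_ofNat 2
  rw [PoleData.potential, ← hc, map_mul, map_mul, map_neg, hI, Complex.conj_I]
  linear_combination (2 * I) * h5

variable (d) in
theorem poles_eq : d.poleData.poles = d.upperPoles ∪ d.lowerPoles := by
  rw [PoleData.poles, range_pt, range_conj_pt]

variable (d) in
theorem exists_g_ne_zero (k : Fin N ⊕ OffAxis N N₁) :
    ∃ j, (d.poleData.g k j).eval (d.poleData.pt k) ≠ 0 := by
  have h : ∀ k : Fin N, ∃ j, (d.f j).eval (d.pole k) ≠ 0 := fun k => by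
    by_contra! hcon
    exact d.f_ne_zero k (funext hcon)
  rcases k with k | k
  · exact h k
  · obtain ⟨j, hj⟩ := h k
    refine ⟨j, ?_⟩
    simpa [poleData, eval_fsharp, fv] using hj

/-! ### The constructed matrix solves the Riemann-Hilbert problem -/

theorem leftCol_residue {G : ℂ → BlockMat n} {p : ℂ} {m r : ℕ} {ψ : Unit ⊕ Fin n → ℂ → ℂ}
    (hr : r ≤ m) (hψ : ∀ i, AnalyticAt ℂ (ψ i) p)
    (hL : ∀ i, PolarRel (fun z => G z i (.inl ())) (ψ i) p m)
    (hR : ∀ i j, AnalyticAt ℂ (fun z => G z i (.inr j)) p) :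
    HasMatResidue (fun z => (z - p) ^ r • G z) p
      (leftCol fun i => iteratedDeriv (m - r) (ψ i) p / (m - r)!) := by
  rintro i (j | j)
  · exact (hL i).hasResidue hr (hψ i)
  · have h := hR i j
    exact hasResidue_of_analyticAt (g := fun z => (z - p) ^ r * G z i (.inr j)) (by fun_prop)

theorem rightCols_residue {G : ℂ → BlockMat n} {p : ℂ} {m r : ℕ}
    {ψ : Unit ⊕ Fin n → Fin n → ℂ → ℂ}
    (hr : r ≤ m) (hψ : ∀ i j, AnalyticAt ℂ (ψ i j) p)
    (hR : ∀ i j, PolarRel (fun z => G z i (.inr j)) (ψ i j) p m)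
    (hL : ∀ i, AnalyticAt ℂ (fun z => G z i (.inl ())) p) :
    HasMatResidue (fun z => (z - p) ^ r • G z) p
      (rightCols fun i j => iteratedDeriv (m - r) (ψ i j) p / (m - r)!) := by
  rintro i (j | j)
  · have h := hL i
    exact hasResidue_of_analyticAt (g := fun z => (z - p) ^ r * G z i (.inl ())) (by fun_prop)
  · exact (hR i j).hasResidue hr (hψ i j)

theorem jumpMatrix_zero (x t s : ℝ) : jumpMatrix (0 : ℝ → Fin n → ℂ) x t s = 1 := by
  rw [jumpMatrix, ← Matrix.fromBlocks_one]
  congr 1 <;> ext <;> simp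

theorem analyticAt_conj_fv_conj (d : DiscreteData n N N₁) (j : Fin n) (p : ℂ) :
    AnalyticAt ℂ (fun z => conj (d.fv (conj z) j)) p := by
  simp only [fv, ← eval_conjPoly]
  exact analyticAt_eval _ _

theorem analyticAt_conj_fv_neg_conj (d : DiscreteData n N N₁) (j : Fin n) (p : ℂ) :
    AnalyticAt ℂ (fun z => conj (d.fv (-conj z) j)) p := by
  simp only [← eval_fsharp]
  exact analyticAt_eval _ _

theorem analyticAt_fv_neg (d : DiscreteData n N N₁) (j : Fin n) (p : ℂ) :
    AnalyticAt ℂ (fun z => d.fv (-z) j) p :=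
  AnalyticAt.comp (g := fun z => d.fv z j) (f := fun z => -z) (analyticAt_eval _ _) (by fun_prop)

theorem iteratedDeriv_neg_one_pow_mul (m k : ℕ) (f : ℂ → ℂ) (z : ℂ) :
    iteratedDeriv k (fun z => (-1) ^ m * f z) z = (-1) ^ m * iteratedDeriv k f z := by
  have := iteratedDeriv_const_smul_field (n := k) ((-1 : ℂ) ^ m) f (x := z)
  exact this

theorem mul_div_neg_one_pow (m : ℕ) (a b : ℂ) : a / ((-1) ^ m * b) = (-1) ^ m * a / b := by
  have h : ((-1 : ℂ) ^ m) * (-1) ^ m = 1 := by rw [← mul_pow]; simp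
  have h0 : ((-1 : ℂ) ^ m) ≠ 0 := left_ne_zero_of_mul_eq_one h
  rw [div_mul_eq_div_div, div_eq_iff h0 |>.2 (show a = (-1) ^ m * a * (-1) ^ m by
    rw [mul_right_comm, h, one_mul])]

variable (d) in
theorem isRHSolution_sol (x t : ℝ) : d.IsRHSolution 0 x t (d.poleData.sol x t) := by
  have hrow := fun i => d.poleData.isRow_sol x t i
  have hcont : ∀ z ∉ d.poleData.poles, ContinuousAt (d.poleData.sol x t) z := fun z hz =>
    continuousAt_pi.2 fun i => continuousAt_pi.2 fun j => ((hrow i).analyticAt hz j).continuousAt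
  have hL : ∀ i, ∀ z ∉ d.upperPoles, AnalyticAt ℂ (fun w => d.poleData.sol x t w i (.inl ())) z :=
    fun i z hz => (hrow i).analytic_left z (d.notMem_upperPoles.1 hz)
  have hR : ∀ i j, ∀ z ∉ d.lowerPoles,
      AnalyticAt ℂ (fun w => d.poleData.sol x t w i (.inr j)) z :=
    fun i j z hz => (hrow i).analytic_right j z (d.notMem_lowerPoles.1 hz)
  have hup : ∀ z ∈ d.upperPoles, 0 < z.im := by
    rintro z ⟨k, rfl | rfl⟩ <;> simpa using d.im_pos k
  have hlow : ∀ z ∈ d.lowerPoles, z.im < 0 := by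
    rintro z ⟨k, rfl | rfl⟩ <;> simpa using d.im_pos k
  have hdis : ∀ z ∈ d.upperPoles, z ∉ d.lowerPoles := fun z h h' =>
    lt_asymm (hup z h) (hlow z h')
  refine ⟨?_, ?_, ?_, ?_, ?_, ?_, ?_, ?_, ?_, ?_⟩
  · intro z hz i j
    refine (hrow i).analyticAt ?_ j
    rw [poles_eq]
    exact fun h => h.elim hz.2.1 hz.2.2
  · exact fun z hz i j => hR i j z (hdis z hz)
  · exact fun z hz i => hL i z fun h => hdis z h hz
  · refine Tendsto.mono_left ?_ inf_le_left
    exact tendsto_pi_nhds.2 fun i => tendsto_pi_nhds.2 fun j => (hrow i).tendsto j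
  -- No pole is real, so the values on the line serve as both boundary values.
  · refine ⟨fun s => d.poleData.sol x t s, fun s => d.poleData.sol x t s, fun s => ?_, fun s => ?_,
      fun s => by rw [jumpMatrix_zero, mul_one]⟩
    · exact (hcont s (PoleData.real_notMem_poles s)).tendsto.mono_left nhdsWithin_le_nhds
    · exact (hcont s (PoleData.real_notMem_poles s)).tendsto.mono_left nhdsWithin_le_nhds
  · intro k
    have h1 := PoleData.hasMatPole_pt x t (d.exists_g_ne_zero (.inl k))
    have h3 := PoleData.hasMatPole_conj_pt x t (d.exists_g_ne_zero (.inl k))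
    refine ⟨h1, ?_, h3, ?_⟩
    · rcases lt_or_ge (k : ℕ) N₁ with hk | hk
      · rw [d.neg_conj_pole hk]; exact h1
      · exact PoleData.hasMatPole_pt x t (d.exists_g_ne_zero (.inr ⟨k, hk⟩))
    · rcases lt_or_ge (k : ℕ) N₁ with hk | hk
      · rw [d.neg_pole hk]; exact h3
      · have := PoleData.hasMatPole_conj_pt x t (d.exists_g_ne_zero (.inr ⟨k, hk⟩))
        simpa using this
  · intro k r hr
    have hk : d.pole k ∈ d.upperPoles := ⟨k, .inl rfl⟩
    refine leftCol_residue hr (fun i => ?_) (fun i => polar₁ (hrow i) k)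
      fun i j => hR i j _ (hdis _ hk)
    exact (analyticAt_exp_phase _ _ _ _).fun_mul (Finset.analyticAt_fun_sum _ fun j _ =>
      (hR i j _ (hdis _ hk)).mul (analyticAt_eval _ _))
  · intro k r hr
    have hk : -conj (d.pole k) ∈ d.upperPoles := ⟨k, .inr rfl⟩
    have h := leftCol_residue hr (fun i => ?_) (fun i => polar₂ (hrow i) k)
      fun i j => hR i j _ (hdis _ hk)
    · simp only [iteratedDeriv_neg_one_pow_mul, ← mul_div_neg_one_pow, sub_neg_eq_add] at h
      exact h
    · exact analyticAt_const.fun_mul ((analyticAt_exp_phase _ _ _ _).fun_mul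
        (Finset.analyticAt_fun_sum _ fun j _ =>
          (hR i j _ (hdis _ hk)).mul (d.analyticAt_conj_fv_neg_conj j _)))
  · intro k r hr
    have hk : conj (d.pole k) ∈ d.lowerPoles := ⟨k, .inl rfl⟩
    have hk' : conj (d.pole k) ∉ d.upperPoles := fun h => hdis _ h hk
    have h := rightCols_residue hr (fun i j => ?_) (fun i j => polar₃ (hrow i) k j)
      fun i => hL i _ hk'
    · simp only [iteratedDeriv_fun_neg] at h
      exact h
    · exact (((analyticAt_exp_phase _ _ _ _).fun_mul (hL i _ hk')).fun_mul
        (d.analyticAt_conj_fv_conj j _)).fun_neg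
  · intro k r hr
    have hk : -d.pole k ∈ d.lowerPoles := ⟨k, .inr rfl⟩
    have hk' : -d.pole k ∉ d.upperPoles := fun h => hdis _ h hk
    have h := rightCols_residue hr (fun i j => ?_) (fun i j => polar₄ (hrow i) k j)
      fun i => hL i _ hk'
    · simp only [iteratedDeriv_neg_one_pow_mul, ← mul_div_neg_one_pow, sub_neg_eq_add] at h
      exact h
    · exact analyticAt_const.fun_mul (((analyticAt_exp_phase _ _ _ _).fun_mul (hL i _ hk')).fun_mul
        (d.analyticAt_fv_neg j _))

end DiscreteData

/-! ### Arbitrary solutions: continuation across the real line and uniqueness -/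

/-- Morera's theorem: a function which is continuous on an open set and holomorphic off the real
line is holomorphic. -/
theorem differentiableOn_of_off_real {f : ℂ → ℂ} {U : Set ℂ} (hU : IsOpen U)
    (hc : ContinuousOn f U) (hd : ∀ z ∈ U, z.im ≠ 0 → DifferentiableAt ℂ f z) :
    DifferentiableOn ℂ f U := by
  refine (isConservativeOn_and_continuousOn_iff_isDifferentiableOn hU).1 ⟨fun z w hzw => ?_, hc⟩
  rw [← add_eq_zero_iff_eq_neg, wedgeIntegral_add_wedgeIntegral_eq]
  have hzw : Set.uIcc z.re w.re ×ℂ Set.uIcc z.im w.im ⊆ U := hzw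
  -- For a rectangle whose interior misses the real line, Cauchy's theorem needs only continuity up
  -- to the boundary. Any other rectangle is cut along the real line into two of this kind.
  have key : ∀ c d : ℝ, Set.uIcc c d ⊆ Set.uIcc z.im w.im → (0 : ℝ) ∉ Set.Ioo (min c d) (max c d) →
      (∫ x : ℝ in z.re..w.re, f (x + c * I)) - (∫ x : ℝ in z.re..w.re, f (x + d * I)) +
      I • (∫ y : ℝ in c..d, f (w.re + y * I)) - I • (∫ y : ℝ in c..d, f (z.re + y * I)) = 0 := by
    intro c d hcd h0
    have hsub : Set.uIcc z.re w.re ×ℂ Set.uIcc c d ⊆ U := fun u hu => hzw ⟨hu.1, hcd hu.2⟩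
    have := integral_boundary_rect_eq_zero_of_continuousOn_of_differentiableOn f
      (⟨z.re, c⟩ : ℂ) ⟨w.re, d⟩ (hc.mono hsub) fun u hu => by
        have hu1 : u.re ∈ Set.uIcc z.re w.re := Set.Ioo_subset_Icc_self hu.1
        have hu2 : u.im ∈ Set.uIcc c d := Set.Ioo_subset_Icc_self hu.2
        exact (hd u (hsub ⟨hu1, hu2⟩) fun h => h0 (h ▸ hu.2)).differentiableWithinAt
    exact this
  by_cases h0 : (0 : ℝ) ∈ Set.Ioo (min z.im w.im) (max z.im w.im)
  · have h0' : (0 : ℝ) ∈ Set.uIcc z.im w.im := Set.Ioo_subset_Icc_self h0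
    have hs1 : Set.uIcc z.im 0 ⊆ Set.uIcc z.im w.im := Set.uIcc_subset_uIcc Set.left_mem_uIcc h0'
    have hs2 : Set.uIcc 0 w.im ⊆ Set.uIcc z.im w.im := Set.uIcc_subset_uIcc h0' Set.right_mem_uIcc
    have hint : ∀ a ∈ Set.uIcc z.re w.re, ∀ c d : ℝ, Set.uIcc c d ⊆ Set.uIcc z.im w.im →
        IntervalIntegrable (fun y : ℝ => f (a + y * I)) MeasureTheory.volume c d := by
      intro a ha c d hcd
      refine ContinuousOn.intervalIntegrable (hc.comp (by fun_prop) fun y hy => hzw ⟨?_, ?_⟩)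
      · simpa using ha
      · simpa using hcd hy
    have h1 := key z.im 0 hs1 (by simpa using le_of_lt)
    have h2 := key 0 w.im hs2 (by simpa using le_of_lt)
    rw [← intervalIntegral.integral_add_adjacent_intervals
      (hint w.re Set.right_mem_uIcc z.im 0 hs1) (hint w.re Set.right_mem_uIcc 0 w.im hs2),
      ← intervalIntegral.integral_add_adjacent_intervals
      (hint z.re Set.left_mem_uIcc z.im 0 hs1) (hint z.re Set.left_mem_uIcc 0 w.im hs2)]
    simp only [smul_add]
    linear_combination h1 + h2
  · exact key z.im w.im subset_rfl h0

theorem neBot_nhdsWithin_off_real (s : ℝ) : (𝓝[{z : ℂ | z.im ≠ 0}] (s : ℂ)).NeBot := by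
  refine mem_closure_iff_nhdsWithin_neBot.1 (Metric.mem_closure_iff.2 fun e he =>
    ⟨s + (e / 2 : ℝ) * I, by simpa using he.ne', ?_⟩)
  simp [abs_of_pos he]
  linarith

/-- Limits along the two open half planes, continuous off the real line, give continuity of the
extension by the boundary values. -/
theorem continuousAt_extension {f : ℂ → ℂ} {B : ℝ → ℂ}
    (h : ∀ s : ℝ, Tendsto f (𝓝[{z | z.im ≠ 0}] (s : ℂ)) (𝓝 (B s))) (s : ℝ) :
    ContinuousAt (fun z => if z.im = 0 then B z.re else f z) s := by
  set F : ℂ → ℂ := fun z => if z.im = 0 then B z.re else f z with hF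
  have hFs : F s = B s := by simp [hF]
  have hreal : ∀ s : ℝ, Tendsto f (𝓝[{z | z.im ≠ 0}] (s : ℂ)) (𝓝 (F s)) := fun s => by
    have : F s = B s := by simp [hF]
    rw [this]; exact h s
  rw [Metric.continuousAt_iff]
  intro ε hε
  have h1 := (Metric.tendsto_nhds.1 (hreal s)) (ε / 2) (half_pos hε)
  rw [eventually_nhdsWithin_iff, Metric.eventually_nhds_iff] at h1
  obtain ⟨δ, hδ, h1⟩ := h1
  refine ⟨δ, hδ, fun z hz => ?_⟩
  by_cases hz0 : z.im = 0
  · have hzr : z = (z.re : ℂ) := by apply Complex.ext <;> simp [hz0]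
    have h2 := hreal z.re
    have hne := neBot_nhdsWithin_off_real z.re
    have h3 : ∀ᶠ w in 𝓝[{z : ℂ | z.im ≠ 0}] (z.re : ℂ), dist (f w) (F s) ≤ ε / 2 := by
      have : ∀ᶠ w in 𝓝 (z.re : ℂ), dist w (s : ℂ) < δ := by
        rw [← hzr]
        exact (Metric.isOpen_ball (x := (s : ℂ)) (ε := δ)).mem_nhds hz
      filter_upwards [self_mem_nhdsWithin, this.filter_mono nhdsWithin_le_nhds] with w hw hw'
      exact (h1 hw' hw).le
    have h4 : dist (F z.re) (F s) ≤ ε / 2 := le_of_tendsto (h2.dist tendsto_const_nhds) h3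
    rw [← hzr] at h4
    linarith
  · have h2 : F z = f z := if_neg hz0
    have := h1 hz hz0
    rw [h2]
    linarith

/-- Values off the real line control the limit at infinity of a continuous extension. -/
theorem tendsto_cobounded_extension {f F : ℂ → ℂ} {c : ℂ}
    (hF : ∀ z, z.im ≠ 0 → F z = f z) (hc : ∀ s : ℝ, ContinuousAt F s)
    (h : Tendsto f (Bornology.cobounded ℂ ⊓ 𝓟 {z | z.im ≠ 0}) (𝓝 c)) :
    Tendsto F (Bornology.cobounded ℂ) (𝓝 c) := by
  rw [Metric.tendsto_nhds]
  intro ε hε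
  have h1 := Metric.tendsto_nhds.1 h (ε / 2) (half_pos hε)
  rw [eventually_inf_principal, ← comap_norm_atTop, eventually_comap, eventually_atTop] at h1
  obtain ⟨R, hR⟩ := h1
  rw [← comap_norm_atTop, eventually_comap, eventually_atTop]
  refine ⟨R + 1, fun b hb z hz => ?_⟩
  by_cases hz0 : z.im = 0
  · have hzr : z = (z.re : ℂ) := by apply Complex.ext <;> simp [hz0]
    have hne := neBot_nhdsWithin_off_real z.re
    have h2 : Tendsto F (𝓝[{z : ℂ | z.im ≠ 0}] (z.re : ℂ)) (𝓝 (F z)) := by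
      have := (hc z.re).tendsto.mono_left (nhdsWithin_le_nhds (s := {z : ℂ | z.im ≠ 0}))
      rwa [← hzr] at this ⊢
    have h3 : ∀ᶠ w in 𝓝[{z : ℂ | z.im ≠ 0}] (z.re : ℂ), dist (F w) c ≤ ε / 2 := by
      have : ∀ᶠ w in 𝓝 (z.re : ℂ), R < ‖w‖ := by
        rw [← hzr]
        exact (continuous_norm.tendsto z).eventually (lt_mem_nhds (by linarith))
      filter_upwards [self_mem_nhdsWithin, this.filter_mono nhdsWithin_le_nhds] with w hw hw'
      rw [hF w hw]
      exact (hR _ hw'.le w rfl hw).le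
    have h4 := le_of_tendsto (h2.dist tendsto_const_nhds) h3
    linarith
  · rw [hF z hz0]
    exact (hR b (by linarith) z hz hz0).trans (by linarith)

namespace DiscreteData

variable {n N N₁ : ℕ} {d : DiscreteData n N N₁} {x t : ℝ} {M : ℂ → BlockMat n}

theorem polarRel_leftCol {p : ℂ} {m : ℕ} {G : ℂ → BlockMat n} {ψ : Unit ⊕ Fin n → ℂ → ℂ}
    (hG : HasMatPole G p (m + 1)) (hψ : ∀ i, AnalyticAt ℂ (ψ i) p)
    (h : ∀ r ≤ m, HasMatResidue (fun z => (z - p) ^ r • G z) p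
      (leftCol fun i => iteratedDeriv (m - r) (ψ i) p / (m - r)!)) (i : Unit ⊕ Fin n) :
    PolarRel (fun z => G z i (.inl ())) (ψ i) p m :=
  polarRel_of_hasResidue (hG.1 i _) (hG.2.1 i _) (hψ i) fun r hr => h r hr i (.inl ())

theorem polarRel_rightCols {p : ℂ} {m : ℕ} {G : ℂ → BlockMat n}
    {ψ : Unit ⊕ Fin n → Fin n → ℂ → ℂ}
    (hG : HasMatPole G p (m + 1)) (hψ : ∀ i j, AnalyticAt ℂ (ψ i j) p)
    (h : ∀ r ≤ m, HasMatResidue (fun z => (z - p) ^ r • G z) p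
      (rightCols fun i j => iteratedDeriv (m - r) (ψ i j) p / (m - r)!)) (i : Unit ⊕ Fin n)
    (j : Fin n) : PolarRel (fun z => G z i (.inr j)) (ψ i j) p m :=
  polarRel_of_hasResidue (hG.1 i _) (hG.2.1 i _) (hψ i j) fun r hr => h r hr i (.inr j)

theorem im_pos_of_mem {z : ℂ} (hz : z ∈ d.upperPoles) : 0 < z.im := by
  obtain ⟨k, rfl | rfl⟩ := hz <;> simpa using d.im_pos k

theorem im_neg_of_mem {z : ℂ} (hz : z ∈ d.lowerPoles) : z.im < 0 := by
  obtain ⟨k, rfl | rfl⟩ := hz <;> simpa using d.im_pos k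

/-- Every solution of the reflectionless Riemann-Hilbert problem agrees off the real line with a
matrix function whose rows satisfy `IsRow`. -/
theorem IsRHSolution.exists_isRow (h : d.IsRHSolution 0 x t M) :
    ∃ M' : ℂ → BlockMat n, (∀ z : ℂ, z.im ≠ 0 → M' z = M z) ∧
      ∀ i, d.poleData.IsRow x t ((1 : BlockMat n) i) (fun j z => M' z i j) := by
  obtain ⟨B, B', hB, hB', hBB⟩ := h.jump
  have hBB' : B = B' := funext fun s => by rw [hBB s, jumpMatrix_zero, mul_one]
  subst hBB'
  -- The problem says nothing about the values of `M` on the real line itself, so they are replaced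
  -- by the common boundary values.
  set M' : ℂ → BlockMat n := fun z => if z.im = 0 then B z.re else M z with hM'
  have hoff : ∀ z : ℂ, z.im ≠ 0 → M' z = M z := fun z hz => if_neg hz
  have hoff' : ∀ z : ℂ, z.im ≠ 0 → ∀ᶠ w in 𝓝 z, M' w = M w := fun z hz => by
    filter_upwards [Complex.continuous_im.continuousAt.eventually_ne hz] with w hw using hoff w hw
  have hcont : ∀ (s : ℝ) i j, ContinuousAt (fun z => M' z i j) s := by
    intro s i j
    have h1 : ∀ s : ℝ, Tendsto (fun z => M z i j) (𝓝[{z | z.im ≠ 0}] (s : ℂ)) (𝓝 (B s i j)) := by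
      intro s
      have hset : {z : ℂ | z.im ≠ 0} = {z | 0 < z.im} ∪ {z | z.im < 0} := by
        ext z; simp [lt_or_lt_iff_ne, or_comm]
      rw [hset, nhdsWithin_union]
      exact (tendsto_pi_nhds.1 (tendsto_pi_nhds.1 (hB s) i) j).sup
        (tendsto_pi_nhds.1 (tendsto_pi_nhds.1 (hB' s) i) j)
    refine (continuousAt_extension h1 s).congr (Eventually.of_forall fun z => ?_)
    simp only [hM']
    split_ifs <;> rfl
  have hanM : ∀ z : ℂ, z.im ≠ 0 → ∀ i j, AnalyticAt ℂ (fun w => M w i j) z →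
      AnalyticAt ℂ (fun w => M' w i j) z := fun z hz i j ha => ha.congr (by
    filter_upwards [hoff' z hz] with w hw using by rw [hw])
  have hdom : ∀ z ∉ d.poleData.poles, ∀ i j, AnalyticAt ℂ (fun w => M' w i j) z := by
    intro z hz i j
    have hdiff : DifferentiableOn ℂ (fun w => M' w i j) (d.poleData.poles)ᶜ := by
      have hd : ∀ w ∈ (d.poleData.poles)ᶜ, w.im ≠ 0 → AnalyticAt ℂ (fun w => M' w i j) w := by
        intro w hw hw0
        refine hanM w hw0 i j (h.analytic w ⟨hw0, fun h => hw ?_, fun h => hw ?_⟩ i j)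
        · rw [poles_eq]; exact .inl h
        · rw [poles_eq]; exact .inr h
      refine differentiableOn_of_off_real d.poleData.poles_finite.isClosed.isOpen_compl
        (fun w hw => ContinuousAt.continuousWithinAt ?_) fun w hw hw0 => (hd w hw hw0).differentiableAt
      by_cases hw0 : w.im = 0
      · have hwr : w = (w.re : ℂ) := by apply Complex.ext <;> simp [hw0]
        rw [hwr]; exact hcont _ i j
      · exact (hd w hw hw0).continuousAt
    exact hdiff.analyticAt (d.poleData.poles_finite.isClosed.isOpen_compl.mem_nhds hz)
  have hR : ∀ z ∉ d.lowerPoles, ∀ i (j : Fin n), AnalyticAt ℂ (fun w => M' w i (.inr j)) z := by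
    intro z hz i j
    by_cases hu : z ∈ d.upperPoles
    · exact hanM z (im_pos_of_mem hu).ne' _ _ (h.analytic_right z hu i j)
    · exact hdom z (by rw [poles_eq]; exact fun h => h.elim hu hz) i _
  have hL : ∀ z ∉ d.upperPoles, ∀ i, AnalyticAt ℂ (fun w => M' w i (.inl ())) z := by
    intro z hz i
    by_cases hu : z ∈ d.lowerPoles
    · exact hanM z (im_neg_of_mem hu).ne _ _ (h.analytic_left z hu i)
    · exact hdom z (by rw [poles_eq]; exact fun h => h.elim hz hu) i _
  refine ⟨M', hoff, fun i => ⟨?_, ?_, ?_, ?_, ?_⟩⟩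
  · exact fun z hz => hL z (d.notMem_upperPoles.2 hz) i
  · exact fun j z hz => hR z (d.notMem_lowerPoles.2 hz) i j
  · intro j
    refine tendsto_cobounded_extension (f := fun z => M z i j) (fun z hz => by rw [hoff z hz])
      (fun s => hcont s i j) ?_
    exact tendsto_pi_nhds.1 (tendsto_pi_nhds.1 h.normalization i) j
  · have hup : ∀ p ∈ d.upperPoles, ∀ᶠ z in 𝓝[≠] p, M' z = M z := fun p hp =>
      (hoff' p (im_pos_of_mem hp).ne').filter_mono nhdsWithin_le_nhds
    have hRM : ∀ p ∈ d.upperPoles, ∀ i (j : Fin n), AnalyticAt ℂ (fun z => M z i (.inr j)) p :=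
      h.analytic_right
    rintro (k | k)
    · have hp : d.pole k ∈ d.upperPoles := ⟨k, .inl rfl⟩
      have h1 := polarRel_leftCol (h.poles k).1 (fun i =>
        (analyticAt_exp_phase (2 * I) x t _).fun_mul (Finset.analyticAt_fun_sum Finset.univ
          fun j _ => (hRM _ hp i j).fun_mul (analyticAt_eval (d.f j) _))) (h.residue₁ k) i
      refine h1.congr ?_ ?_
      · filter_upwards [hup _ hp] with z hz using by rw [hz]
      · filter_upwards [hup _ hp] with z hz
        simp only [PoleData.upper, hz]
        rfl
    · have hp : -conj (d.pole k) ∈ d.upperPoles := ⟨k, .inr rfl⟩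
      have h0 := h.residue₂ k
      simp only [mul_div_neg_one_pow, ← iteratedDeriv_neg_one_pow_mul] at h0
      have h1 := polarRel_leftCol (h.poles k).2.1 (fun i =>
        analyticAt_const.fun_mul ((analyticAt_exp_phase (2 * I) x t _).fun_mul
          (Finset.analyticAt_fun_sum Finset.univ
          fun j _ => (hRM _ hp i j).fun_mul (d.analyticAt_conj_fv_neg_conj j _))))
          (by simpa only [sub_neg_eq_add] using h0) i
      refine h1.congr ?_ ?_
      · filter_upwards [hup _ hp] with z hz using by rw [hz]
      · filter_upwards [hup _ hp] with z hz
        simp only [PoleData.upper, hz, poleData, Sum.elim_inr, Polynomial.eval_mul,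
          Polynomial.eval_C, eval_fsharp, Finset.mul_sum]
        exact Finset.sum_congr rfl fun j _ => by ring
  · have hlow : ∀ p ∈ d.lowerPoles, ∀ᶠ z in 𝓝[≠] p, M' z = M z := fun p hp =>
      (hoff' p (im_neg_of_mem hp).ne).filter_mono nhdsWithin_le_nhds
    have hLM : ∀ p ∈ d.lowerPoles, ∀ i, AnalyticAt ℂ (fun z => M z i (.inl ())) p :=
      h.analytic_left
    rintro (k | k) j
    · have hp : conj (d.pole k) ∈ d.lowerPoles := ⟨k, .inl rfl⟩
      have h0 := h.residue₃ k
      simp only [← iteratedDeriv_fun_neg] at h0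
      have h1 := polarRel_rightCols (h.poles k).2.2.1 (fun i j =>
        (((analyticAt_exp_phase (-2 * I) x t _).fun_mul (hLM _ hp i)).fun_mul
          (d.analyticAt_conj_fv_conj j _)).fun_neg) h0 i j
      refine h1.congr ?_ ?_
      · filter_upwards [hlow _ hp] with z hz using by rw [hz]
      · filter_upwards [hlow _ hp] with z hz
        simp only [PoleData.lower, hz, poleData, Sum.elim_inl, eval_conjPoly, fv]
        ring
    · have hp : -d.pole k ∈ d.lowerPoles := ⟨k, .inr rfl⟩
      have h0 := h.residue₄ k
      simp only [mul_div_neg_one_pow, ← iteratedDeriv_neg_one_pow_mul] at h0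
      have h1 := polarRel_rightCols (h.poles k).2.2.2 (fun i j =>
        analyticAt_const.fun_mul (((analyticAt_exp_phase (-2 * I) x t _).fun_mul
          (hLM _ hp i)).fun_mul (d.analyticAt_fv_neg j _)))
          (by simpa only [sub_neg_eq_add] using h0) i j
      have h2 : conj (d.poleData.pt (.inr k)) = -d.pole k := by simp
      have h4 : ∀ z, (conjPoly (d.poleData.g (.inr k) j)).eval z
          = (-1) ^ (d.m k + 1) * d.fv (-z) j := fun z => by
        simp [poleData, conjPoly, fsharp, Polynomial.map_comp, Polynomial.map_map, fv,
          Polynomial.eval_comp]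
      rw [h2]
      refine h1.congr ?_ ?_
      · filter_upwards [hlow _ hp] with z hz using by rw [hz]
      · filter_upwards [hlow _ hp] with z hz
        simp only [PoleData.lower, hz, h4]
        ring

/-- Solutions of the Riemann-Hilbert problem coincide with the constructed one. -/
theorem IsRHSolution.eq_sol_left (h : d.IsRHSolution 0 x t M) {z : ℂ} (hz : z.im ≠ 0)
    (hz' : z ∉ d.upperPoles) (i : Unit ⊕ Fin n) :
    M z i (.inl ()) = d.poleData.sol x t z i (.inl ()) := by
  obtain ⟨M', h1, h2⟩ := h.exists_isRow
  rw [← h1 z hz]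
  exact (h2 i).eq_left (d.poleData.isRow_sol x t i) (d.notMem_upperPoles.1 hz')

theorem IsRHSolution.eq_sol_right (h : d.IsRHSolution 0 x t M) {z : ℂ} (hz : z.im ≠ 0)
    (hz' : z ∉ d.lowerPoles) (i : Unit ⊕ Fin n) (j : Fin n) :
    M z i (.inr j) = d.poleData.sol x t z i (.inr j) := by
  obtain ⟨M', h1, h2⟩ := h.exists_isRow
  rw [← h1 z hz]
  exact (h2 i).eq_right (d.poleData.isRow_sol x t i) (d.notMem_lowerPoles.1 hz') j

theorem IsRHSolution.eq_sol (h : d.IsRHSolution 0 x t M) {z : ℂ} (hz : z ∈ d.domain) :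
    M z = d.poleData.sol x t z := by
  ext i j
  rcases j with _ | j
  · exact h.eq_sol_left hz.1 hz.2.1 i
  · exact h.eq_sol_right hz.1 hz.2.2 i j

theorem IsRHSolution.reconstructs (h : d.IsRHSolution 0 x t M) :
    Reconstructs M fun i => (d.poleData.potential x t i).re := by
  refine tendsto_pi_nhds.2 fun i => ?_
  rw [Complex.conj_eq_iff_re.1 (d.potential_real x t i)]
  have h1 := (PoleData.tendsto_mul_sol (D := d.poleData) x t (i := .inr i) (j := .inl ())
    (by simp)).const_mul (-2 * I)
  refine (h1.mono_left inf_le_left).congr' ?_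
  rw [Filter.EventuallyEq, eventually_inf_principal]
  filter_upwards [d.poleData.poles_finite.isBounded] with z hz hz0
  have hz' : z ∉ d.poleData.poles := hz
  rw [poles_eq] at hz'
  rw [h.eq_sol_left hz0 fun h => hz' (.inl h)]

end DiscreteData

/-! ### Mixed Taylor coefficients as iterated principal parts -/

theorem analyticAt_pi {n : ℕ} {V : ℂ → Fin n → ℂ} {p : ℂ}
    (h : ∀ i, AnalyticAt ℂ (fun z => V z i) p) : AnalyticAt ℂ V p := by
  rw [show V = fun z => ∑ i, V z i • (Pi.single i (1 : ℂ) : Fin n → ℂ) by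
    ext z i; simp [Finset.sum_apply, Pi.single_apply]]
  exact Finset.analyticAt_fun_sum _ fun i _ => (h i).fun_smul analyticAt_const

theorem iteratedDeriv_apply_pi {n : ℕ} {V : ℂ → Fin n → ℂ} {p : ℂ}
    (h : ∀ i, AnalyticAt ℂ (fun z => V z i) p) (j : ℕ) (i : Fin n) :
    iteratedDeriv j V p i = iteratedDeriv j (fun z => V z i) p := by
  have h1 : ContDiffAt ℂ j V p := (analyticAt_pi h).contDiffAt
  let L : (Fin n → ℂ) →L[ℂ] ℂ := ContinuousLinearMap.proj i
  have h2 := L.iteratedFDeriv_comp_left h1 le_rfl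
  rw [iteratedDeriv_eq_iteratedFDeriv, iteratedDeriv_eq_iteratedFDeriv]
  have h3 := congrArg (fun A => A fun _ => (1 : ℂ)) h2
  exact h3.symm

theorem iteratedDeriv_finset_sum {ι : Type*} (s : Finset ι) {F : ι → ℂ → ℂ} {p : ℂ}
    (h : ∀ i ∈ s, AnalyticAt ℂ (F i) p) (j : ℕ) :
    iteratedDeriv j (fun z => ∑ i ∈ s, F i z) p = ∑ i ∈ s, iteratedDeriv j (F i) p := by
  classical
  induction s using Finset.induction_on with
  | empty => simp
  | insert a s ha ih =>
    simp only [Finset.sum_insert ha]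
    rw [iteratedDeriv_fun_add (h a (by simp)).contDiffAt
      (Finset.analyticAt_fun_sum _ fun i hi => h i (by simp [hi])).contDiffAt,
      ih fun i hi => h i (by simp [hi])]

theorem principalPart_sum {ι : Type*} (s : Finset ι) {F : ι → ℂ → ℂ} {p : ℂ}
    (h : ∀ i ∈ s, AnalyticAt ℂ (F i) p) (m : ℕ) (z : ℂ) :
    principalPart (fun z => ∑ i ∈ s, F i z) p m z = ∑ i ∈ s, principalPart (F i) p m z := by
  unfold principalPart
  simp only [iteratedDeriv_finset_sum s h, Finset.sum_div]
  exact Finset.sum_comm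

theorem principalPart_const_mul (c : ℂ) (ψ : ℂ → ℂ) (p : ℂ) (m : ℕ) (z : ℂ) :
    principalPart (fun z => c * ψ z) p m z = c * principalPart ψ p m z := by
  unfold principalPart
  simp only [iteratedDeriv_const_mul_field, Finset.mul_sum]
  exact Finset.sum_congr rfl fun i _ => by ring

theorem principalPart_congr_nhds {ψ χ : ℂ → ℂ} {p : ℂ} {m : ℕ} (h : ψ =ᶠ[𝓝 p] χ) (z : ℂ) :
    principalPart ψ p m z = principalPart χ p m z :=
  principalPart_congr (fun i _ => h.iteratedDeriv_eq i) z

namespace DiscreteData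

variable {n : ℕ}

/-- Together with its left counterpart this brings all four double sums to the single kernel `1 /
((y - μ)(μ - ν))`, with poles indexed by the reduced data. -/
theorem mixedTaylor_comp_neg_right (p r : ℕ) (A : ℂ → ℂ → Fin n → ℂ) (a b : ℂ) :
    mixedTaylor p r A a b = (-1 : ℂ) ^ r • mixedTaylor p r (fun μ ν => A μ (-ν)) a (-b) := by
  have h : ∀ μ, iteratedDeriv r (fun ν => A μ (-ν)) (-b)
      = (-1 : ℂ) ^ r • iteratedDeriv r (fun ν => A μ ν) b := fun μ => by
    rw [iteratedDeriv_comp_neg r (fun ν => A μ ν), neg_neg]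
  have hs : ((-1 : ℂ) ^ r) * (-1) ^ r = 1 := by rw [← mul_pow]; simp
  simp only [mixedTaylor, h]
  rw [iteratedDeriv_fun_const_smul_field ((-1 : ℂ) ^ r)
    (fun μ => iteratedDeriv r (fun ν => A μ ν) b), smul_smul, smul_smul, mul_right_comm, hs,
    one_mul]

theorem mixedTaylor_comp_neg_left (p r : ℕ) (A : ℂ → ℂ → Fin n → ℂ) (a b : ℂ) :
    mixedTaylor p r A a b = (-1 : ℂ) ^ p • mixedTaylor p r (fun μ ν => A (-μ) ν) (-a) b := by
  have hs : ((-1 : ℂ) ^ p) * (-1) ^ p = 1 := by rw [← mul_pow]; simp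
  simp only [mixedTaylor]
  rw [iteratedDeriv_comp_neg p (fun μ => iteratedDeriv r (fun ν => A μ ν) b), neg_neg,
    smul_smul, smul_smul, mul_right_comm, hs, one_mul]

theorem mixedTaylor_const_smul (p r : ℕ) (c : ℂ) (A : ℂ → ℂ → Fin n → ℂ) (a b : ℂ) :
    mixedTaylor p r (fun μ ν => c • A μ ν) a b = c • mixedTaylor p r A a b := by
  simp only [mixedTaylor]
  simp only [iteratedDeriv_fun_const_smul_field c]
  exact smul_comm _ _ _

/-- The mixed Taylor coefficient of a product of Cauchy kernels is an iterated principal part. -/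
theorem mixedTaylor_apply (p r : ℕ) {H : ℂ → ℂ} {T : ℂ → Fin n → ℂ} {a b y : ℂ}
    (hH : AnalyticAt ℂ H a) (hT : ∀ i, AnalyticAt ℂ (fun ν => T ν i) b) (hab : a ≠ b)
    (hy : y ≠ a) (i : Fin n) :
    mixedTaylor p r (fun μ ν => (H μ / ((y - μ) * (μ - ν))) • T ν) a b i
      = principalPart (fun μ => H μ * principalPart (fun ν => T ν i) b r μ) a p y := by
  -- For `μ` near `a` the point `μ` avoids `b`, so the inner derivative is a principal part at `b`
  -- evaluated at `μ`; the outer one treats it as part of the density at `a`.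
  have hinner : (fun μ => iteratedDeriv r (fun ν => (H μ / ((y - μ) * (μ - ν))) • T ν) b)
      =ᶠ[𝓝 a] fun μ i => (r ! : ℂ) * (H μ * principalPart (fun ν => T ν i) b r μ / (y - μ)) := by
    filter_upwards [eventually_ne_nhds hab] with μ hμ
    ext i
    have hsub : μ - b ≠ 0 := sub_ne_zero.2 hμ
    have han : ∀ i, AnalyticAt ℂ (fun ν => T ν i / (μ - ν)) b := fun i =>
      (hT i).fun_div (by fun_prop) hsub
    have heq : (fun ν => (H μ / ((y - μ) * (μ - ν))) • T ν)
        = fun ν i => (H μ / (y - μ)) * (T ν i / (μ - ν)) := by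
      ext ν i
      simp only [Pi.smul_apply, smul_eq_mul]
      rw [div_mul_eq_div_div]
      ring
    rw [heq, iteratedDeriv_apply_pi (fun i => analyticAt_const.fun_mul (han i)),
      iteratedDeriv_const_mul_field, ← principalPart_eq r (hT i) hμ]
    have : (r ! : ℂ) ≠ 0 := by exact_mod_cast r.factorial_ne_zero
    field_simp
  have hpp : ∀ i, AnalyticAt ℂ (fun μ => H μ * principalPart (fun ν => T ν i) b r μ) a := fun i =>
    hH.fun_mul (principalPart_analyticAt _ _ hab)
  have hy0 : y - a ≠ 0 := sub_ne_zero.2 hy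
  rw [mixedTaylor, hinner.iteratedDeriv_eq, Pi.smul_apply, iteratedDeriv_apply_pi (fun i =>
    analyticAt_const.fun_mul ((hpp i).fun_div (by fun_prop) hy0)),
    iteratedDeriv_const_mul_field, ← principalPart_eq p (hpp i) hy, smul_eq_mul]
  have h1 : (r ! : ℂ) ≠ 0 := by exact_mod_cast r.factorial_ne_zero
  have h2 : (p ! : ℂ) ≠ 0 := by exact_mod_cast p.factorial_ne_zero
  field_simp

end DiscreteData

/-- The derivatives at its centre of a Taylor polynomial. -/
theorem iteratedDeriv_taylor {m : ℕ} (u : Fin (m + 1) → ℂ) (p : ℂ) (j : Fin (m + 1)) :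
    iteratedDeriv j (fun z => ∑ i : Fin (m + 1), (z - p) ^ (i : ℕ) / ((i : ℕ)! : ℂ) * u i) p
      = u j := by
  rw [iteratedDeriv_finset_sum _ fun i _ => by fun_prop]
  have h : ∀ i : Fin (m + 1),
      iteratedDeriv j (fun z => (z - p) ^ (i : ℕ) / ((i : ℕ)! : ℂ) * u i) p
        = if j = i then u i else 0 := by
    intro i
    have h1 : (fun z => (z - p) ^ (i : ℕ) / ((i : ℕ)! : ℂ) * u i)
        = fun z => (u i / ((i : ℕ)! : ℂ)) * (fun w : ℂ => w ^ (i : ℕ)) (z - p) := by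
      ext z; simp only; ring
    have h2 := congrFun (iteratedDeriv_comp_sub_const (n := j) (f := fun w : ℂ => w ^ (i : ℕ))
      (s := p)) p
    rw [h1, iteratedDeriv_const_mul_field, h2, sub_self, iteratedDeriv_fun_pow_zero]
    have h3 : ((i : ℕ)! : ℂ) ≠ 0 := by exact_mod_cast (i : ℕ).factorial_ne_zero
    by_cases hji : j = i
    · subst hji
      rw [if_pos rfl, if_pos rfl]
      field_simp
    · rw [if_neg hji, if_neg fun h => hji (Fin.ext h)]
      simp
  simp [h]

/-! ### The trial rows built from the unknowns -/

namespace DiscreteData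

variable {n N N₁ : ℕ} (d : DiscreteData n N N₁) (x t : ℝ) (U : d.Unknowns)

/-- The Taylor polynomials made of the unknowns, at the poles in the upper half plane. -/
def taylor : Fin N ⊕ OffAxis N N₁ → ℂ → Fin n → ℂ :=
  Sum.elim (fun l => d.T₁ U l) fun l ν => (-1 : ℂ) ^ d.m l • d.T₂ U l (-ν)

theorem T₁_apply (k : Fin N) (z : ℂ) (i : Fin n) : d.T₁ U k z i
    = ∑ j : Fin (d.m k + 1), (z - d.pole k) ^ (j : ℕ) / ((j : ℕ)! : ℂ) * U.1 k j i := by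
  simp [T₁, Finset.sum_apply]

theorem T₂_apply (k : OffAxis N N₁) (z : ℂ) (i : Fin n) : d.T₂ U k z i
    = ∑ j : Fin (d.m k + 1), (z - conj (d.pole k)) ^ (j : ℕ) / ((j : ℕ)! : ℂ) * U.2 k j i := by
  simp [T₂, Finset.sum_apply]

theorem analyticAt_T₁ (k : Fin N) (i : Fin n) (z : ℂ) :
    AnalyticAt ℂ (fun z => d.T₁ U k z i) z := by
  simp only [T₁_apply]; fun_prop

theorem analyticAt_taylor (k : Fin N ⊕ OffAxis N N₁) (i : Fin n) (z : ℂ) :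
    AnalyticAt ℂ (fun z => d.taylor U k z i) z := by
  rcases k with k | k
  · exact d.analyticAt_T₁ U k i z
  · change AnalyticAt ℂ (fun z => (-1 : ℂ) ^ d.m k * d.T₂ U k (-z) i) z
    simp only [T₂_apply]; fun_prop

theorem iteratedDeriv_T₁ (k : Fin N) (i : Fin n) (j : Fin (d.m k + 1)) :
    iteratedDeriv j (fun z => d.T₁ U k z i) (d.pole k) = U.1 k j i := by
  simp only [T₁_apply]
  exact iteratedDeriv_taylor (fun j => U.1 k j i) _ j

theorem iteratedDeriv_T₂ (k : OffAxis N N₁) (i : Fin n) (j : Fin (d.m k + 1)) :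
    iteratedDeriv j (fun z => d.T₂ U k z i) (conj (d.pole k)) = U.2 k j i := by
  simp only [T₂_apply]
  exact iteratedDeriv_taylor (fun j => U.2 k j i) _ j

/-- The first entry of the row with index `i` of the candidate solution made of the unknowns. -/
def trialLeft (i : Fin n) (z : ℂ) : ℂ :=
  ∑ a, principalPart (fun ν => I / 2 * d.taylor U a ν i) (d.poleData.pt a) (d.poleData.ord a) z

/-- The row with index `i` of the candidate solution made of the unknowns. -/
def trial (i : Fin n) : Unit ⊕ Fin n → ℂ → ℂ :=
  Sum.elim (fun _ => d.trialLeft U i) fun c z => (1 : BlockMat n) (.inr i) (.inr c)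
    + ∑ a, principalPart (d.poleData.lower x t (fun _ => d.trialLeft U i) a c)
        (conj (d.poleData.pt a)) (d.poleData.ord a) z

theorem analyticAt_trialLeft (i : Fin n) {z : ℂ} (hz : ∀ a, z ≠ d.poleData.pt a) :
    AnalyticAt ℂ (d.trialLeft U i) z := by
  unfold trialLeft
  exact Finset.analyticAt_fun_sum _ fun a _ => principalPart_analyticAt _ _ (hz a)

theorem analyticAt_trial_right (i c : Fin n) {z : ℂ} (hz : ∀ a, z ≠ conj (d.poleData.pt a)) :
    AnalyticAt ℂ (d.trial x t U i (.inr c)) z := by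
  simp only [trial, Sum.elim_inr]
  exact analyticAt_const.fun_add
    (Finset.analyticAt_fun_sum _ fun a _ => principalPart_analyticAt _ _ (hz a))

/-- The double sums of the algebraic system, as functions of a vector and a point. -/
def doubleSum (w : Fin n → ℂ) (y : ℂ) : Fin n → ℂ :=
  ∑ k : Fin N, ∑ l : Fin N, mixedTaylor (d.m k) (d.m l)
      (fun μ ν => ((d.hbar x t μ ⬝ᵥ w) / ((y - μ) * (μ - ν))) • d.T₁ U l ν)
      (conj (d.pole k)) (d.pole l)
  + ∑ k : Fin N, ∑ l : OffAxis N N₁, mixedTaylor (d.m k) (d.m l)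
      (fun μ ν => ((d.hbar x t μ ⬝ᵥ w) / ((y - μ) * (μ + ν))) • d.T₂ U l ν)
      (conj (d.pole k)) (conj (d.pole l))
  + ∑ k : OffAxis N N₁, ∑ l : Fin N, mixedTaylor (d.m k) (d.m l)
      (fun μ ν => ((d.h x t μ ⬝ᵥ w) / ((y + μ) * (μ + ν))) • d.T₁ U l ν)
      (d.pole k) (d.pole l)
  + ∑ k : OffAxis N N₁, ∑ l : OffAxis N N₁, mixedTaylor (d.m k) (d.m l)
      (fun μ ν => ((d.h x t μ ⬝ᵥ w) / ((y + μ) * (μ - ν))) • d.T₂ U l ν)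
      (d.pole k) (conj (d.pole l))

theorem G₁_eq (k : Fin N) (z : ℂ) : d.G₁ x t U k z
    = d.T₁ U k z + (2 * I) • d.h x t z + d.doubleSum x t U (d.h x t z) z := by
  simp only [G₁, doubleSum, add_assoc]

/-- The sums in `G₂` are those of `G₁` at the reflected point `-z`; the overall sign comes from the
first factor of each kernel. -/
theorem G₂_eq (k : OffAxis N N₁) (z : ℂ) : d.G₂ x t U k z
    = d.T₂ U k z - (2 * I) • d.hbar x t z - d.doubleSum x t U (d.hbar x t z) (-z) := by
  have h1 : ∀ (s μ ν : ℂ) (T : Fin n → ℂ),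
      (s / ((z + μ) * (μ - ν))) • T = (-1 : ℂ) • ((s / ((-z - μ) * (μ - ν))) • T) := by
    intro s μ ν T
    rw [smul_smul, show (-z - μ) * (μ - ν) = -((z + μ) * (μ - ν)) by ring, div_neg, neg_one_mul,
      neg_neg]
  have h2 : ∀ (s μ ν : ℂ) (T : Fin n → ℂ),
      (s / ((z + μ) * (μ + ν))) • T = (-1 : ℂ) • ((s / ((-z - μ) * (μ + ν))) • T) := by
    intro s μ ν T
    rw [smul_smul, show (-z - μ) * (μ + ν) = -((z + μ) * (μ + ν)) by ring, div_neg, neg_one_mul,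
      neg_neg]
  have h3 : ∀ (s μ ν : ℂ) (T : Fin n → ℂ),
      (s / ((z - μ) * (μ - ν))) • T = (-1 : ℂ) • ((s / ((-z + μ) * (μ - ν))) • T) := by
    intro s μ ν T
    rw [smul_smul, show (-z + μ) * (μ - ν) = -((z - μ) * (μ - ν)) by ring, div_neg, neg_one_mul,
      neg_neg]
  have h4 : ∀ (s μ ν : ℂ) (T : Fin n → ℂ),
      (s / ((z - μ) * (μ + ν))) • T = (-1 : ℂ) • ((s / ((-z + μ) * (μ + ν))) • T) := by
    intro s μ ν T
    rw [smul_smul, show (-z + μ) * (μ + ν) = -((z - μ) * (μ + ν)) by ring, div_neg, neg_one_mul,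
      neg_neg]
  simp only [G₂, doubleSum, h1, h2, h3, h4, mixedTaylor_const_smul, ← Finset.smul_sum]
  simp only [neg_one_smul]
  abel

theorem hbar_apply (z : ℂ) (c : Fin n) :
    d.hbar x t z c = exp (-2 * I * phase x t z) * conj (d.fv (conj z) c) := by
  have hI : conj (2 * I) = -2 * I := by simp [Complex.conj_ofNat]
  rw [hbar, h, map_mul, ← Complex.exp_conj, map_mul, hI, conj_phase, Complex.conj_conj]

theorem eval_conjPoly_g_inr (k : OffAxis N N₁) (c : Fin n) (z : ℂ) :
    (conjPoly (d.poleData.g (.inr k) c)).eval z = (-1) ^ (d.m k + 1) * d.fv (-z) c := by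
  simp [poleData, conjPoly, fsharp, Polynomial.map_comp, Polynomial.map_map, fv,
    Polynomial.eval_comp]

/-- The scalar factor of the summands of `doubleSum`. -/
def kernelFactor (w : Fin n → ℂ) (k : Fin N ⊕ OffAxis N N₁) (μ : ℂ) : ℂ :=
  exp (-2 * I * phase x t μ) * ∑ c, w c * (conjPoly (d.poleData.g k c)).eval μ

theorem analyticAt_kernelFactor (w : Fin n → ℂ) (k : Fin N ⊕ OffAxis N N₁) (z : ℂ) :
    AnalyticAt ℂ (d.kernelFactor x t w k) z :=
  (analyticAt_exp_phase _ _ _ _).fun_mul (Finset.analyticAt_fun_sum _ fun _ _ =>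
    analyticAt_const.fun_mul (analyticAt_eval _ _))

theorem hbar_dotProduct (w : Fin n → ℂ) (k : Fin N) (μ : ℂ) :
    d.hbar x t μ ⬝ᵥ w = d.kernelFactor x t w (.inl k) μ := by
  simp only [dotProduct, hbar_apply, kernelFactor, Finset.mul_sum, poleData, Sum.elim_inl,
    eval_conjPoly, fv]
  exact Finset.sum_congr rfl fun c _ => by ring

theorem h_neg_dotProduct (w : Fin n → ℂ) (k : OffAxis N N₁) (μ : ℂ) :
    (-1) ^ d.m k * (d.h x t (-μ) ⬝ᵥ w) = -d.kernelFactor x t w (.inr k) μ := by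
  have hp : 2 * I * phase x t (-μ) = -2 * I * phase x t μ := by simp [phase]; ring
  simp only [dotProduct, h, kernelFactor, Finset.mul_sum, eval_conjPoly_g_inr, hp,
    ← Finset.sum_neg_distrib]
  exact Finset.sum_congr rfl fun c _ => by ring

/-- The summands of `doubleSum` in uniform notation. -/
def doubleTerm (w : Fin n → ℂ) (y : ℂ) (k l : Fin N ⊕ OffAxis N N₁) : Fin n → ℂ :=
  mixedTaylor (d.poleData.ord k) (d.poleData.ord l)
    (fun μ ν => (d.kernelFactor x t w k μ / ((y - μ) * (μ - ν))) • d.taylor U l ν)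
    (conj (d.poleData.pt k)) (d.poleData.pt l)

theorem doubleTerm_inl_inl (w : Fin n → ℂ) (y : ℂ) (k l : Fin N) :
    mixedTaylor (d.m k) (d.m l)
      (fun μ ν => ((d.hbar x t μ ⬝ᵥ w) / ((y - μ) * (μ - ν))) • d.T₁ U l ν)
      (conj (d.pole k)) (d.pole l) = d.doubleTerm x t U w y (.inl k) (.inl l) := by
  simp only [d.hbar_dotProduct x t w k]
  rfl

theorem doubleTerm_inl_inr (w : Fin n → ℂ) (y : ℂ) (k : Fin N) (l : OffAxis N N₁) :
    mixedTaylor (d.m k) (d.m l)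
      (fun μ ν => ((d.hbar x t μ ⬝ᵥ w) / ((y - μ) * (μ + ν))) • d.T₂ U l ν)
      (conj (d.pole k)) (conj (d.pole l)) = d.doubleTerm x t U w y (.inl k) (.inr l) := by
  rw [mixedTaylor_comp_neg_right, ← mixedTaylor_const_smul]
  simp only [d.hbar_dotProduct x t w k, ← sub_eq_add_neg, smul_comm ((-1 : ℂ) ^ d.m l)]
  rfl

theorem doubleTerm_inr_inl (w : Fin n → ℂ) (y : ℂ) (k : OffAxis N N₁) (l : Fin N) :
    mixedTaylor (d.m k) (d.m l)
      (fun μ ν => ((d.h x t μ ⬝ᵥ w) / ((y + μ) * (μ + ν))) • d.T₁ U l ν)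
      (d.pole k) (d.pole l) = d.doubleTerm x t U w y (.inr k) (.inl l) := by
  have hp : conj (d.poleData.pt (.inr k)) = -d.pole k := by simp
  have he : ∀ μ ν : ℂ, (y - μ) * (-μ + ν) = -((y - μ) * (μ - ν)) := fun μ ν => by ring
  rw [mixedTaylor_comp_neg_left, ← mixedTaylor_const_smul, doubleTerm, hp]
  simp only [smul_smul, ← mul_div_assoc, d.h_neg_dotProduct, ← sub_eq_add_neg, he, neg_div_neg_eq]
  rfl

theorem doubleTerm_inr_inr (w : Fin n → ℂ) (y : ℂ) (k l : OffAxis N N₁) :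
    mixedTaylor (d.m k) (d.m l)
      (fun μ ν => ((d.h x t μ ⬝ᵥ w) / ((y + μ) * (μ - ν))) • d.T₂ U l ν)
      (d.pole k) (conj (d.pole l)) = d.doubleTerm x t U w y (.inr k) (.inr l) := by
  have hp : conj (d.poleData.pt (.inr k)) = -d.pole k := by simp
  have he : ∀ μ ν : ℂ, (y - μ) * (-μ - -ν) = -((y - μ) * (μ - ν)) := fun μ ν => by ring
  have hk : ∀ μ (c : ℂ), (-1) ^ d.m k * ((d.h x t (-μ) ⬝ᵥ w) / -c)
      = d.kernelFactor x t w (.inr k) μ / c := fun μ c => by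
    rw [← mul_div_assoc, d.h_neg_dotProduct, neg_div_neg_eq]
  rw [mixedTaylor_comp_neg_right, mixedTaylor_comp_neg_left, ← mixedTaylor_const_smul,
    ← mixedTaylor_const_smul, doubleTerm, hp]
  simp only [← sub_eq_add_neg, he]
  simp only [smul_smul, hk]
  simp only [mul_comm ((-1 : ℂ) ^ d.m l), ← smul_smul]
  rfl

theorem doubleSum_eq_sum (w : Fin n → ℂ) (y : ℂ) :
    d.doubleSum x t U w y = ∑ k, ∑ l, d.doubleTerm x t U w y k l := by
  simp only [doubleSum, doubleTerm_inl_inl, doubleTerm_inl_inr, doubleTerm_inr_inl,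
    doubleTerm_inr_inr, Fintype.sum_sum_type, Finset.sum_add_distrib, add_assoc]
  exact congrArg _ (add_left_comm _ _ _)

/-- The inner principal parts, summed over `l`, reconstruct the left entry of the trial row.
Inserting it in the lower residue condition, the outer ones, summed over `k`, reconstruct the right
entries minus their value at infinity. -/
theorem doubleSum_apply (w : Fin n → ℂ) {y : ℂ} (hy : ∀ a, y ≠ conj (d.poleData.pt a))
    (i : Fin n) : d.doubleSum x t U w y i
    = 2 * I * ∑ c, w c * (d.trial x t U i (.inr c) y - (1 : BlockMat n) (.inr i) (.inr c)) := by
  have hA : ∀ z, d.trialLeft U i z = ∑ l, I / 2 * principalPart (fun ν => d.taylor U l ν i)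
      (d.poleData.pt l) (d.poleData.ord l) z := fun z => by
    simp only [trialLeft, principalPart_const_mul]
  have hlow : ∀ k c, AnalyticAt ℂ (d.poleData.lower x t (fun _ => d.trialLeft U i) k c)
      (conj (d.poleData.pt k)) := fun k c =>
    PoleData.lower_analyticAt (d.analyticAt_trialLeft U i (PoleData.conj_pt_ne_pt k))
  have hk : ∀ k, ∑ l, d.doubleTerm x t U w y k l i = ∑ c, 2 * I * (w c *
      principalPart (d.poleData.lower x t (fun _ => d.trialLeft U i) k c)
        (conj (d.poleData.pt k)) (d.poleData.ord k) y) := by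
    intro k
    have hterm : ∀ l, d.doubleTerm x t U w y k l i
        = principalPart (fun μ => d.kernelFactor x t w k μ * principalPart
          (fun ν => d.taylor U l ν i) (d.poleData.pt l) (d.poleData.ord l) μ)
          (conj (d.poleData.pt k)) (d.poleData.ord k) y := fun l =>
      mixedTaylor_apply _ _ (d.analyticAt_kernelFactor x t w k _)
        (fun i => d.analyticAt_taylor U l i _) (PoleData.conj_pt_ne_pt k l) (hy k) i
    have hfun : (fun μ => ∑ l, d.kernelFactor x t w k μ * principalPart
          (fun ν => d.taylor U l ν i) (d.poleData.pt l) (d.poleData.ord l) μ)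
        = fun μ => ∑ c, 2 * I * w c
          * d.poleData.lower x t (fun _ => d.trialLeft U i) k c μ := by
      ext μ
      rw [← Finset.mul_sum]
      -- The unknowns model `-2i M_DR h`, while the residue condition prescribes `M_DR h`; `i/2` is
      -- the inverse of `-2i`.
      have h1 : ∑ l, principalPart (fun ν => d.taylor U l ν i) (d.poleData.pt l)
          (d.poleData.ord l) μ = -2 * I * d.trialLeft U i μ := by
        rw [hA, ← Finset.mul_sum]
        linear_combination (∑ l, principalPart (fun ν => d.taylor U l ν i) (d.poleData.pt l)
          (d.poleData.ord l) μ) * Complex.I_mul_I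
      rw [h1]
      simp only [kernelFactor, PoleData.lower, Finset.mul_sum, Finset.sum_mul]
      exact Finset.sum_congr rfl fun c _ => by ring
    simp only [hterm]
    rw [← principalPart_sum _ fun l _ => (d.analyticAt_kernelFactor x t w k _).fun_mul
      (principalPart_analyticAt _ _ (PoleData.conj_pt_ne_pt k l)), hfun,
      principalPart_sum _ fun c _ => analyticAt_const.fun_mul (hlow k c)]
    refine Finset.sum_congr rfl fun c _ => ?_
    rw [principalPart_const_mul, mul_assoc]
  rw [doubleSum_eq_sum, Finset.sum_apply]
  simp only [Finset.sum_apply, hk, trial, Sum.elim_inr, add_sub_cancel_left]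
  rw [Finset.sum_comm, Finset.mul_sum]
  refine Finset.sum_congr rfl fun c _ => ?_
  rw [Finset.mul_sum, Finset.mul_sum]

end DiscreteData

/-! ### Equivalence of the algebraic system with the residue conditions -/

namespace DiscreteData

variable {n N N₁ : ℕ} (d : DiscreteData n N N₁) (x t : ℝ) (U : d.Unknowns)

theorem upper_inl (v : Unit ⊕ Fin n → ℂ → ℂ) (k : Fin N) (z : ℂ) :
    d.poleData.upper x t v (.inl k) z = ∑ c, v (.inr c) z * d.h x t z c := by
  simp only [PoleData.upper, poleData, Sum.elim_inl, h, fv, Finset.mul_sum]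
  exact Finset.sum_congr rfl fun c _ => by ring

theorem upper_inr (v : Unit ⊕ Fin n → ℂ → ℂ) (k : OffAxis N N₁) (z : ℂ) :
    d.poleData.upper x t v (.inr k) (-z)
      = (-1) ^ (d.m k + 1) * ∑ c, v (.inr c) (-z) * d.hbar x t z c := by
  have hp : 2 * I * phase x t (-z) = -2 * I * phase x t z := by simp [phase]; ring
  simp only [PoleData.upper, poleData, Sum.elim_inr, hbar_apply, Polynomial.eval_mul,
    Polynomial.eval_C, eval_fsharp, map_neg, neg_neg, hp, Finset.mul_sum]
  exact Finset.sum_congr rfl fun c _ => by ring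

/-- The failure of the candidate row to satisfy the residue condition in the upper half plane. -/
def defect (i : Fin n) (a : Fin N ⊕ OffAxis N N₁) (z : ℂ) : ℂ :=
  d.poleData.upper x t (d.trial x t U i) a z - I / 2 * d.taylor U a z i

theorem sum_mul_one_row (w : Fin n → ℂ) (i : Fin n) :
    ∑ c, w c * (1 : BlockMat n) (.inr i) (.inr c) = w i := by
  simp [Matrix.one_apply]

/-- The term `2i h` restores the value at infinity subtracted in `doubleSum_apply`. What remains is
the residue condition at `λ_k` for the trial row. -/
theorem G₁_apply (k : Fin N) {z : ℂ} (hz : ∀ a, z ≠ conj (d.poleData.pt a)) (i : Fin n) :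
    d.G₁ x t U k z i = 2 * I * d.defect x t U i (.inl k) z := by
  rw [G₁_eq, Pi.add_apply, Pi.add_apply, d.doubleSum_apply x t U _ hz, defect, upper_inl]
  simp only [mul_sub, Finset.sum_sub_distrib, sum_mul_one_row, Pi.smul_apply, smul_eq_mul]
  have h1 : ∑ c, d.h x t z c * d.trial x t U i (.inr c) z
      = ∑ c, d.trial x t U i (.inr c) z * d.h x t z c :=
    Finset.sum_congr rfl fun c _ => mul_comm _ _
  rw [h1]
  change d.T₁ U k z i + _ + _ = _ - 2 * I * (I / 2 * d.T₁ U k z i)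
  linear_combination (d.T₁ U k z i) * Complex.I_mul_I

theorem G₂_apply (k : OffAxis N N₁) {z : ℂ} (hz : ∀ a, -z ≠ conj (d.poleData.pt a)) (i : Fin n) :
    d.G₂ x t U k z i = (-1) ^ d.m k * (2 * I) * d.defect x t U i (.inr k) (-z) := by
  rw [G₂_eq, Pi.sub_apply, Pi.sub_apply, d.doubleSum_apply x t U _ hz, defect, upper_inr]
  simp only [mul_sub, Finset.sum_sub_distrib, sum_mul_one_row, Pi.smul_apply, smul_eq_mul]
  have h1 : ∑ c, d.hbar x t z c * d.trial x t U i (.inr c) (-z)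
      = ∑ c, d.trial x t U i (.inr c) (-z) * d.hbar x t z c :=
    Finset.sum_congr rfl fun c _ => mul_comm _ _
  have hs : ((-1 : ℂ) ^ d.m k) * (-1) ^ d.m k = 1 := by rw [← mul_pow]; simp
  have h2 : d.taylor U (.inr k) (-z) i = (-1) ^ d.m k * d.T₂ U k z i := by
    change (-1) ^ d.m k * d.T₂ U k (- -z) i = _
    rw [neg_neg]
  rw [h1, h2, pow_succ]
  generalize ∑ c, d.trial x t U i (.inr c) (-z) * d.hbar x t z c = T
  linear_combination (2 * I * T + I * I * d.T₂ U k z i) * hs + (d.T₂ U k z i) * Complex.I_mul_I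

theorem analyticAt_defect (i : Fin n) (a b : Fin N ⊕ OffAxis N N₁) :
    AnalyticAt ℂ (d.defect x t U i a) (d.poleData.pt b) := by
  unfold defect
  exact (PoleData.upper_analyticAt fun c => d.analyticAt_trial_right x t U i c
    (PoleData.ne_conj_pt (d.poleData.im_pos b).le)).fun_sub
    (analyticAt_const.fun_mul (d.analyticAt_taylor U a i _))

theorem eventually_ne_conj_pt (b : Fin N ⊕ OffAxis N N₁) :
    ∀ᶠ z in 𝓝 (d.poleData.pt b), ∀ a, z ≠ conj (d.poleData.pt a) :=
  eventually_all.2 fun a => eventually_ne_nhds (PoleData.ne_conj_pt (d.poleData.im_pos b).le a)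

/-- Up to nonzero constants and `z ↦ -z`, `G₁` and `G₂` are the defects, so the two kinds of
equations become one condition for each pole of the reduced data. -/
theorem solvesSystem_iff : d.SolvesSystem x t U ↔ ∀ i a,
    VanishesTo (d.defect x t U i a) (d.poleData.pt a) (d.poleData.ord a + 1) := by
  have hfac : ∀ j : ℕ, ((j ! : ℂ)⁻¹) ≠ 0 := fun j =>
    inv_ne_zero (by exact_mod_cast j.factorial_ne_zero)
  have h1 : ∀ k j, iteratedDeriv j (d.G₁ x t U k) (d.pole k) = 0 ↔
      ∀ i, iteratedDeriv j (d.defect x t U i (.inl k)) (d.pole k) = 0 := by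
    intro k j
    have he : d.G₁ x t U k =ᶠ[𝓝 (d.pole k)] fun z i => 2 * I * d.defect x t U i (.inl k) z := by
      filter_upwards [d.eventually_ne_conj_pt (.inl k)] with z hz
      exact funext fun i => d.G₁_apply x t U k hz i
    have han : ∀ i, AnalyticAt ℂ (d.defect x t U i (.inl k)) (d.pole k) :=
      fun i => d.analyticAt_defect x t U i (.inl k) (.inl k)
    rw [he.iteratedDeriv_eq, funext_iff]
    refine forall_congr' fun i => ?_
    rw [iteratedDeriv_apply_pi (fun i => analyticAt_const.fun_mul (han i)),
      iteratedDeriv_const_mul_field]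
    simp
  have h2 : ∀ k j, iteratedDeriv j (d.G₂ x t U k) (conj (d.pole k)) = 0 ↔
      ∀ i, iteratedDeriv j (d.defect x t U i (.inr k)) (-conj (d.pole k)) = 0 := by
    intro k j
    have he : d.G₂ x t U k =ᶠ[𝓝 (conj (d.pole k))]
        fun z i => (-1) ^ d.m k * (2 * I) * d.defect x t U i (.inr k) (-z) := by
      have ht : Tendsto (fun z : ℂ => -z) (𝓝 (conj (d.pole k))) (𝓝 (-conj (d.pole k))) :=
        continuous_neg.tendsto _
      filter_upwards [ht.eventually (d.eventually_ne_conj_pt (.inr k))] with z hz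
      exact funext fun i => d.G₂_apply x t U k hz i
    have han : ∀ i, AnalyticAt ℂ (fun z => d.defect x t U i (.inr k) (-z)) (conj (d.pole k)) :=
      fun i => AnalyticAt.comp (g := d.defect x t U i (.inr k)) (f := fun z => -z)
        (d.analyticAt_defect x t U i (.inr k) (.inr k)) (by fun_prop)
    rw [he.iteratedDeriv_eq, funext_iff]
    refine forall_congr' fun i => ?_
    rw [iteratedDeriv_apply_pi (fun i => analyticAt_const.fun_mul (han i)),
      iteratedDeriv_const_mul_field, iteratedDeriv_comp_neg]
    simp
  have h3 : ∀ i a, VanishesTo (d.defect x t U i a) (d.poleData.pt a) (d.poleData.ord a + 1) ↔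
      ∀ j ≤ d.poleData.ord a, iteratedDeriv j (d.defect x t U i a) (d.poleData.pt a) = 0 := by
    intro i a
    rw [VanishesTo.iff_iteratedDeriv (d.analyticAt_defect x t U i a a)]
    simp only [Nat.lt_succ_iff]
  simp only [SolvesSystem, smul_eq_zero_iff_right (hfac _), h1, h2, h3, Sum.forall]
  exact ⟨fun h i => ⟨fun k j hj => h.1 k j hj i, fun k j hj => h.2 k j hj i⟩,
    fun h => ⟨fun k j hj i => (h i).1 k j hj, fun k j hj i => (h i).2 k j hj⟩⟩

variable {d x t U}

/-- The lower residue conditions hold by construction of the right entries. At the upper poles the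
left entry has the polar part of `i/2` times the unknown Taylor polynomial, and vanishing of the
defect turns it into the required one. -/
theorem isRow_trial {i : Fin n}
    (h : ∀ a, VanishesTo (d.defect x t U i a) (d.poleData.pt a) (d.poleData.ord a + 1)) :
    d.poleData.IsRow x t ((1 : BlockMat n) (.inr i)) (d.trial x t U i) where
  analytic_left z hz := d.analyticAt_trialLeft U i hz
  analytic_right c z hz := d.analyticAt_trial_right x t U i c hz
  tendsto := by
    rintro (c | c)
    · have := tendsto_finsetSum Finset.univ fun a (_ : a ∈ Finset.univ) =>
        principalPart_tendsto (fun ν => I / 2 * d.taylor U a ν i) (d.poleData.pt a)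
          (d.poleData.ord a)
      rw [Finset.sum_const_zero] at this
      rw [Matrix.one_apply_ne (by simp)]
      exact this
    · have := (tendsto_finsetSum Finset.univ fun a (_ : a ∈ Finset.univ) =>
        principalPart_tendsto (d.poleData.lower x t (fun _ => d.trialLeft U i) a c)
          (conj (d.poleData.pt a)) (d.poleData.ord a)).const_add
          ((1 : BlockMat n) (.inr i) (.inr c))
      simpa [trial] using this
  polar_up a := by
    classical
    obtain ⟨l, hl, he⟩ := principalPart_polarRel (d.poleData.ord a)
      (analyticAt_const.fun_mul (d.analyticAt_taylor U a i (d.poleData.pt a)) :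
        AnalyticAt ℂ (fun ν => I / 2 * d.taylor U a ν i) _)
    refine PolarRel.congr_vanishes (ψ := fun ν => I / 2 * d.taylor U a ν i) ⟨fun z => l z
      + ∑ b ∈ Finset.univ.erase a, principalPart (fun ν => I / 2 * d.taylor U b ν i)
        (d.poleData.pt b) (d.poleData.ord b) z, hl.fun_add (Finset.analyticAt_fun_sum _
        fun b hb => principalPart_analyticAt _ _
          (d.poleData.inj.ne (Finset.ne_of_mem_erase hb).symm)), ?_⟩ (h a)
    filter_upwards [he] with z hz
    change d.trialLeft U i z = _
    rw [trialLeft, ← Finset.add_sum_erase _ _ (Finset.mem_univ a), hz]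
    ring
  polar_low a c := by
    classical
    obtain ⟨l, hl, he⟩ := principalPart_polarRel (d.poleData.ord a)
      (PoleData.lower_analyticAt (D := d.poleData) (x := x) (t := t) (k := a) (j := c)
        (v := fun _ => d.trialLeft U i)
        (d.analyticAt_trialLeft U i (PoleData.conj_pt_ne_pt a)))
    refine ⟨fun z => l z + ((1 : BlockMat n) (.inr i) (.inr c) + ∑ b ∈ Finset.univ.erase a,
      principalPart (d.poleData.lower x t (fun _ => d.trialLeft U i) b c)
        (conj (d.poleData.pt b)) (d.poleData.ord b) z), hl.fun_add (analyticAt_const.fun_add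
        (Finset.analyticAt_fun_sum _ fun b hb => principalPart_analyticAt _ _ fun e =>
          Finset.ne_of_mem_erase hb (d.poleData.inj ((starRingEnd ℂ).injective e)).symm)), ?_⟩
    filter_upwards [he] with z hz
    simp only [trial, Sum.elim_inr]
    rw [← Finset.add_sum_erase _ _ (Finset.mem_univ a), hz]
    simp only [PoleData.lower, Sum.elim_inl]
    ring

variable (d x t) in
/-- The lower rows of the solution of the Riemann-Hilbert problem. -/
def solRow (i : Fin n) : Unit ⊕ Fin n → ℂ → ℂ := fun j z => d.poleData.sol x t z (.inr i) j

theorem isRow_solRow (i : Fin n) :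
    d.poleData.IsRow x t ((1 : BlockMat n) (.inr i)) (d.solRow x t i) :=
  d.poleData.isRow_sol x t (.inr i)

theorem iteratedDeriv_taylor_inl (k : Fin N) (i : Fin n) (j : Fin (d.m k + 1)) :
    iteratedDeriv j (fun z => d.taylor U (.inl k) z i) (d.poleData.pt (.inl k)) = U.1 k j i :=
  d.iteratedDeriv_T₁ U k i j

theorem iteratedDeriv_taylor_inr (k : OffAxis N N₁) (i : Fin n) (j : Fin (d.m k + 1)) :
    iteratedDeriv j (fun z => d.taylor U (.inr k) z i) (d.poleData.pt (.inr k))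
      = (-1) ^ d.m k * ((-1) ^ (j : ℕ) * U.2 k j i) := by
  change iteratedDeriv j (fun z => (-1) ^ d.m k * d.T₂ U k (-z) i) (-conj (d.pole k)) = _
  rw [iteratedDeriv_const_mul_field, iteratedDeriv_comp_neg j (fun z => d.T₂ U k z i), neg_neg,
    d.iteratedDeriv_T₂, smul_eq_mul]

theorem ext_of_taylor {U' : d.Unknowns} (h : ∀ i a, ∀ j ≤ d.poleData.ord a,
    iteratedDeriv j (fun z => d.taylor U a z i) (d.poleData.pt a)
      = iteratedDeriv j (fun z => d.taylor U' a z i) (d.poleData.pt a)) : U = U' := by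
  refine Prod.ext ?_ ?_
  · ext k j i
    have := h i (.inl k) j (Nat.lt_succ_iff.1 j.2)
    rwa [iteratedDeriv_taylor_inl, iteratedDeriv_taylor_inl] at this
  · ext k j i
    have := h i (.inr k) j (Nat.lt_succ_iff.1 j.2)
    rw [iteratedDeriv_taylor_inr, iteratedDeriv_taylor_inr] at this
    have hne : ∀ m : ℕ, ((-1 : ℂ) ^ m) ≠ 0 := fun m => pow_ne_zero _ (by simp)
    exact mul_left_cancel₀ (hne _) (mul_left_cancel₀ (hne _) this)

variable (d x t) in
theorem F₁_sol_apply (z : ℂ) (i : Fin n) (k : Fin N) : d.F₁ x t (d.poleData.sol x t) z i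
    = -2 * I * d.poleData.upper x t (d.solRow x t i) (.inl k) z := by
  rw [upper_inl]
  rfl

variable (d x t) in
theorem F₂_sol_apply (z : ℂ) (i : Fin n) (k : OffAxis N N₁) : d.F₂ x t (d.poleData.sol x t) z i
    = (-1) ^ d.m k * (-2 * I) * d.poleData.upper x t (d.solRow x t i) (.inr k) (-z) := by
  have hs : ((-1 : ℂ) ^ d.m k) * (-1) ^ d.m k = 1 := by rw [← mul_pow]; simp
  have h1 : d.F₂ x t (d.poleData.sol x t) z i
      = 2 * I * ∑ c, d.solRow x t i (.inr c) (-z) * d.hbar x t z c := rfl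
  rw [upper_inr, h1, pow_succ]
  linear_combination (-(2 * I * ∑ c, d.solRow x t i (.inr c) (-z) * d.hbar x t z c)) * hs

variable (d x t) in
/-- The derivatives of `F₁` and `F₂` formed with the solution of the Riemann-Hilbert problem. -/
def solJets : d.Unknowns :=
  d.jets (d.F₁ x t (d.poleData.sol x t)) (d.F₂ x t (d.poleData.sol x t))

variable (d x t) in
theorem iteratedDeriv_taylor_solJets (i : Fin n) (a : Fin N ⊕ OffAxis N N₁) (j : ℕ)
    (hj : j ≤ d.poleData.ord a) :
    iteratedDeriv j (fun z => d.taylor (d.solJets x t) a z i) (d.poleData.pt a)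
      = -2 * I * iteratedDeriv j (d.poleData.upper x t (d.solRow x t i) a) (d.poleData.pt a) := by
  have han : ∀ i a, AnalyticAt ℂ (d.poleData.upper x t (d.solRow x t i) a) (d.poleData.pt a) :=
    fun i a => (isRow_solRow i).analyticAt_upper a a
  rcases a with k | k
  · have h1 := iteratedDeriv_taylor_inl (U := d.solJets x t) k i ⟨j, Nat.lt_succ_of_le hj⟩
    rw [h1]
    change iteratedDeriv j (d.F₁ x t (d.poleData.sol x t)) (d.pole k) i = _
    have hF : d.F₁ x t (d.poleData.sol x t) = fun z i =>
        -2 * I * d.poleData.upper x t (d.solRow x t i) (.inl k) z := by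
      ext z i; exact d.F₁_sol_apply x t z i k
    have han' : ∀ i, AnalyticAt ℂ (d.poleData.upper x t (d.solRow x t i) (.inl k)) (d.pole k) :=
      fun i => han i (.inl k)
    rw [hF, iteratedDeriv_apply_pi (fun i => analyticAt_const.fun_mul (han' i)),
      iteratedDeriv_const_mul_field]
    rfl
  · have h1 := iteratedDeriv_taylor_inr (U := d.solJets x t) k i ⟨j, Nat.lt_succ_of_le hj⟩
    rw [h1]
    change (-1) ^ d.m k * ((-1) ^ j *
      iteratedDeriv j (d.F₂ x t (d.poleData.sol x t)) (conj (d.pole k)) i) = _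
    have hF : d.F₂ x t (d.poleData.sol x t) = fun z i =>
        (-1) ^ d.m k * (-2 * I) * d.poleData.upper x t (d.solRow x t i) (.inr k) (-z) := by
      ext z i; exact d.F₂_sol_apply x t z i k
    have han' : ∀ i, AnalyticAt ℂ (fun z => d.poleData.upper x t (d.solRow x t i) (.inr k) (-z))
        (conj (d.pole k)) := fun i =>
      AnalyticAt.comp (g := d.poleData.upper x t (d.solRow x t i) (.inr k)) (f := fun z => -z)
        (han i (.inr k)) (by fun_prop)
    rw [hF, iteratedDeriv_apply_pi (fun i => analyticAt_const.fun_mul (han' i)),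
      iteratedDeriv_const_mul_field,
      iteratedDeriv_comp_neg j (d.poleData.upper x t (d.solRow x t i) (.inr k))]
    have hs : ∀ m : ℕ, ((-1 : ℂ) ^ m) * (-1) ^ m = 1 := fun m => by rw [← mul_pow]; simp
    rw [smul_eq_mul, poleData_pt_inr]
    generalize iteratedDeriv j (d.poleData.upper x t (d.solRow x t i) (.inr k)) _ = T
    linear_combination (-2 * I * T * ((-1) ^ j * (-1) ^ j)) * hs (d.m k) + (-2 * I * T) * hs j

theorem upper_trial_eq {i : Fin n} {a : Fin N ⊕ OffAxis N N₁}
    (h : ∀ c z, (∀ b, z ≠ conj (d.poleData.pt b)) →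
      d.trial x t U i (.inr c) z = d.solRow x t i (.inr c) z) :
    d.poleData.upper x t (d.trial x t U i) a
      =ᶠ[𝓝 (d.poleData.pt a)] d.poleData.upper x t (d.solRow x t i) a := by
  filter_upwards [d.eventually_ne_conj_pt a] with z hz
  simp only [PoleData.upper, h _ z hz]

/-- The algebraic system has no solution besides the derivatives of `F₁` and `F₂`. -/
theorem SolvesSystem.eq_solJets (h : d.SolvesSystem x t U) : U = d.solJets x t := by
  rw [solvesSystem_iff] at h
  refine ext_of_taylor fun i a j hj => ?_
  rw [iteratedDeriv_taylor_solJets d x t i a j hj]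
  -- The trial row of a solution satisfies the row problem, so it is the row of the true solution,
  -- and the vanishing defect then determines the jets of the unknowns.
  have h1 := (upper_trial_eq (a := a) fun c z hz => (isRow_trial (h i)).eq_right
    (isRow_solRow i) hz c).iteratedDeriv_eq j
  have h2 := (VanishesTo.sub_iff_iteratedDeriv ((isRow_trial (h i)).analyticAt_upper a a)
    (analyticAt_const.fun_mul (d.analyticAt_taylor U a i _))).1 (h i a) j (Nat.lt_succ_of_le hj)
  rw [← h1, h2, iteratedDeriv_const_mul_field]
  linear_combination iteratedDeriv j (fun z => d.taylor U a z i) (d.poleData.pt a) *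
    Complex.I_mul_I

variable (d x t)

theorem half_I_mul_iteratedDeriv_taylor_solJets (i : Fin n) (a : Fin N ⊕ OffAxis N N₁) (j : ℕ)
    (hj : j ≤ d.poleData.ord a) :
    iteratedDeriv j (fun z => I / 2 * d.taylor (d.solJets x t) a z i) (d.poleData.pt a)
      = iteratedDeriv j (d.poleData.upper x t (d.solRow x t i) a) (d.poleData.pt a) := by
  rw [iteratedDeriv_const_mul_field, d.iteratedDeriv_taylor_solJets x t i a j hj]
  linear_combination (-iteratedDeriv j (d.poleData.upper x t (d.solRow x t i) a)
    (d.poleData.pt a)) * Complex.I_mul_I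

/-- Principal parts depend only on jets up to `ord`, and those formed with the true solution
reproduce its partial fraction expansion. -/
theorem trialLeft_solJets (i : Fin n) {z : ℂ} (hz : ∀ a, z ≠ d.poleData.pt a) :
    d.trialLeft (d.solJets x t) i z = d.solRow x t i (.inl ()) z := by
  rw [(isRow_solRow i).left_eq_sum hz, Matrix.one_apply_ne (by simp), zero_add, trialLeft]
  exact Finset.sum_congr rfl fun a _ => principalPart_congr (fun j hj =>
    d.half_I_mul_iteratedDeriv_taylor_solJets x t i a j (Nat.lt_succ_iff.1 hj)) z

theorem trial_solJets_right (i c : Fin n) {z : ℂ} (hz : ∀ a, z ≠ conj (d.poleData.pt a)) :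
    d.trial x t (d.solJets x t) i (.inr c) z = d.solRow x t i (.inr c) z := by
  rw [(isRow_solRow i).right_eq_sum hz, trial, Sum.elim_inr]
  refine congrArg _ (Finset.sum_congr rfl fun a _ => principalPart_congr_nhds ?_ z)
  have h1 : ∀ᶠ z in 𝓝 (conj (d.poleData.pt a)), ∀ b, z ≠ d.poleData.pt b :=
    eventually_all.2 fun b => eventually_ne_nhds (PoleData.conj_pt_ne_pt a b)
  filter_upwards [h1] with w hw
  simp only [PoleData.lower, d.trialLeft_solJets x t i hw]

theorem solvesSystem_solJets : d.SolvesSystem x t (d.solJets x t) := by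
  rw [solvesSystem_iff]
  intro i a
  have h1 := upper_trial_eq (a := a) fun c z hz => d.trial_solJets_right x t i c hz
  have h0 := (isRow_solRow (d := d) (x := x) (t := t) i).analyticAt_upper a a
  have h2 := (VanishesTo.sub_iff_iteratedDeriv (N := d.poleData.ord a + 1) h0
    (analyticAt_const.fun_mul (d.analyticAt_taylor (d.solJets x t) a i _))).2 fun j hj =>
    (d.half_I_mul_iteratedDeriv_taylor_solJets x t i a j (Nat.lt_succ_iff.1 hj)).symm
  refine h2.congr ?_
  filter_upwards [h1] with z hz
  rw [defect, hz]

theorem solitonFormula_apply (U : d.Unknowns) (i : Fin n) : d.solitonFormula U i = -2 * I *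
    ∑ a, iteratedDeriv (d.poleData.ord a) (fun z => I / 2 * d.taylor U a z i) (d.poleData.pt a)
      / (d.poleData.ord a)! := by
  have hs : ∀ m : ℕ, ((-1 : ℂ) ^ m) * (-1) ^ m = 1 := fun m => by rw [← mul_pow]; simp
  rw [Finset.mul_sum, Fintype.sum_sum_type, solitonFormula, Pi.add_apply, Finset.sum_apply,
    Finset.sum_apply]
  congr 1
  · refine Finset.sum_congr rfl fun k _ => ?_
    have h1 := iteratedDeriv_taylor_inl (U := U) k i (Fin.last _)
    rw [iteratedDeriv_const_mul_field]
    rw [Fin.val_last] at h1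
    rw [poleData_ord_inl, h1, Pi.smul_apply, smul_eq_mul]
    linear_combination (((d.m k)! : ℂ)⁻¹ * U.1 k (Fin.last _) i) * Complex.I_mul_I
  · refine Finset.sum_congr rfl fun k _ => ?_
    have h1 := iteratedDeriv_taylor_inr (U := U) k i (Fin.last _)
    rw [iteratedDeriv_const_mul_field]
    rw [Fin.val_last, ← mul_assoc, hs, one_mul] at h1
    rw [poleData_ord_inr, h1, Pi.smul_apply, smul_eq_mul]
    linear_combination (((d.m k)! : ℂ)⁻¹ * U.2 k (Fin.last _) i) * Complex.I_mul_I

/-- The `1/z` coefficient of a sum of principal parts is the sum of their residues, which are the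
top Taylor coefficients of the densities; compare with `z M_DL` at infinity. -/
theorem potential_eq_solitonFormula :
    (fun i => (((d.poleData.potential x t i).re : ℝ) : ℂ)) = d.solitonFormula (d.solJets x t) := by
  ext i
  rw [Complex.conj_eq_iff_re.1 (d.potential_real x t i), solitonFormula_apply, PoleData.potential]
  congr 1
  refine tendsto_nhds_unique (PoleData.tendsto_mul_sol (D := d.poleData) x t (i := .inr i)
    (j := .inl ()) (by simp)) ?_
  have h1 := tendsto_finsetSum Finset.univ fun a (_ : a ∈ Finset.univ) =>
    tendsto_mul_principalPart (fun ν => I / 2 * d.taylor (d.solJets x t) a ν i)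
      (d.poleData.pt a) (d.poleData.ord a)
  refine h1.congr' ?_
  filter_upwards [d.poleData.poles_finite.isBounded] with z hz
  rw [← Finset.mul_sum]
  congr 1
  exact d.trialLeft_solJets x t i (PoleData.ne_of_notMem_poles hz).1

variable {d x t}

/-- Both jets involve the right columns only near upper poles, since `F₂` evaluates `M` at `-z`.
There these columns agree with those of `sol` in a full neighbourhood, the pole included. -/
theorem IsRHSolution.jets_eq {M : ℂ → BlockMat n} (h : d.IsRHSolution 0 x t M) :
    d.jets (d.F₁ x t M) (d.F₂ x t M) = d.solJets x t := by
  have hev : ∀ p ∈ d.upperPoles, ∀ᶠ z in 𝓝 p,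
      (M z).toBlocks₂₂ = (d.poleData.sol x t z).toBlocks₂₂ := by
    intro p hp
    have h1 : ∀ᶠ z : ℂ in 𝓝 p, 0 < z.im :=
      Complex.continuous_im.continuousAt.eventually (lt_mem_nhds (im_pos_of_mem hp))
    filter_upwards [h1] with z hz
    ext i j
    exact h.eq_sol_right hz.ne' (fun hl => lt_asymm hz (im_neg_of_mem hl)) (.inr i) j
  refine Prod.ext ?_ ?_
  · ext k j : 2
    refine Filter.EventuallyEq.iteratedDeriv_eq _ ?_
    filter_upwards [hev (d.pole k) ⟨k, .inl rfl⟩] with z hz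
    rw [F₁, F₁, hz]
  · ext k j : 2
    refine Filter.EventuallyEq.iteratedDeriv_eq _ ?_
    have ht : Tendsto (fun z : ℂ => -z) (𝓝 (conj (d.pole k))) (𝓝 (-conj (d.pole k))) :=
      continuous_neg.tendsto _
    filter_upwards [ht.eventually (hev (-conj (d.pole k)) ⟨k, .inr rfl⟩)] with z hz
    rw [F₂, F₂, hz]

end DiscreteData

end

end VmKdV

theorem mainTheorem1 {n N N₁ : ℕ} (d : VmKdV.DiscreteData n N N₁) :
    ∃ q : ℝ → ℝ → Fin n → ℝ, VmKdV.IsVmKdVSolution q ∧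
      ∀ x t : ℝ,
        (∃ M, d.IsRHSolution 0 x t M) ∧
        (∀ M M', d.IsRHSolution 0 x t M → d.IsRHSolution 0 x t M' → ∀ z ∈ d.domain, M z = M' z) ∧
        (∃! U : d.Unknowns, d.SolvesSystem x t U) ∧
        (∀ M, d.IsRHSolution 0 x t M →
          VmKdV.DiscreteData.Reconstructs M (q x t) ∧
          d.SolvesSystem x t (d.jets (d.F₁ x t M) (d.F₂ x t M)) ∧
          (fun i => (q x t i : ℂ)) = d.solitonFormula (d.jets (d.F₁ x t M) (d.F₂ x t M))) ∧
        (∀ U : d.Unknowns, d.SolvesSystem x t U →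
          (fun i => (q x t i : ℂ)) = d.solitonFormula U) := by
  refine ⟨fun x t i => (d.poleData.potential x t i).re,
    d.poleData.isVmKdVSolution d.potential_real, fun x t => ⟨⟨_, d.isRHSolution_sol x t⟩, ?_,
    ⟨_, d.solvesSystem_solJets x t, fun U hU => hU.eq_solJets⟩, fun M hM => ?_, fun U hU => ?_⟩⟩
  · exact fun M M' hM hM' z hz => (hM.eq_sol hz).trans (hM'.eq_sol hz).symm
  · rw [hM.jets_eq]
    exact ⟨hM.reconstructs, d.solvesSystem_solJets x t, d.potential_eq_solitonFormula x t⟩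
  · rw [hU.eq_solJets]
    exact d.potential_eq_solitonFormula x t
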